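/- **Setting.** Write $\mathbb Z^+=\{1,2,\dots\}$. *Gibbs-Markov maps.* Let $(Y,\mu_Y)$ be a probability space with an at most countable measurable partition $\alpha$ and let $F:Y\to Y$ be an ergodic measure-preserving map. For $y\ne y'$ in $Y$ let the separation time $s(y,y')$ be the least $n\ge 0$ such that $F^ny$ and $F^ny'$ lie in distinct elements of $\alpha$; it is assumed to be finite whenever $y\neq y'$. $F$ is a *full-branch Gibbs-Markov map* if for each $a\in\alpha$ the restriction $F|_a:a\to Y$ is a bimeasurable bijection, and there are a version $\xi>0$ of the density $d\mu_Y/d(\mu_Y\circ F)$ and constants $C_0>0$, $\theta_0\in(0,1)$ with $|\log\xi(y)-\log\xi(y')|\le C_0\theta_0^{s(y,y')}$ for all $y\neq y'$ in $a$, $a\in\alpha$. *Young towers.* Let $g$ be an ergodic measure-preserving map of a probability space $(N,\nu)$. We say that $g$ is *modelled by a Young tower* $Y^\tau$ if $Y\subset N$ is measurable with $\nu(Y)>0$, $\tau:Y\to\mathbb Z^+$ is such that $F=g^\tau$ maps $Y$ into $Y$ and is a full-branch Gibbs-Markov map for some probability measure $\mu_Y$ and partition $\alpha$ of $Y$, $\tau$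 is $\mu_Y$-integrable and constant on the elements of $\alpha$, and $\nu$ is the push-forward under $(y,\ell)\mapsto g^\ell y$ of the probability measure $(\mu_Y\times\text{counting})/\int_Y\tau\,d\mu_Y$ on $\{(y,\ell)\in Y\times\mathbb Z:0\le\ell\le\tau(y)-1\}$. *Chernov-Markarian-Zhang structures.* Let $f:M\to M$ be an ergodic and mixing measure-preserving map of a probability space $(M,\mu)$. A (one-sided) *Chernov-Markarian-Zhang structure* for $f$ consists of measurable sets $Y\subset X\subset M$ with $\mu(Y)>0$ such that every $x\in X$ returns to $X$, the first return time $h(x)=\inf\{n\ge1:f^nx\in X\}$ is integrable on $X$, and the first return map $f_X=f^h:X\to X$ with the measure $\mu_X=\mu|_X/\mu(X)$ is modelled by a Young tower $Y^\sigma$, with return time $\sigma:Y\to\mathbb Z^+$, Gibbs-Markov map $F=f_X^\sigma:Y\to Y$, probability measure $\mu_Y$ and partition $\alpha$; moreover $h$ is constant on $f_X^\ell a$ for all $a\in\alpha$, $0\le\ell\le\sigma(a)-1$. Put $\varphi(y)=\sum_{\ell=0}^{\sigma(y)-1}h(f_X^\ell y)$ for $y\in Y$, and $\bar\varphi=\int_Y\varphi\,d\mu_Y$.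 *Observables.* Fix $\theta\in(0,1)$. For measurable $v:M\to\mathbb R$ let $$\|v\|_{\mathcal H}=|v|_\infty+\sup_{y\ne y'\in Y}\ \sup_{0\le\ell\le\varphi(y)-1}\frac{|v(f^\ell y)-v(f^\ell y')|}{\theta^{s(y,y')}},$$ where $|\cdot|_\infty$ is the norm of $L^\infty(M)=L^\infty(M,\mu)$. Let $\mathcal H(X)$ be the set of $v$ with $\|v\|_{\mathcal H}<\infty$ that vanish outside $X$, and let $L^\infty(X)$ be the set of $w\in L^\infty(M)$ that vanish almost everywhere on $M\setminus X$. Let $$\rho_{v,w}(n)=\int_M v\;w\circ f^n\,d\mu-\int_M v\,d\mu\int_M w\,d\mu .$$ **Theorem 3.1.** Let $f:M\to M$ have a Chernov-Markarian-Zhang structure as above, and suppose that $\mu_Y(\varphi>n)=O(n^{-\beta'})$ for $n\ge1$, where $\beta'>1$. Let $$\sigma_n=\int_Y\sigma 1_{\{\varphi>n\}}\,d\mu_Y,\qquad \gamma_n=\sum_{j=0}^n a_j\,\sigma_{n-j}\quad\text{with } a_0=1,\ a_j=j^{-\beta'}\ (j\ge1),$$ $$\zeta_{\beta'}(n)=\begin{cases}n^{-\beta'}&\beta'>2\\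 n^{-2}\log n&\beta'=2\\ n^{-2(\beta'-1)}&1<\beta'<2.\end{cases}$$ Then there is a constant $C>0$, independent of $n$, $v$ and $w$, such that for all $n\ge1$: (a) for all $v\in\mathcal H(X)$ and $w\in L^\infty(X)$, $$\Big|\rho_{v,w}(n)-\bar\varphi^{-1}\sum_{j>n}\mu_Y(\varphi>j)\int_Mv\,d\mu\int_Mw\,d\mu\Big|\le C\|v\|_{\mathcal H}\,|w|_\infty\,(\gamma_n+\zeta_{\beta'}(n));$$ (b) for all $v\in\mathcal H(X)$ with $\int_Mv\,d\mu=0$ and all $w\in L^\infty(M)$, $$|\rho_{v,w}(n)|\le C\|v\|_{\mathcal H}\,|w|_\infty\,\gamma_n.$$ -/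

import Mathlib

open MeasureTheory Filter Topology
open scoped ENNReal

noncomputable section

namespace CMZ

/-! ### Full-branch Gibbs-Markov maps -/

section GibbsMarkov

variable {Y : Type*}

/-- The points `y`, `y'` lie in distinct elements of the partition `α`. -/
def InDistinct (α : Set (Set Y)) (y y' : Y) : Prop :=
  ∀ a ∈ α, y ∈ a → y' ∉ a

/-- The separation time `s(y,y')`: the least `n ≥ 0` such that `F^n y`, `F^n y'` lie in distinct
elements of `α`. It is only used for `y ≠ y'`, where such an `n` exists as soon as `α` separates
trajectories (otherwise the value is the junk value `0`). -/
def sepTime (F : Y → Y) (α : Set (Set Y)) (y y' : Y) : ℕ :=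
  sInf {n | InDistinct α (F^[n] y) (F^[n] y')}

/-- `F` is a full-branch Gibbs-Markov map on the probability space `(Y, μ)` with respect to the at
most countable measurable partition `α`. -/
structure IsFullBranchGibbsMarkov [MeasurableSpace Y] (μ : Measure Y) (F : Y → Y)
    (α : Set (Set Y)) : Prop where
  isProbabilityMeasure : IsProbabilityMeasure μ
  /-- `F` is measure preserving and ergodic -/
  ergodic : Ergodic F μ
  countable : α.Countable
  isPartition : Setoid.IsPartition α
  measurableSet : ∀ a ∈ α, MeasurableSet a
  /-- the partition separates trajectories -/
  separates : ∀ y y' : Y, y ≠ y' → ∃ n, InDistinct α (F^[n] y) (F^[n] y')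
  /-- `F` restricted to `a` is injective, measurable, and images of measurable sets are
  measurable -/
  measurableEmbedding : ∀ a ∈ α, MeasurableEmbedding (a.domRestrict F)
  /-- `F` maps `a` onto `Y` -/
  surjective : ∀ a ∈ α, Function.Surjective (a.domRestrict F)
  /-- There is a version `ξ` of the density `dμ / d(μ ∘ F)` (where `μ ∘ F` is, on each `a`, the
  measure `E ↦ μ (F E)`) such that `log ξ` is Lipschitz for the metric `θ ^ s(y,y')` on
  each `a`. -/
  bounded_distortion : ∃ ξ : Y → ℝ, Measurable ξ ∧ (∀ y, 0 < ξ y) ∧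
    (∀ a ∈ α, μ.comap (Subtype.val : a → Y) =
      (μ.comap (a.domRestrict F)).withDensity fun y => ENNReal.ofReal (ξ y)) ∧
    ∃ C θ : ℝ, 0 < C ∧ 0 < θ ∧ θ < 1 ∧ ∀ a ∈ α, ∀ y ∈ a, ∀ y' ∈ a, y ≠ y' →
      |Real.log (ξ y) - Real.log (ξ y')| ≤ C * θ ^ sepTime F α y y'

/-! ### Young towers -/

/-- The tower `Y^φ = {(y,ℓ) : 0 ≤ ℓ ≤ φ(y) - 1}`. -/
def tower (φ : Y → ℕ) : Set (Y × ℕ) := {p | p.2 < φ p.1}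

/-- The measure `(μ × counting) / ∫ φ dμ` on the tower `Y^φ`, as a measure on `Y × ℕ`. -/
def towerMeasure [MeasurableSpace Y] (μ : Measure Y) (φ : Y → ℕ) : Measure (Y × ℕ) :=
  ENNReal.ofReal (∫ y, (φ y : ℝ) ∂μ)⁻¹ • (μ.prod Measure.count).restrict (tower φ)

end GibbsMarkov

variable {M : Type*}

/-- The map `f` on `(M, μ)` is modelled by the Young tower `Y^φ` over the full-branch Gibbs-Markov
map `F = f^φ : Y → Y` with invariant probability measure `μY` and partition `α`. -/
structure IsModelledByTower [MeasurableSpace M] (f : M → M) (μ : Measure M) (Y : Set M)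
    (μY : Measure Y) (F : Y → Y) (α : Set (Set Y)) (φ : Y → ℕ) : Prop where
  /-- `f` is measure preserving and ergodic -/
  ergodic : Ergodic f μ
  measurableSet : MeasurableSet Y
  pos : 0 < μ Y
  gibbsMarkov : IsFullBranchGibbsMarkov μY F α
  time_pos : ∀ y, 1 ≤ φ y
  time_const : ∀ a ∈ α, ∀ y ∈ a, ∀ y' ∈ a, φ y = φ y'
  time_integrable : Integrable (fun y => (φ y : ℝ)) μY
  /-- `F = f^φ` (in particular `φ` is a return time to `Y`) -/
  map_eq : ∀ y : Y, (F y : M) = f^[φ y] y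
  /-- the projection `π_M (y,ℓ) = f^ℓ y` carries the tower measure to `μ` -/
  map_towerMeasure : (towerMeasure μY φ).map (fun p => f^[p.2] (p.1 : M)) = μ

/-! ### Chernov-Markarian-Zhang structures -/

/-- `f` is mixing for the measure `μ`. -/
def IsMixing [MeasurableSpace M] (f : M → M) (μ : Measure M) : Prop :=
  ∀ A B : Set M, MeasurableSet A → MeasurableSet B →
    Tendsto (fun n : ℕ => μ (A ∩ f^[n] ⁻¹' B)) atTop (𝓝 (μ A * μ B))

/-- The first return time `h(x) = inf {n ≥ 1 : f^n x ∈ X}`. -/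
def firstReturnTime (f : M → M) (X : Set M) (x : M) : ℕ :=
  sInf {n | 1 ≤ n ∧ f^[n] x ∈ X}

/-- The first return map `f_X = f^h`. Only its values on `X` matter. -/
def firstReturnMap (f : M → M) (X : Set M) (x : M) : M :=
  f^[firstReturnTime f X x] x

/-- A (one-sided) Chernov-Markarian-Zhang structure for `f` on the probability space `(M, μ)`. -/
structure Structure [MeasurableSpace M] (f : M → M) (μ : Measure M) where
  ergodic : Ergodic f μ
  mixing : IsMixing f μ
  /-- the set on which the first return map is taken -/
  X : Set M
  /-- the base of the tower -/
  Y : Set M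
  measurableSet_X : MeasurableSet X
  Y_subset_X : Y ⊆ X
  /-- every point of `X` returns to `X` -/
  returns : ∀ x ∈ X, ∃ n, 1 ≤ n ∧ f^[n] x ∈ X
  integrable_firstReturnTime : IntegrableOn (fun x => (firstReturnTime f X x : ℝ)) X μ
  /-- the probability measure on `Y` -/
  μY : Measure Y
  /-- the Gibbs-Markov map -/
  F : Y → Y
  /-- the partition of `Y` -/
  α : Set (Set Y)
  /-- the return time to `Y` under the first return map -/
  σ : Y → ℕ
  /-- the first return map, with the normalised restriction of `μ` to `X`, is modelled by the
  tower `Y^σ` -/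
  modelled : IsModelledByTower (firstReturnMap f X) (ProbabilityTheory.cond μ X) Y μY F α σ
  /-- `h` is constant on `f_X^ℓ a` for `a ∈ α`, `0 ≤ ℓ ≤ σ(a) - 1` -/
  firstReturnTime_const : ∀ a ∈ α, ∀ y ∈ a, ∀ y' ∈ a, ∀ ℓ < σ y,
    firstReturnTime f X ((firstReturnMap f X)^[ℓ] y) =
      firstReturnTime f X ((firstReturnMap f X)^[ℓ] y')

namespace Structure

variable [MeasurableSpace M] {f : M → M} {μ : Measure M} (S : Structure f μ)

/-- The induced return time `φ(y) = ∑_{ℓ < σ(y)} h(f_X^ℓ y)`. -/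
def φ (y : S.Y) : ℕ :=
  ∑ ℓ ∈ Finset.range (S.σ y), firstReturnTime f S.X ((firstReturnMap f S.X)^[ℓ] y)

/-- The mean `∫_Y φ dμ_Y` of the induced return time. -/
def φbar : ℝ := ∫ y, (S.φ y : ℝ) ∂S.μY

/-- The tail `μ_Y(φ > n)`. -/
def tail (n : ℕ) : ℝ := S.μY.real {y | n < S.φ y}

/-- `σ_n = ∫_Y σ 1_{φ > n} dμ_Y`. -/
def σseq (n : ℕ) : ℝ := ∫ y, {y | n < S.φ y}.indicator (fun y => (S.σ y : ℝ)) y ∂S.μY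

/-- The seminorm `|v|_H` with values in `[0,∞]`: the supremum of
`|v(f^ℓ y) - v(f^ℓ y')| / θ^{s(y,y')}` over `y ≠ y'` in `Y` and `0 ≤ ℓ ≤ φ(y) - 1`. -/
def dynSeminorm (θ : ℝ) (v : M → ℝ) : ℝ≥0∞ :=
  ⨆ (y : S.Y) (y' : S.Y) (_ : y ≠ y') (ℓ : ℕ) (_ : ℓ < S.φ y),
    ENNReal.ofReal (|v (f^[ℓ] y) - v (f^[ℓ] y')| / θ ^ sepTime S.F S.α y y')

/-- The norm `‖v‖_H = |v|_∞ + |v|_H`, with values in `[0,∞]`. -/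
def dynNorm (θ : ℝ) (v : M → ℝ) : ℝ≥0∞ :=
  eLpNorm v ∞ μ + S.dynSeminorm θ v

/-- The space `H(X)` of dynamically Hölder observables that vanish outside `X`. -/
def dynHolder (θ : ℝ) : Set (M → ℝ) :=
  {v | AEStronglyMeasurable v μ ∧ S.dynNorm θ v < ∞ ∧ ∀ x, x ∉ S.X → v x = 0}

end Structure

/-! ### Correlations and rates -/

/-- The correlation function `ρ_{v,w}(n) = ∫ v · w ∘ f^n dμ - ∫ v dμ ∫ w dμ`. -/
def corr [MeasurableSpace M] (f : M → M) (μ : Measure M) (v w : M → ℝ) (n : ℕ) : ℝ :=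
  ∫ x, v x * w (f^[n] x) ∂μ - (∫ x, v x ∂μ) * ∫ x, w x ∂μ

/-- The sequence `n^{-β}`, with the value `1` at `n = 0`. -/
def powSeq (β : ℝ) (n : ℕ) : ℝ := if n = 0 then 1 else (n : ℝ) ^ (-β)

/-- Convolution `(a ⋆ b)_n = ∑_{j=0}^n a_j b_{n-j}` of sequences. -/
def conv (a b : ℕ → ℝ) (n : ℕ) : ℝ := ∑ j ∈ Finset.range (n + 1), a j * b (n - j)

/-- The rate `ζ_β(n)` (used for `β > 1` and `n ≥ 1`). -/
def zeta (β : ℝ) (n : ℕ) : ℝ :=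
  if 2 < β then (n : ℝ) ^ (-β)
  else if β = 2 then (n : ℝ) ^ (-2 : ℝ) * Real.log n
  else (n : ℝ) ^ (-(2 * (β - 1)))

/-- `γ_n = n^{-β} ⋆ σ_n`. -/
def Structure.γ [MeasurableSpace M] {f : M → M} {μ : Measure M} (S : Structure f μ) (β : ℝ)
    (n : ℕ) : ℝ :=
  conv (powSeq β) S.σseq n

end CMZ

end

noncomputable section

namespace CMZ

/-! The proof is renewal theory for densities on the base `Y`, carried out with generating functions
whose coefficients are compared one by one (`Maj`). Write β for the tail exponent.

Reduction to an aperiodic tower. Let `d` be the greatest common divisor of the values of φ. Mixing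
makes `f^[d]` ergodic, so μ is the projection of the tower of `f^[d]` with height φ/d
(`lintegral_eq_lintegral_sum_tower`). Integrals over `M` become integrals over `Y` of sums along
columns, and from there on the height is aperiodic and is again called φ. The observable `w` is
split into nonnegative parts.

Regeneration. A density whose logarithm is Hölder becomes more regular when it is pushed through a
branch of `F`. A fixed fraction κ of its mass can therefore be split off as a multiple of the
invariant measure while the remainder stays in the same cone (`exists_regeneration`). Thus mass
returning to the base regenerates with probability κ at every return. The probability of not having
regenerated by time `n` satisfies a recursive inequality that forces decay like n^{-β}
(`regenTail_rec`, `exists_decay_bound`). After the first regeneration the density is constant, so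
everything reduces to the scalar renewal equation for the first regeneration time
(`renewalSeries_eq`).

Scalar renewal theory. For an aperiodic law `p`, the series D = (1-p)/(1-z) of tails has no zero in
the closed disc. A Wiener lemma (`exists_maj_of_mul_eq_one`) then gives 1/D = O(n^{-β}). With m =
D(1) and t = (m-D)/(1-z), substituting 1/D = 1/m + (1-z)t/(mD) twice yields the expansion 1/(1-p) =
1/(m(1-z)) + t/m² + (1-z)t²/(m²D), whose last term is O(n^{-β}(1+∑_{k≤n} k^{1-β}))
(`IsAperiodicProb.exists_maj_renewal_sub`).

Back to the base. Let K_n W be the sum of W∘F^k over the returns occurring exactly at time n. Up to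
O(n^{-β}), the integral of g K_n W depends on `g` and on `W` only through their masses
(`exists_maj_renewalSeries_sub`, `exists_maj_renewalSeries_sub_mass`); the second fact uses
ergodicity of `F`. Decomposing the constant 1 according to the last visit to the base then compares
the integral of K_n 1 with the renewal sequence of the law of φ itself. This is how the tails of φ,
rather than those of the regeneration time, enter the second order term.

Correlations. Split `v` by the number of steps left before the base is reached. The levels from
which the base is reached within `n` steps decorrelate, with a total error given by a convolution of
two sequences n^{-β}. The remaining points have φ > n, and there a column sum of `v` is at most a
multiple of σ, since `v` lives on `X` and a column meets `X` only σ times. So the correlation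
integral equals the integral of `v` times Ω_n, the integral of `w` followed for time `n` from the
base, up to O(γ_n) (`exists_abs_towerCorr_sub_le`). For centred `v` this is part (b). If `w` lives
on `X` too, Ω_n has an explicit expansion (`exists_maj_towerSeries_expansion`), which gives part
(a); `exists_rate_le_zeta` turns the remainder into n^{-β} + ζ_β(n), and n^{-β} ≤ γ_n because σ_0 ≥
1. -/

open PowerSeries in
/-- Coefficientwise majorisation of power series. -/
def Maj (f g : PowerSeries ℝ) : Prop := ∀ n, |coeff n f| ≤ coeff n g

/-! ### Calculus of majorants -/

namespace Maj

open PowerSeries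

variable {f g f' g' h : PowerSeries ℝ}

theorem nonneg (H : Maj f g) (n : ℕ) : 0 ≤ coeff n g := (abs_nonneg _).trans (H n)

theorem trans (H : Maj f g) (H' : Maj g h) : Maj f h := fun n =>
  (H n).trans ((le_abs_self _).trans (H' n))

theorem of_nonneg (H : ∀ n, 0 ≤ coeff n f) : Maj f f := fun n => (abs_of_nonneg (H n)).le

theorem add (H : Maj f g) (H' : Maj f' g') : Maj (f + f') (g + g') := fun n => by
  simpa using (abs_add_le _ _).trans (add_le_add (H n) (H' n))

theorem neg (H : Maj f g) : Maj (-f) g := fun n => by simpa using H n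

theorem sub (H : Maj f g) (H' : Maj f' g') : Maj (f - f') (g + g') := by
  simpa [sub_eq_add_neg] using H.add H'.neg

theorem mul (H : Maj f g) (H' : Maj f' g') : Maj (f * f') (g * g') := fun n => by
  rw [coeff_mul, coeff_mul]
  refine (Finset.abs_sum_le_sum_abs _ _).trans (Finset.sum_le_sum fun p _ => ?_)
  rw [abs_mul]
  exact mul_le_mul (H _) (H' _) (abs_nonneg _) (H.nonneg _)

theorem smul (H : Maj f g) (c : ℝ) : Maj (c • f) (|c| • g) := fun n => by
  simpa [abs_mul] using mul_le_mul_of_nonneg_left (H n) (abs_nonneg c)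

theorem smul_of_nonneg (H : Maj f g) {c : ℝ} (hc : 0 ≤ c) : Maj (c • f) (c • g) := by
  simpa [abs_of_nonneg hc] using H.smul c

theorem mono {c d : ℝ} (H : Maj f (c • g)) (hg : ∀ n, 0 ≤ coeff n g) (hcd : c ≤ d) :
    Maj f (d • g) := fun n => (H n).trans <| by
  simpa using mul_le_mul_of_nonneg_right hcd (hg n)

theorem smul_mul_smul {c d : ℝ} (H : Maj f (c • g)) (H' : Maj f' (d • g')) :
    Maj (f * f') ((c * d) • (g * g')) := by
  have := H.mul H'
  rwa [smul_mul_smul_comm] at this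

end Maj

/-! ### Polynomial sequences -/

section PowSeq

variable {β : ℝ}

theorem powSeq_zero (β : ℝ) : powSeq β 0 = 1 := by simp [powSeq]

theorem powSeq_of_ne {n : ℕ} (hn : n ≠ 0) : powSeq β n = (n : ℝ) ^ (-β) := by simp [powSeq, hn]

theorem powSeq_pos (β : ℝ) (n : ℕ) : 0 < powSeq β n := by
  unfold powSeq
  split_ifs with h
  · norm_num
  · positivity

theorem powSeq_nonneg (β : ℝ) (n : ℕ) : 0 ≤ powSeq β n := (powSeq_pos β n).le

/-- `n^{-β}` does not increase by more than `c^β` if `n` decreases by a factor of at most `c`. -/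
theorem powSeq_le_of_le_mul (hβ : 0 ≤ β) {c : ℝ} (hc : 1 ≤ c) {i n : ℕ} (h : (n : ℝ) ≤ c * i) :
    powSeq β i ≤ c ^ β * powSeq β n := by
  have hc0 : (0:ℝ) < c := by linarith
  rcases eq_or_ne i 0 with rfl | hi
  · have : n = 0 := by
      have : (n : ℝ) ≤ 0 := by simpa using h
      exact_mod_cast le_antisymm this (Nat.cast_nonneg n)
    subst this
    simpa [powSeq_zero] using Real.one_le_rpow hc hβ
  rcases eq_or_ne n 0 with rfl | hn
  · rw [powSeq_of_ne hi, powSeq_zero, mul_one]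
    have h1 : (i : ℝ) ^ (-β) ≤ 1 :=
      Real.rpow_le_one_of_one_le_of_nonpos (by exact_mod_cast Nat.one_le_iff_ne_zero.2 hi)
        (by linarith)
    exact h1.trans (Real.one_le_rpow hc hβ)
  · rw [powSeq_of_ne hi, powSeq_of_ne hn]
    have hi' : (0:ℝ) < i := by positivity
    have hn' : (0:ℝ) < n := by positivity
    calc (i : ℝ) ^ (-β) = c ^ β * (c * i) ^ (-β) := by
          rw [Real.mul_rpow hc0.le hi'.le, ← mul_assoc, ← Real.rpow_add hc0]; simp
      _ ≤ c ^ β * (n : ℝ) ^ (-β) := by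
          refine mul_le_mul_of_nonneg_left ?_ (by positivity)
          exact Real.rpow_le_rpow_of_nonpos hn' h (by linarith)

theorem powSeq_anti (hβ : 0 ≤ β) {i j : ℕ} (h : i ≤ j) : powSeq β j ≤ powSeq β i := by
  rcases eq_or_ne i 0 with rfl | hi
  · rcases eq_or_ne j 0 with rfl | hj
    · rfl
    rw [powSeq_of_ne hj, powSeq_zero]
    exact Real.rpow_le_one_of_one_le_of_nonpos (by exact_mod_cast Nat.one_le_iff_ne_zero.2 hj)
        (by linarith)
  · rw [powSeq_of_ne hi, powSeq_of_ne (by omega)]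
    exact Real.rpow_le_rpow_of_nonpos (by positivity) (by exact_mod_cast h) (by linarith)

/-- This is the basis of all the convolution bounds that split at n/2: of two indices with sum n at
least one is ≥ n/2, and there the sequence is comparable with its value at n. -/
theorem powSeq_half (hβ : 0 ≤ β) {i n : ℕ} (h : n ≤ 2 * i) :
    powSeq β i ≤ 2 ^ β * powSeq β n :=
  powSeq_le_of_le_mul hβ one_le_two (by exact_mod_cast h)

theorem powSeq_le_of_le_mul_add_one (hβ : 0 ≤ β) {c : ℝ} (hc : 1 ≤ c) {i n : ℕ}
    (h : (n : ℝ) ≤ c * (i + 1)) : powSeq β i ≤ (2 * c) ^ β * powSeq β n := by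
  rcases eq_or_ne i 0 with rfl | hi
  · have := powSeq_le_of_le_mul hβ hc (i := 1) (n := n) (by simpa using h)
    rw [powSeq_of_ne one_ne_zero] at this
    simp only [Nat.cast_one, Real.one_rpow] at this
    rw [powSeq_zero]
    refine this.trans (mul_le_mul_of_nonneg_right ?_ (powSeq_nonneg _ _))
    exact Real.rpow_le_rpow (by linarith) (by linarith) hβ
  · refine powSeq_le_of_le_mul hβ (by linarith) (h.trans ?_)
    have : (1:ℝ) ≤ i := by exact_mod_cast Nat.one_le_iff_ne_zero.2 hi
    nlinarith

theorem summable_powSeq (hβ : 1 < β) : Summable (powSeq β) := by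
  have : Summable fun n : ℕ => (n : ℝ) ^ (-β) := Real.summable_nat_rpow.2 (by linarith)
  rw [← summable_nat_add_iff 1] at this ⊢
  exact this.congr fun n => (powSeq_of_ne (by omega)).symm

/-- The power series with coefficients `n^{-β}`. -/
def powSeries (β : ℝ) : PowerSeries ℝ := PowerSeries.mk (powSeq β)

@[simp] theorem coeff_powSeries (β : ℝ) (n : ℕ) :
    PowerSeries.coeff n (powSeries β) = powSeq β n := by simp [powSeries]

theorem coeff_powSeries_nonneg (β : ℝ) (n : ℕ) :
    0 ≤ PowerSeries.coeff n (powSeries β) := by simpa using powSeq_nonneg β n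

/-- Convolution of `n^{-β} w_n`, `w` nondecreasing, with `n^{-β}`. -/
theorem exists_maj_mul_powSeries (hβ : 1 < β) : ∃ K : ℝ, 0 < K ∧ ∀ w : ℕ → ℝ, Monotone w →
    (∀ n, 0 ≤ w n) →
    Maj (PowerSeries.mk (fun n => powSeq β n * w n) * powSeries β)
      (K • PowerSeries.mk (fun n => powSeq β n * w n)) := by
  have hβ0 : 0 ≤ β := by linarith
  have hs := summable_powSeq hβ
  set T := ∑' n, powSeq β n with hT
  have hTpos : 0 < T := by
    have := hs.le_tsum 0 fun j _ => powSeq_nonneg β j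
    rw [powSeq_zero] at this
    linarith
  refine ⟨2 ^ β * T + 2 ^ β * T, by positivity, fun w hw hw0 n => ?_⟩
  rw [abs_of_nonneg]
  swap
  · rw [PowerSeries.coeff_mul]
    refine Finset.sum_nonneg fun p _ => ?_
    simp only [PowerSeries.coeff_mk, coeff_powSeries]
    exact mul_nonneg (mul_nonneg (powSeq_nonneg _ _) (hw0 _)) (powSeq_nonneg _ _)
  rw [PowerSeries.coeff_mul]
  simp only [PowerSeries.coeff_mk, coeff_powSeries, map_smul, smul_eq_mul]
  -- The larger index supplies the factor `2 ^ β * powSeq β n` and the other one is left to be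
  -- summed; monotonicity of `w` replaces `w p.1` by `w n` in both cases.
  have key : ∀ p ∈ Finset.HasAntidiagonal.antidiagonal n, powSeq β p.1 * w p.1 * powSeq β p.2 ≤
      (2 ^ β * (powSeq β n * w n)) * powSeq β p.2 + (2 ^ β * (powSeq β n * w n)) * powSeq β p.1 := by
    intro p hp
    rw [Finset.HasAntidiagonal.mem_antidiagonal] at hp
    have hwp : w p.1 ≤ w n := hw (by omega)
    have h1 := powSeq_nonneg β p.1
    have h2 := powSeq_nonneg β p.2
    have h3 := powSeq_nonneg β n
    have h4 : (0:ℝ) ≤ 2 ^ β := by positivity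
    have hw1 := hw0 p.1
    have hwn := hw0 n
    rcases le_total n (2 * p.1) with h | h
    · have := powSeq_half hβ0 h
      refine le_add_of_le_of_nonneg ?_ (by positivity)
      refine mul_le_mul_of_nonneg_right ?_ h2
      calc powSeq β p.1 * w p.1 ≤ (2 ^ β * powSeq β n) * w n := mul_le_mul this hwp hw1 (by positivity)
        _ = _ := by ring
    · have := powSeq_half hβ0 (show n ≤ 2 * p.2 by omega)
      refine le_add_of_nonneg_of_le (by positivity) ?_
      calc powSeq β p.1 * w p.1 * powSeq β p.2
          ≤ powSeq β p.1 * w n * (2 ^ β * powSeq β n) :=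
            mul_le_mul (mul_le_mul_of_nonneg_left hwp h1) this h2 (by positivity)
        _ = _ := by ring
  refine (Finset.sum_le_sum key).trans ?_
  rw [Finset.sum_add_distrib, ← Finset.mul_sum, ← Finset.mul_sum]
  have e1 : ∑ p ∈ Finset.HasAntidiagonal.antidiagonal n, powSeq β p.1 ≤ T := by
    rw [Finset.Nat.sum_antidiagonal_eq_sum_range_succ (fun i _ => powSeq β i)]
    exact hs.sum_le_tsum _ fun i _ => powSeq_nonneg β i
  have e2 : ∑ p ∈ Finset.HasAntidiagonal.antidiagonal n, powSeq β p.2 ≤ T := by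
    rw [← Finset.Nat.sum_antidiagonal_swap]
    exact e1
  have h5 : 0 ≤ 2 ^ β * (powSeq β n * w n) := by
    have := powSeq_nonneg β n
    have := hw0 n
    positivity
  have := mul_le_mul_of_nonneg_left e1 h5
  have := mul_le_mul_of_nonneg_left e2 h5
  nlinarith

theorem exists_maj_powSeries_mul_self (hβ : 1 < β) :
    ∃ K : ℝ, 0 < K ∧ Maj (powSeries β * powSeries β) (K • powSeries β) := by
  obtain ⟨K, hK, H⟩ := exists_maj_mul_powSeries hβ
  refine ⟨K, hK, ?_⟩
  simpa [powSeries] using H (fun _ => 1) monotone_const fun _ => zero_le_one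

end PowSeq

/-! ### A Wiener lemma for polynomially decaying power series -/

section Wiener

/-- Cauchy's estimate on the circle of radius r < 1 gives M r^{-n}; then r tends to 1, because the
bound is assumed in the open disc only. -/
theorem norm_coeff_le_of_norm_tsum_le {c : ℕ → ℂ} {M : ℝ}
    (hs : ∀ r : ℝ, 0 ≤ r → r < 1 → Summable fun n => ‖c n‖ * r ^ n)
    (hM : ∀ z : ℂ, ‖z‖ < 1 → ‖∑' n, c n * z ^ n‖ ≤ M) (n : ℕ) : ‖c n‖ ≤ M := by
  have hM0 : 0 ≤ M := (norm_nonneg _).trans (hM 0 (by simp))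
  set p := FormalMultilinearSeries.ofScalars ℂ c with hp
  have hnorm : ∀ k, ‖p k‖ = ‖c k‖ := fun k =>
    FormalMultilinearSeries.ofScalars_norm ℂ c k
  have hrad : 1 ≤ p.radius := by
    refine ENNReal.le_of_forall_nnreal_lt fun r hr => ?_
    refine p.le_radius_of_summable ?_
    simp only [hnorm]
    exact hs r r.2 (by exact_mod_cast hr)
  have hball : HasFPowerSeriesOnBall p.sum p 0 p.radius :=
    p.hasFPowerSeriesOnBall (lt_of_lt_of_le one_pos hrad)
  have hsum : ∀ z, p.sum z = ∑' n, c n * z ^ n := fun z => by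
    simp [FormalMultilinearSeries.sum, hp, mul_comm]
  have hr : ∀ r : ℝ, 0 < r → r < 1 → ‖c n‖ ≤ M * (r⁻¹) ^ n := by
    intro r hr0 hr1
    lift r to NNReal using hr0.le
    have hr0' : (0 : NNReal) < r := by exact_mod_cast hr0
    have hdiff : DifferentiableOn ℂ p.sum (Metric.closedBall 0 r) := by
      refine hball.differentiableOn.mono fun z hz => ?_
      rw [Metric.mem_eball, edist_zero_right]
      refine lt_of_lt_of_le ?_ hrad
      rw [mem_closedBall_zero_iff] at hz
      have : ‖z‖ < 1 := lt_of_le_of_lt hz hr1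
      rw [← ofReal_norm]
      simpa using (ENNReal.ofReal_lt_one).2 this
    have h2 := (hdiff.hasFPowerSeriesOnBall hr0').hasFPowerSeriesAt
    have heq := hball.hasFPowerSeriesAt.eq_formalMultilinearSeries h2
    rw [← hnorm, heq]
    refine (norm_cauchyPowerSeries_le _ _ _ _).trans ?_
    have hab : |(r : ℝ)| = r := abs_of_pos hr0
    rw [hab]
    refine mul_le_mul_of_nonneg_right ?_ (by positivity)
    have hle : ∀ t : ℝ, ‖p.sum (circleMap 0 r t)‖ ≤ M := fun t => by
      rw [hsum]
      exact hM _ (by simpa [hab] using hr1)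
    have : ∫ t in (0:ℝ)..2 * Real.pi, ‖p.sum (circleMap 0 r t)‖ ≤ M * (2 * Real.pi) := by
      have h3 := intervalIntegral.norm_integral_le_of_norm_le_const (a := 0) (b := 2 * Real.pi)
        (f := fun t => ‖p.sum (circleMap 0 r t)‖) (C := M) (fun t _ => by simpa using hle t)
      have hpi := Real.pi_pos
      rw [sub_zero, abs_of_pos (by positivity)] at h3
      exact (le_abs_self _).trans h3
    have hpi := Real.pi_pos
    rw [inv_mul_le_iff₀ (by positivity)]
    linarith
  have hlim : Tendsto (fun r : ℝ => M * (r⁻¹) ^ n) (𝓝[<] 1) (𝓝 (M * (1⁻¹) ^ n)) := by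
    refine Tendsto.mono_left ?_ nhdsWithin_le_nhds
    exact ((tendsto_id.inv₀ one_ne_zero).pow n).const_mul M
  simp only [inv_one, one_pow, mul_one] at hlim
  refine ge_of_tendsto hlim ?_
  filter_upwards [Ioo_mem_nhdsLT (show (0:ℝ) < 1 by norm_num)] with r hr'
  exact hr r hr'.1 hr'.2

end Wiener

/-! ### Absolutely convergent series in the disc and inversion -/

section Wiener

open PowerSeries

/-- The power series converges absolutely in the open unit disc. -/
def DiscConv (f : PowerSeries ℝ) : Prop :=
  ∀ r : ℝ, 0 ≤ r → r < 1 → Summable fun n => |coeff n f| * r ^ n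

/-- The sum of a power series at a complex number. -/
def discEval (f : PowerSeries ℝ) (z : ℂ) : ℂ := ∑' n, ((coeff n f : ℝ) : ℂ) * z ^ n

variable {f g : PowerSeries ℝ}

theorem DiscConv.summable_norm (hf : DiscConv f) {z : ℂ} (hz : ‖z‖ < 1) :
    Summable fun n => ‖((coeff n f : ℝ) : ℂ) * z ^ n‖ := by
  simpa using hf ‖z‖ (norm_nonneg z) hz

theorem discConv_of_bounded {K : ℝ} (h : ∀ n, |coeff n f| ≤ K) : DiscConv f := fun r h0 h1 =>
  Summable.of_nonneg_of_le (fun n => by positivity)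
    (fun n => mul_le_mul_of_nonneg_right (h n) (by positivity))
    ((summable_geometric_of_lt_one h0 h1).mul_left K)

theorem coeff_mul_mul_pow (f g : PowerSeries ℝ) (z : ℂ) (n : ℕ) :
    ∑ p ∈ Finset.HasAntidiagonal.antidiagonal n,
      (((coeff p.1 f : ℝ) : ℂ) * z ^ p.1) * (((coeff p.2 g : ℝ) : ℂ) * z ^ p.2) =
    ((coeff n (f * g) : ℝ) : ℂ) * z ^ n := by
  rw [PowerSeries.coeff_mul, Complex.ofReal_sum, Finset.sum_mul]
  refine Finset.sum_congr rfl fun p hp => ?_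
  rw [Finset.HasAntidiagonal.mem_antidiagonal] at hp
  rw [← hp, pow_add]
  push_cast
  ring

theorem DiscConv.mul (hf : DiscConv f) (hg : DiscConv g) : DiscConv (f * g) := fun r h0 h1 => by
  have hz : ‖(r : ℂ)‖ < 1 := by simpa [abs_of_nonneg h0] using h1
  have := summable_norm_sum_mul_antidiagonal_of_summable_norm (hf.summable_norm hz)
    (hg.summable_norm hz)
  simp_rw [coeff_mul_mul_pow] at this
  simpa [abs_of_nonneg h0] using this

theorem discEval_mul (hf : DiscConv f) (hg : DiscConv g) {z : ℂ} (hz : ‖z‖ < 1) :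
    discEval (f * g) z = discEval f z * discEval g z := by
  rw [discEval, discEval, discEval, tsum_mul_tsum_eq_tsum_sum_antidiagonal_of_summable_norm
    (hf.summable_norm hz) (hg.summable_norm hz)]
  simp_rw [coeff_mul_mul_pow]

theorem discConv_one : DiscConv 1 := discConv_of_bounded (K := 1) fun n => by
  rw [coeff_one]; split_ifs <;> simp

@[simp] theorem discEval_one (z : ℂ) : discEval 1 z = 1 := by
  rw [discEval, tsum_eq_single 0]
  · simp
  · intro n hn; simp [coeff_one, hn]

theorem DiscConv.pow (hf : DiscConv f) (k : ℕ) : DiscConv (f ^ k) := by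
  induction k with
  | zero => simpa using discConv_one
  | succ k ih => rw [pow_succ]; exact ih.mul hf

theorem discEval_pow (hf : DiscConv f) {z : ℂ} (hz : ‖z‖ < 1) (k : ℕ) :
    discEval (f ^ k) z = discEval f z ^ k := by
  induction k with
  | zero => simp
  | succ k ih => rw [pow_succ, discEval_mul (hf.pow k) hf hz, ih, pow_succ]

/-- The growth in `k` is governed by the supremum over the disc and not by an ℓ¹ norm of the
coefficients. No ℓ¹ bound is available for the inverse series in the Wiener lemma, and the sup bound
is what makes its Neumann series converge. -/
theorem abs_coeff_pow_le (hf : DiscConv f) {M : ℝ}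
    (hM : ∀ z : ℂ, ‖z‖ < 1 → ‖discEval f z‖ ≤ M) (k n : ℕ) : |coeff n (f ^ k)| ≤ M ^ k := by
  have := norm_coeff_le_of_norm_tsum_le (c := fun n => ((coeff n (f ^ k) : ℝ) : ℂ)) (M := M ^ k)
    (fun r h0 h1 => by simpa using hf.pow k r h0 h1) (fun z hz => ?_) n
  · simpa using this
  · change ‖discEval (f ^ k) z‖ ≤ _
    rw [discEval_pow hf hz, norm_pow]
    exact pow_le_pow_left₀ (norm_nonneg _) (hM z hz) k

/-- The coefficients are absolutely summable, with sum at most `A`. -/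
def AbsSumLE (f : PowerSeries ℝ) (A : ℝ) : Prop :=
  (Summable fun n => |coeff n f|) ∧ ∑' n, |coeff n f| ≤ A

theorem AbsSumLE.nonneg {A : ℝ} (hf : AbsSumLE f A) : 0 ≤ A :=
  (tsum_nonneg fun _ => abs_nonneg _).trans hf.2

theorem AbsSumLE.mul {A B : ℝ} (hf : AbsSumLE f A) (hg : AbsSumLE g B) :
    AbsSumLE (f * g) (A * B) := by
  have hf' : Summable fun n => ‖|coeff n f|‖ := by simpa using hf.1
  have hg' : Summable fun n => ‖|coeff n g|‖ := by simpa using hg.1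
  have h1 : Summable fun n => ∑ p ∈ Finset.HasAntidiagonal.antidiagonal n, |coeff p.1 f| * |coeff p.2 g| :=
    (summable_norm_sum_mul_antidiagonal_of_summable_norm hf' hg').of_norm
  have hle : ∀ n, |coeff n (f * g)| ≤
      ∑ p ∈ Finset.HasAntidiagonal.antidiagonal n, |coeff p.1 f| * |coeff p.2 g| := fun n => by
    rw [PowerSeries.coeff_mul]
    refine (Finset.abs_sum_le_sum_abs _ _).trans (Finset.sum_le_sum fun p _ => ?_)
    rw [abs_mul]
  have h2 : Summable fun n => |coeff n (f * g)| :=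
    Summable.of_nonneg_of_le (fun _ => abs_nonneg _) hle h1
  refine ⟨h2, (h2.tsum_le_tsum hle h1).trans ?_⟩
  rw [← tsum_mul_tsum_eq_tsum_sum_antidiagonal_of_summable_norm hf' hg']
  exact mul_le_mul hf.2 hg.2 (tsum_nonneg fun _ => abs_nonneg _) hf.nonneg

theorem AbsSumLE.pow {A : ℝ} (hf : AbsSumLE f A) (k : ℕ) : AbsSumLE (f ^ k) (A ^ k) := by
  induction k with
  | zero =>
    have : ∀ n, n ≠ 0 → |coeff n (f ^ 0)| = 0 := fun n hn => by simp [coeff_one, hn]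
    refine ⟨summable_of_ne_finset_zero (s := {0}) fun n hn => this n (by simpa using hn), ?_⟩
    rw [tsum_eq_single 0 this]
    simp
  | succ k ih => rw [pow_succ, pow_succ]; exact ih.mul hf

theorem AbsSumLE.sum_le {A : ℝ} (hf : AbsSumLE f A) (s : Finset ℕ) :
    ∑ n ∈ s, |coeff n f| ≤ A :=
  (hf.1.sum_le_tsum s fun _ _ => abs_nonneg _).trans hf.2

variable {β : ℝ}

/-- Splitting at n/2 pairs the pointwise bound of one factor with the ℓ¹ norm of the other only. The
constant is thus linear in the ℓ¹ norms, so smallness in ℓ¹ survives even if `B` and `B'` are large.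
-/
theorem Maj.mul_of_absSumLE (hβ : 0 ≤ β) {A A' B B' : ℝ}
    (hf : AbsSumLE f A) (hg : AbsSumLE g A')
    (hf' : Maj f (B • powSeries β)) (hg' : Maj g (B' • powSeries β)) :
    Maj (f * g) ((2 ^ β * (B * A' + A * B')) • powSeries β) := fun n => by
  have hB : 0 ≤ B := by simpa [powSeq_zero] using hf'.nonneg 0
  have hB' : 0 ≤ B' := by simpa [powSeq_zero] using hg'.nonneg 0
  have h3 := powSeq_nonneg β n
  have h4 : (0:ℝ) ≤ 2 ^ β := by positivity
  have key : ∀ p ∈ Finset.HasAntidiagonal.antidiagonal n, |coeff p.1 f * coeff p.2 g| ≤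
      (B * (2 ^ β * powSeq β n)) * |coeff p.2 g| + (B' * (2 ^ β * powSeq β n)) * |coeff p.1 f| := by
    intro p hp
    rw [Finset.HasAntidiagonal.mem_antidiagonal] at hp
    rw [abs_mul]
    rcases le_total n (2 * p.1) with h | h
    · refine le_add_of_le_of_nonneg (mul_le_mul_of_nonneg_right ?_ (abs_nonneg _)) (by positivity)
      refine (hf' p.1).trans ?_
      simpa using mul_le_mul_of_nonneg_left (powSeq_half hβ h) hB
    · refine le_add_of_nonneg_of_le (by positivity) ?_
      rw [mul_comm]
      refine mul_le_mul_of_nonneg_right ?_ (abs_nonneg _)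
      refine (hg' p.2).trans ?_
      simpa using mul_le_mul_of_nonneg_left (powSeq_half hβ (show n ≤ 2 * p.2 by omega)) hB'
  rw [PowerSeries.coeff_mul]
  refine (Finset.abs_sum_le_sum_abs _ _).trans ((Finset.sum_le_sum key).trans ?_)
  rw [Finset.sum_add_distrib, ← Finset.mul_sum, ← Finset.mul_sum]
  have e1 : ∑ p ∈ Finset.HasAntidiagonal.antidiagonal n, |coeff p.1 f| ≤ A := by
    rw [Finset.Nat.sum_antidiagonal_eq_sum_range_succ (fun i _ => |coeff i f|)]
    exact hf.sum_le _
  have e2 : ∑ p ∈ Finset.HasAntidiagonal.antidiagonal n, |coeff p.2 g| ≤ A' := by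
    rw [← Finset.Nat.sum_antidiagonal_swap]
    simp only [Prod.snd_swap]
    rw [Finset.Nat.sum_antidiagonal_eq_sum_range_succ (fun i _ => |coeff i g|)]
    exact hg.sum_le _
  have := mul_le_mul_of_nonneg_left e1 (show 0 ≤ B' * (2 ^ β * powSeq β n) by positivity)
  have := mul_le_mul_of_nonneg_left e2 (show 0 ≤ B * (2 ^ β * powSeq β n) by positivity)
  simp only [map_smul, coeff_powSeries, smul_eq_mul]
  nlinarith

theorem exists_pow_le_mul_powSeq (β : ℝ) {ρ : ℝ} (h0 : 0 ≤ ρ) (h1 : ρ < 1) :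
    ∃ C : ℝ, 0 < C ∧ ∀ n, ρ ^ n ≤ C * powSeq β n := by
  have ht := tendsto_pow_const_mul_const_pow_of_abs_lt_one ⌈β⌉₊ (r := ρ)
    (by rwa [abs_of_nonneg h0])
  obtain ⟨C, hC⟩ := ht.bddAbove_range
  refine ⟨max C 1, by positivity, fun n => ?_⟩
  rcases eq_or_ne n 0 with rfl | hn
  · simp [powSeq_zero]
  rw [powSeq_of_ne hn]
  have hn' : (0:ℝ) < n := by positivity
  have hn1 : (1:ℝ) ≤ n := by exact_mod_cast Nat.one_le_iff_ne_zero.2 hn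
  have hle : (n : ℝ) ^ β ≤ (n : ℝ) ^ ⌈β⌉₊ := by
    rw [← Real.rpow_natCast]
    exact Real.rpow_le_rpow_of_exponent_le hn1 (Nat.le_ceil β)
  have h2 : (n : ℝ) ^ β * ρ ^ n ≤ max C 1 :=
    (mul_le_mul_of_nonneg_right hle (by positivity)).trans
      ((hC ⟨n, rfl⟩).trans (le_max_left _ _))
  rw [Real.rpow_neg hn'.le, ← div_eq_mul_inv, le_div_iff₀ (by positivity)]
  linarith

theorem absSumLE_of_le_geometric {G ρ : ℝ} (h0 : 0 ≤ ρ) (h1 : ρ < 1)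
    (h : ∀ n, |coeff n f| ≤ G * ρ ^ n) : AbsSumLE f (G * (1 - ρ)⁻¹) := by
  have hs := (summable_geometric_of_lt_one h0 h1).mul_left G
  have hs' : Summable fun n => |coeff n f| := Summable.of_nonneg_of_le (fun _ => abs_nonneg _) h hs
  refine ⟨hs', (hs'.tsum_le_tsum h hs).trans ?_⟩
  rw [tsum_mul_left, tsum_geometric_of_lt_one h0 h1]

/-- The coefficients of `f - f(ρ ·)` become small in `ℓ¹` as `ρ → 1`. -/
theorem exists_absSumLE_sub_rescale (hf : Summable fun n => |coeff n f|) {δ : ℝ} (hδ : 0 < δ) :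
    ∃ ρ : ℝ, 0 < ρ ∧ ρ < 1 ∧ AbsSumLE (f - rescale ρ f) δ := by
  have hco : ∀ ρ : ℝ, ∀ n, coeff n (f - rescale ρ f) = coeff n f * (1 - ρ ^ n) := fun ρ n => by
    rw [map_sub, coeff_rescale]; ring
  have hle : ∀ ρ : ℝ, 0 < ρ → ρ < 1 → ∀ n, |coeff n f * (1 - ρ ^ n)| ≤ |coeff n f| := by
    intro ρ h0 h1 n
    rw [abs_mul]
    refine mul_le_of_le_one_right (abs_nonneg _) ?_
    have := pow_le_one₀ (n := n) h0.le h1.le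
    have : 0 ≤ ρ ^ n := by positivity
    rw [abs_of_nonneg (by linarith)]
    linarith
  have hev : ∀ᶠ ρ : ℝ in 𝓝[<] 1, 0 < ρ ∧ ρ < 1 := by
    filter_upwards [Ioo_mem_nhdsLT (show (0:ℝ) < 1 by norm_num)] with r hr using hr
  have hlim : Tendsto (fun ρ : ℝ => ∑' n, |coeff n f * (1 - ρ ^ n)|) (𝓝[<] 1)
      (𝓝 (∑' n, |coeff n f * (1 - 1 ^ n)|)) := by
    refine tendsto_tsum_of_dominated_convergence hf (fun n => ?_) ?_
    · refine Tendsto.mono_left ?_ nhdsWithin_le_nhds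
      exact ((((tendsto_id.pow n).const_sub 1).const_mul _).abs)
    · filter_upwards [hev] with ρ hρ n
      simpa using hle ρ hρ.1 hρ.2 n
  simp only [one_pow, sub_self, mul_zero, abs_zero, tsum_zero] at hlim
  obtain ⟨ρ, hρ, hlt⟩ := (hev.and (hlim.eventually_lt_const hδ)).exists
  refine ⟨ρ, hρ.1, hρ.2, ?_⟩
  simp only [AbsSumLE, hco]
  exact ⟨Summable.of_nonneg_of_le (fun _ => abs_nonneg _) (hle ρ hρ.1 hρ.2) hf, hlt.le⟩

/-- Each further factor costs only `2 * 2 ^ β * δ`, whatever the pointwise constant `K`: a series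
that is small in ℓ¹ has geometrically small powers in the weighted sense. -/
theorem Maj.pow_of_absSumLE (hβ : 0 ≤ β) {δ K : ℝ} (hδ : 0 < δ)
    (hf : AbsSumLE f δ) (hf' : Maj f (K • powSeries β)) (k : ℕ) :
    Maj (f ^ k) (((2 * 2 ^ β * δ) ^ k * max (K / δ) 1) • powSeries β) := by
  induction k with
  | zero =>
    intro n
    simp only [pow_zero, one_mul, coeff_one, map_smul, coeff_powSeries, smul_eq_mul]
    split_ifs with h
    · subst h
      simp [powSeq_zero]
    · simpa using mul_nonneg (zero_le_one.trans (le_max_right (K / δ) 1)) (powSeq_nonneg β n)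
  | succ k ih =>
    rw [pow_succ]
    refine ((Maj.mul_of_absSumLE hβ (hf.pow k) hf ih hf')).mono (coeff_powSeries_nonneg β) ?_
    -- The first entry gives `K ≤ δ * K'`, needed for the new factor; the second one covers the
    -- zeroth power.
    set K' := max (K / δ) 1
    have hK' : K ≤ δ * K' := by
      have : K / δ ≤ K' := le_max_left _ _
      rwa [div_le_iff₀' hδ] at this
    have hK0 : 0 ≤ K' := zero_le_one.trans (le_max_right (K / δ) 1)
    have hC : (1:ℝ) ≤ 2 ^ β := Real.one_le_rpow one_le_two hβ
    have h1 : (1:ℝ) ≤ (2 * 2 ^ β) ^ k := one_le_pow₀ (by linarith)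
    have hδk : 0 ≤ δ ^ k := by positivity
    calc (2:ℝ) ^ β * ((2 * 2 ^ β * δ) ^ k * K' * δ + δ ^ k * K)
        ≤ 2 ^ β * ((2 * 2 ^ β * δ) ^ k * K' * δ + δ ^ k * (δ * K')) := by gcongr
      _ = 2 ^ β * δ ^ k * δ * K' * ((2 * 2 ^ β) ^ k + 1) := by rw [mul_pow (2 * 2 ^ β) δ]; ring
      _ ≤ 2 ^ β * δ ^ k * δ * K' * ((2 * 2 ^ β) ^ k + (2 * 2 ^ β) ^ k) := by gcongr
      _ = (2 * 2 ^ β * δ) ^ (k + 1) * K' := by rw [pow_succ, mul_pow (2 * 2 ^ β) δ]; ring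

/-- The Neumann series is finite in each coefficient, since `x ^ (n + 1)` vanishes to order n + 1 at
the origin; no convergence is involved. -/
theorem coeff_eq_sum_of_eq_add_mul {E F x : PowerSeries ℝ} (h : E = F + x * E)
    (hx : constantCoeff x = 0) (n : ℕ) :
    coeff n E = ∑ k ∈ Finset.range (n + 1), coeff n (x ^ k * F) := by
  have key : ∀ K : ℕ, E = ∑ k ∈ Finset.range K, x ^ k * F + x ^ K * E := by
    intro K
    induction K with
    | zero => simp
    | succ K ih =>
      rw [Finset.sum_range_succ, pow_succ]
      conv_lhs => rw [ih, h]
      ring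
  conv_lhs => rw [key (n + 1)]
  rw [map_add, map_sum, add_eq_left]
  have hd : (X : PowerSeries ℝ) ^ (n + 1) ∣ x ^ (n + 1) * E :=
    (pow_dvd_pow_of_dvd (X_dvd_iff.2 hx) _).mul_right _
  exact X_pow_dvd_iff.1 hd n (Nat.lt_succ_self n)

/-- A Wiener lemma: if `D = O(n^{-β})`, `β > 1`, and `E = 1 / D` is bounded on the open unit disc,
then `E = O(n^{-β})`. -/
theorem exists_maj_of_mul_eq_one (hβ : 1 < β) {D E : PowerSeries ℝ} (hDE : D * E = 1) {K : ℝ}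
    (hD : Maj D (K • powSeries β)) (hE : DiscConv E) {M : ℝ}
    (hM : ∀ z : ℂ, ‖z‖ < 1 → ‖discEval E z‖ ≤ M) :
    ∃ C : ℝ, 0 < C ∧ Maj E (C • powSeries β) := by
  have hβ0 : 0 ≤ β := by linarith
  have hsum : Summable fun n => |coeff n D| :=
    Summable.of_nonneg_of_le (fun _ => abs_nonneg _) (fun n => by simpa using hD n)
      ((summable_powSeq hβ).mul_left K)
  wlog hM1 : 1 ≤ M generalizing M
  · exact this (M := max M 1) (fun z hz => (hM z hz).trans (le_max_left _ _)) (le_max_right _ _)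
  have hM0 : 0 < M := by linarith
  set c : ℝ := 2 * 2 ^ β with hc
  have hc0 : 0 < c := by positivity
  -- In the Neumann series a factor `r` costs `c * δ` and a factor `F` costs `M`; this choice makes
  -- the ratio 1/2.
  set δ : ℝ := (2 * c * M)⁻¹ with hδ
  have hδ0 : 0 < δ := by positivity
  have hδe : c * δ * M = 1 / 2 := by rw [hδ]; field_simp
  obtain ⟨ρ, hρ0, hρ1, hr⟩ := exists_absSumLE_sub_rescale hsum hδ0
  obtain ⟨C, hC0, hC⟩ := exists_pow_le_mul_powSeq β hρ0.le hρ1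
  set r := D - rescale ρ D with hrdef
  have hr' : Maj r (K • powSeries β) := fun n => by
    refine le_trans ?_ (hD n)
    rw [hrdef, map_sub, coeff_rescale, ← one_sub_mul, abs_mul]
    refine mul_le_of_le_one_left (abs_nonneg _) ?_
    have := pow_le_one₀ (n := n) hρ0.le hρ1.le
    have : 0 ≤ ρ ^ n := by positivity
    rw [abs_of_nonneg (by linarith)]
    linarith
  set F := rescale ρ E with hF
  have hDF : rescale ρ D * F = 1 := by rw [hF, ← map_mul, hDE, map_one]
  -- `D` is a small perturbation by `r` of its rescaling, and `F` inverts the rescaling exactly.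
  have hEq : E = F + (-r * F) * E := by
    rw [hrdef]
    linear_combination F * hDE - E * hDF
  have hx0 : constantCoeff (-r * F) = 0 := by
    rw [map_mul, map_neg, hrdef, map_sub]
    have : constantCoeff (rescale ρ D) = constantCoeff D := by
      rw [← coeff_zero_eq_constantCoeff_apply, coeff_rescale]; simp
    rw [this]; simp
  -- `F ^ k` is the rescaling of `E ^ k`: the factor `ρ ^ n` comes from rescaling and `M ^ k` from
  -- the bound on the disc.
  have hFk : ∀ k n, |coeff n (F ^ k)| ≤ M ^ k * ρ ^ n := fun k n => by
    rw [hF, ← map_pow, coeff_rescale, abs_mul, abs_of_nonneg (by positivity : 0 ≤ ρ ^ n), mul_comm]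
    exact mul_le_mul_of_nonneg_right (abs_coeff_pow_le hE hM k n) (by positivity)
  set K' := max (K / δ) 1 with hK'
  have hK0 : 0 < K' := lt_of_lt_of_le one_pos (le_max_right _ _)
  have hρ2 : 0 < 1 - ρ := by linarith
  set G : ℝ := 2 ^ β * M * (K' * (1 - ρ)⁻¹ + C) with hG
  have hterm : ∀ k, Maj (r ^ k * F ^ (k + 1)) ((G * (1 / 2) ^ k) • powSeries β) := fun k => by
    have h1 := absSumLE_of_le_geometric hρ0.le hρ1 (hFk (k + 1))
    have h2 : Maj (F ^ (k + 1)) ((M ^ (k + 1) * C) • powSeries β) := fun n => by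
      refine (hFk (k + 1) n).trans ?_
      have := mul_le_mul_of_nonneg_left (hC n) (show 0 ≤ M ^ (k + 1) by positivity)
      simpa [mul_assoc] using this
    refine (Maj.mul_of_absSumLE hβ0 (hr.pow k) h1 (Maj.pow_of_absSumLE hβ0 hδ0 hr hr' k) h2).mono
      (coeff_powSeries_nonneg β) ?_
    rw [← hδe, ← hc, ← hK', hG]
    have hC1 : (1:ℝ) ≤ c := by
      have : (1:ℝ) ≤ 2 ^ β := Real.one_le_rpow one_le_two hβ0
      linarith
    have h3 : δ ^ k ≤ (c * δ) ^ k := pow_le_pow_left₀ hδ0.le (by nlinarith) k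
    calc (2:ℝ) ^ β * ((c * δ) ^ k * K' * (M ^ (k + 1) * (1 - ρ)⁻¹) + δ ^ k * (M ^ (k + 1) * C))
        ≤ 2 ^ β * ((c * δ) ^ k * K' * (M ^ (k + 1) * (1 - ρ)⁻¹) +
            (c * δ) ^ k * (M ^ (k + 1) * C)) := by gcongr
      _ = 2 ^ β * M * (K' * (1 - ρ)⁻¹ + C) * (c * δ * M) ^ k := by
          rw [mul_pow (c * δ) M, pow_succ]; ring
  have hG0 : 0 < G := by positivity
  refine ⟨G * 2, by positivity, fun n => ?_⟩
  rw [coeff_eq_sum_of_eq_add_mul hEq hx0 n]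
  refine (Finset.abs_sum_le_sum_abs _ _).trans ?_
  have h4 : ∀ k ∈ Finset.range (n + 1), |coeff n ((-r * F) ^ k * F)| ≤
      (1 / 2 : ℝ) ^ k * (G * powSeq β n) := fun k _ => by
    have : (-r * F) ^ k * F = (-1) ^ k * (r ^ k * F ^ (k + 1)) := by
      rw [neg_mul, neg_pow (r * F), mul_pow, pow_succ]; ring
    have h5 : |coeff n ((-r * F) ^ k * F)| = |coeff n (r ^ k * F ^ (k + 1))| := by
      rw [this]
      rcases neg_one_pow_eq_or (PowerSeries ℝ) k with h | h <;> simp [h]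
    rw [h5]
    refine (hterm k n).trans (le_of_eq ?_)
    simp only [map_smul, coeff_powSeries, smul_eq_mul]
    ring
  refine (Finset.sum_le_sum h4).trans ?_
  rw [← Finset.sum_mul]
  have h6 : ∑ k ∈ Finset.range (n + 1), (1 / 2 : ℝ) ^ k ≤ 2 := by
    have := summable_geometric_two.sum_le_tsum (Finset.range (n + 1))
      (fun _ _ => by positivity)
    rwa [tsum_geometric_two] at this
  have h7 : 0 ≤ G * powSeq β n := mul_nonneg hG0.le (powSeq_nonneg β n)
  have := mul_le_mul_of_nonneg_right h6 h7
  simp only [map_smul, coeff_powSeries, smul_eq_mul]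
  linarith

end Wiener

/-! ### Scalar renewal sequences -/

section Renewal

open PowerSeries

variable {β : ℝ}

/-- The power series `∑ z^n = (1 - z)⁻¹`. -/
def geomSeries : PowerSeries ℝ := mk 1

theorem geomSeries_mul : geomSeries * (1 - X) = 1 := mk_one_mul_one_sub_eq_one ℝ

@[simp] theorem coeff_geomSeries (n : ℕ) : coeff n geomSeries = 1 := by simp [geomSeries]

theorem coeff_geomSeries_mul (f : PowerSeries ℝ) (n : ℕ) :
    coeff n (geomSeries * f) = ∑ j ∈ Finset.range (n + 1), coeff j f := by
  rw [mul_comm, coeff_mul]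
  simp only [coeff_geomSeries, mul_one]
  rw [Finset.Nat.sum_antidiagonal_eq_sum_range_succ (fun i _ => coeff i f)]

theorem coeff_zero_one_sub_X_mul (f : PowerSeries ℝ) : coeff 0 ((1 - X) * f) = coeff 0 f := by
  simp [sub_mul]

theorem coeff_succ_one_sub_X_mul (f : PowerSeries ℝ) (n : ℕ) :
    coeff (n + 1) ((1 - X) * f) = coeff (n + 1) f - coeff n f := by
  rw [sub_mul, one_mul, map_sub, coeff_succ_X_mul]

/-- A probability vector on the positive integers whose support generates `ℤ`. -/
structure IsAperiodicProb (p : PowerSeries ℝ) : Prop where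
  nonneg : ∀ n, 0 ≤ coeff n p
  zero : coeff 0 p = 0
  hasSum : HasSum (fun n => coeff n p) 1
  aperiodic : ∀ d : ℕ, (∀ n, coeff n p ≠ 0 → d ∣ n) → d = 1

/-- The tails `1 - ∑_{j ≤ n} p_j`. -/
def tailSeries (p : PowerSeries ℝ) : PowerSeries ℝ := geomSeries * (1 - p)

theorem one_sub_X_mul_tailSeries (p : PowerSeries ℝ) : (1 - X) * tailSeries p = 1 - p := by
  rw [tailSeries, ← mul_assoc, mul_comm (1 - X), geomSeries_mul, one_mul]

/-- The differences `u_n - u_{n-1}` of the renewal sequence. -/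
def invTail (p : PowerSeries ℝ) : PowerSeries ℝ := (tailSeries p)⁻¹

/-- The renewal sequence `u = 1 / (1 - p)`. -/
def renewal (p : PowerSeries ℝ) : PowerSeries ℝ := geomSeries * invTail p

theorem one_sub_X_mul_renewal (p : PowerSeries ℝ) : (1 - X) * renewal p = invTail p := by
  rw [renewal, ← mul_assoc, mul_comm (1 - X), geomSeries_mul, one_mul]

namespace IsAperiodicProb

variable {p : PowerSeries ℝ} (hp : IsAperiodicProb p)

include hp

theorem constantCoeff_tailSeries : constantCoeff (tailSeries p) = 1 := by
  rw [← coeff_zero_eq_constantCoeff_apply, tailSeries, coeff_geomSeries_mul]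
  simp [hp.zero]

theorem tailSeries_mul_invTail : tailSeries p * invTail p = 1 :=
  PowerSeries.mul_inv_cancel _ (by simp [hp.constantCoeff_tailSeries])

theorem renewal_eq : renewal p = 1 + p * renewal p := by
  have h1 := hp.tailSeries_mul_invTail
  have h2 : (1 - p) * renewal p = 1 := by
    rw [← one_sub_X_mul_tailSeries, ← one_sub_X_mul_renewal] at *
    linear_combination h1
  linear_combination h2

/-- Induction over the renewal equation, where `p` has no mass at 0 and total mass 1. It provides
the a priori boundedness that makes `invTail p` converge in the disc. -/
theorem renewal_nonneg_le_one (n : ℕ) : 0 ≤ coeff n (renewal p) ∧ coeff n (renewal p) ≤ 1 := by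
  induction n using Nat.strong_induction_on with
  | _ n ih =>
    rcases Nat.eq_zero_or_pos n with rfl | hn
    · rw [hp.renewal_eq]
      have : constantCoeff p = 0 := by rw [← coeff_zero_eq_constantCoeff_apply, hp.zero]
      simp [this]
    rw [hp.renewal_eq, map_add, coeff_one, if_neg hn.ne', zero_add, coeff_mul]
    have hterm : ∀ q ∈ Finset.HasAntidiagonal.antidiagonal n,
        0 ≤ coeff q.1 p * coeff q.2 (renewal p) ∧
        coeff q.1 p * coeff q.2 (renewal p) ≤ coeff q.1 p := by
      intro q hq
      rw [Finset.HasAntidiagonal.mem_antidiagonal] at hq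
      rcases Nat.eq_zero_or_pos q.1 with h0 | h0
      · simp [h0, hp.zero]
      have := ih q.2 (by omega)
      have := hp.nonneg q.1
      exact ⟨by nlinarith, by nlinarith⟩
    refine ⟨Finset.sum_nonneg fun q hq => (hterm q hq).1,
      (Finset.sum_le_sum fun q hq => (hterm q hq).2).trans ?_⟩
    rw [Finset.Nat.sum_antidiagonal_eq_sum_range_succ (fun i _ => coeff i p)]
    exact sum_le_hasSum _ (fun i _ => hp.nonneg i) hp.hasSum

theorem abs_invTail_le_one (n : ℕ) : |coeff n (invTail p)| ≤ 1 := by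
  rw [← one_sub_X_mul_renewal]
  rcases n with _ | n
  · rw [coeff_zero_one_sub_X_mul]
    have := hp.renewal_nonneg_le_one 0
    exact abs_le.2 ⟨by linarith, by linarith⟩
  · rw [coeff_succ_one_sub_X_mul]
    have := hp.renewal_nonneg_le_one n
    have := hp.renewal_nonneg_le_one (n + 1)
    exact abs_le.2 ⟨by linarith, by linarith⟩

theorem tailSeries_nonneg (n : ℕ) : 0 ≤ coeff n (tailSeries p) := by
  rw [tailSeries, coeff_geomSeries_mul]
  have : ∑ j ∈ Finset.range (n + 1), coeff j p ≤ 1 :=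
    sum_le_hasSum _ (fun i _ => hp.nonneg i) hp.hasSum
  simp only [map_sub, Finset.sum_sub_distrib, coeff_one]
  simp
  linarith

/-- Equality in the triangle inequality: the real parts force `z ^ n = 1` wherever `p` has mass. The
order of `z` then divides the support, and aperiodicity makes it 1. -/
theorem eq_one_of_tsum_eq_one {z : ℂ} (hz : ‖z‖ = 1)
    (h : ∑' n, ((coeff n p : ℝ) : ℂ) * z ^ n = 1) : z = 1 := by
  have hnorm : ∀ n, ‖((coeff n p : ℝ) : ℂ) * z ^ n‖ = coeff n p := fun n => by
    simp [hz, abs_of_nonneg (hp.nonneg n)]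
  have hs : Summable fun n => ((coeff n p : ℝ) : ℂ) * z ^ n :=
    Summable.of_norm (hp.hasSum.summable.congr fun n => (hnorm n).symm)
  have hre : HasSum (fun n => coeff n p * (z ^ n).re) 1 := by
    have := Complex.hasSum_re (h ▸ hs.hasSum)
    simpa using this
  have hsub := hp.hasSum.sub hre
  rw [sub_self] at hsub
  have hle : ∀ n, (z ^ n).re ≤ 1 := fun n => by
    refine (Complex.re_le_norm _).trans ?_
    simp [hz]
  have hz0 := (hasSum_zero_iff_of_nonneg (fun n => ?_)).1 hsub
  swap
  · have := hle n
    have := hp.nonneg n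
    change 0 ≤ coeff n p - coeff n p * (z ^ n).re
    nlinarith
  have hord : orderOf z = 1 := by
    refine hp.aperiodic _ fun n hn => orderOf_dvd_of_pow_eq_one ?_
    have h1 : coeff n p - coeff n p * (z ^ n).re = 0 := congrFun hz0 n
    have h2 : (z ^ n).re = 1 := by
      have : coeff n p * (1 - (z ^ n).re) = 0 := by linarith
      rcases mul_eq_zero.1 this with h | h
      · exact absurd h hn
      · linarith
    have h3 : ‖z ^ n‖ = 1 := by simp [hz]
    have h4 := Complex.sq_norm (z ^ n)
    rw [h3, Complex.normSq_apply, h2] at h4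
    apply Complex.ext
    · simpa using h2
    · have : (z ^ n).im * (z ^ n).im = 0 := by linarith
      simpa using this
  exact orderOf_eq_one_iff.1 hord

/-- Summation by parts on the unit circle, which the product formula in the open disc does not
reach. -/
theorem one_sub_mul_tsum_tailSeries (hs : Summable fun n => coeff n (tailSeries p)) {z : ℂ}
    (hz : ‖z‖ = 1) :
    (1 - z) * discEval (tailSeries p) z = 1 - ∑' n, ((coeff n p : ℝ) : ℂ) * z ^ n := by
  have hnD : ∀ n, ‖((coeff n (tailSeries p) : ℝ) : ℂ) * z ^ n‖ = coeff n (tailSeries p) := fun n => by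
    simp [hz, abs_of_nonneg (hp.tailSeries_nonneg n)]
  have hnP : ∀ n, ‖((coeff n p : ℝ) : ℂ) * z ^ n‖ = coeff n p := fun n => by
    simp [hz, abs_of_nonneg (hp.nonneg n)]
  have hsD : Summable fun n => ((coeff n (tailSeries p) : ℝ) : ℂ) * z ^ n :=
    Summable.of_norm (hs.congr fun n => (hnD n).symm)
  have hsP : Summable fun n => ((coeff n p : ℝ) : ℂ) * z ^ n :=
    Summable.of_norm (hp.hasSum.summable.congr fun n => (hnP n).symm)
  have hrec : ∀ n, coeff (n + 1) p = coeff n (tailSeries p) - coeff (n + 1) (tailSeries p) := fun n => by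
    have := congrArg (coeff (n + 1)) (one_sub_X_mul_tailSeries p)
    rw [coeff_succ_one_sub_X_mul, map_sub, coeff_one, if_neg (by omega)] at this
    linarith
  have h0 : coeff 0 (tailSeries p) = 1 := by simpa using hp.constantCoeff_tailSeries
  rw [discEval, hsP.tsum_eq_zero_add, sub_mul, one_mul, ← tsum_mul_left]
  conv_lhs => rw [hsD.tsum_eq_zero_add]
  have e1 : ∑' n, ((coeff (n + 1) p : ℝ) : ℂ) * z ^ (n + 1) =
      ∑' n, z * (((coeff n (tailSeries p) : ℝ) : ℂ) * z ^ n) -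
        ∑' n, ((coeff (n + 1) (tailSeries p) : ℝ) : ℂ) * z ^ (n + 1) := by
    rw [← (hsD.mul_left z).tsum_sub ((summable_nat_add_iff 1).2 hsD)]
    refine tsum_congr fun n => ?_
    rw [hrec]
    push_cast
    ring
  rw [e1, h0, hp.zero]
  push_cast
  ring

/-- Inside the disc the series has the inverse `invTail p`. A zero on the circle would give the
value 1 to the series of `p`, hence z = 1; but there the tails add up to at least their zeroth term
1. -/
theorem discEval_tailSeries_ne_zero (hs : Summable fun n => coeff n (tailSeries p)) {z : ℂ}
    (hz : ‖z‖ ≤ 1) : discEval (tailSeries p) z ≠ 0 := by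
  intro h0
  rcases hz.lt_or_eq with h | h
  · have hcT : DiscConv (tailSeries p) := discConv_of_bounded fun n => by
      rw [abs_of_nonneg (hp.tailSeries_nonneg n)]
      exact hs.le_tsum n fun j _ => hp.tailSeries_nonneg j
    have := discEval_mul hcT (discConv_of_bounded hp.abs_invTail_le_one) h
    rw [hp.tailSeries_mul_invTail, h0, discEval_one, zero_mul] at this
    exact one_ne_zero this
  · have h1 := hp.one_sub_mul_tsum_tailSeries hs h
    rw [h0, mul_zero] at h1
    have hz1 := hp.eq_one_of_tsum_eq_one h (sub_eq_zero.1 h1.symm).symm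
    subst hz1
    rw [discEval] at h0
    simp only [one_pow, mul_one] at h0
    rw [← Complex.ofReal_tsum] at h0
    have h2 := hs.le_tsum 0 fun j _ => hp.tailSeries_nonneg j
    have h3 : coeff 0 (tailSeries p) = 1 := by simpa using hp.constantCoeff_tailSeries
    rw [h3] at h2
    have h4 : ∑' n, coeff n (tailSeries p) = 0 := by exact_mod_cast h0
    linarith

theorem summable_tailSeries (hβ : 1 < β) {K : ℝ} (hK : Maj (tailSeries p) (K • powSeries β)) :
    Summable fun n => coeff n (tailSeries p) :=
  Summable.of_nonneg_of_le hp.tailSeries_nonneg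
    (fun n => by simpa using (le_abs_self _).trans (hK n)) ((summable_powSeq hβ).mul_left K)

/-- The differences `u_n - u_{n-1}` are `O(n^{-β})` if the tails are. -/
theorem exists_maj_invTail (hβ : 1 < β) {K : ℝ} (hK : Maj (tailSeries p) (K • powSeries β)) :
    ∃ C : ℝ, 0 < C ∧ Maj (invTail p) (C • powSeries β) := by
  have hs := hp.summable_tailSeries hβ hK
  -- A continuous function without zeros on the compact closed disc is bounded away from 0, which is
  -- the bound on the inverse required by the Wiener lemma.
  have hcont : ContinuousOn (fun z => ‖discEval (tailSeries p) z‖) (Metric.closedBall 0 1) := by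
    refine ContinuousOn.norm ?_
    refine continuousOn_tsum (fun n => by fun_prop) hs fun n z hz => ?_
    rw [mem_closedBall_zero_iff] at hz
    rw [norm_mul, norm_pow, Complex.norm_real, Real.norm_of_nonneg (hp.tailSeries_nonneg n)]
    exact mul_le_of_le_one_right (hp.tailSeries_nonneg n) (pow_le_one₀ (norm_nonneg _) hz)
  obtain ⟨z₀, hz₀, hmin⟩ := (isCompact_closedBall (0:ℂ) 1).exists_isMinOn
    ⟨0, by simp⟩ hcont
  have hpos : 0 < ‖discEval (tailSeries p) z₀‖ :=
    norm_pos_iff.2 (hp.discEval_tailSeries_ne_zero hs (by simpa using hz₀))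
  refine exists_maj_of_mul_eq_one hβ hp.tailSeries_mul_invTail hK
    (discConv_of_bounded hp.abs_invTail_le_one) (M := ‖discEval (tailSeries p) z₀‖⁻¹) fun z hz => ?_
  have hcT : DiscConv (tailSeries p) := discConv_of_bounded fun n => by
    rw [abs_of_nonneg (hp.tailSeries_nonneg n)]
    exact hs.le_tsum n fun j _ => hp.tailSeries_nonneg j
  have h1 := discEval_mul hcT (discConv_of_bounded hp.abs_invTail_le_one) hz
  rw [hp.tailSeries_mul_invTail, discEval_one] at h1
  have h2 : ‖discEval (tailSeries p) z₀‖ ≤ ‖discEval (tailSeries p) z‖ :=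
    hmin (by simpa using hz.le)
  have h3 : discEval (invTail p) z = (discEval (tailSeries p) z)⁻¹ :=
    eq_inv_of_mul_eq_one_right h1.symm
  rw [h3, norm_inv]
  exact inv_anti₀ hpos h2

end IsAperiodicProb

/-! ### Second order expansion of the renewal sequence -/

/-- The weights `1 + ∑_{k=1}^n k^{1-β}`. -/
def rateWeight (β : ℝ) (n : ℕ) : ℝ := 1 + ∑ k ∈ Finset.range n, ((k : ℝ) + 1) ^ (1 - β)

/-- The power series with coefficients `n^{-β} (1 + ∑_{k=1}^n k^{1-β})`. -/
def rateSeries (β : ℝ) : PowerSeries ℝ := mk fun n => powSeq β n * rateWeight β n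

theorem rateWeight_mono (β : ℝ) : Monotone (rateWeight β) := by
  refine monotone_nat_of_le_succ fun n => ?_
  rw [rateWeight, rateWeight, Finset.sum_range_succ]
  have : (0:ℝ) ≤ ((n : ℝ) + 1) ^ (1 - β) := by positivity
  linarith

theorem one_le_rateWeight (β : ℝ) (n : ℕ) : 1 ≤ rateWeight β n := by
  have := rateWeight_mono β (Nat.zero_le n)
  simpa [rateWeight] using this

theorem coeff_rateSeries (β : ℝ) (n : ℕ) :
    coeff n (rateSeries β) = powSeq β n * rateWeight β n := by simp [rateSeries]

theorem coeff_rateSeries_nonneg (β : ℝ) (n : ℕ) : 0 ≤ coeff n (rateSeries β) := by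
  rw [coeff_rateSeries]
  exact mul_nonneg (powSeq_nonneg _ _) (zero_le_one.trans (one_le_rateWeight _ _))

theorem powSeries_maj_rateSeries (β : ℝ) : Maj (powSeries β) (rateSeries β) := fun n => by
  rw [coeff_rateSeries, coeff_powSeries, abs_of_nonneg (powSeq_nonneg β n)]
  exact le_mul_of_one_le_right (powSeq_nonneg β n) (one_le_rateWeight β n)

theorem exists_maj_rateSeries_mul (hβ : 1 < β) :
    ∃ K : ℝ, 0 < K ∧ Maj (rateSeries β * powSeries β) (K • rateSeries β) := by
  obtain ⟨K, hK, H⟩ := exists_maj_mul_powSeries hβ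
  exact ⟨K, hK, H _ (rateWeight_mono β) fun n => zero_le_one.trans (one_le_rateWeight β n)⟩

/-- Transfer one factor n + 1: the product is (n+1)^{-β} times (n+1)(n+1)^{1-β}, and the latter is
at most the weight because k^{1-β} decreases. -/
theorem rpow_mul_rpow_le_rateSeries (hβ : 1 < β) (n : ℕ) :
    ((n : ℝ) + 1) ^ (1 - β) * ((n : ℝ) + 1) ^ (1 - β) ≤ coeff n (rateSeries β) := by
  have hn : (0:ℝ) < (n : ℝ) + 1 := by positivity
  have h1 : ((n : ℝ) + 1) ^ (-β) ≤ powSeq β n := by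
    rcases Nat.eq_zero_or_pos n with rfl | h
    · simp [powSeq_zero]
    · rw [powSeq_of_ne h.ne']
      exact Real.rpow_le_rpow_of_nonpos (by positivity) (by linarith) (by linarith)
  have h2 : ((n : ℝ) + 1) * ((n : ℝ) + 1) ^ (1 - β) ≤ rateWeight β n := by
    have e : ((n : ℝ) + 1) * ((n : ℝ) + 1) ^ (1 - β) =
        ((n : ℝ) + 1) ^ (1 - β) + ∑ k ∈ Finset.range n, ((n : ℝ) + 1) ^ (1 - β) := by
      rw [Finset.sum_const, Finset.card_range, nsmul_eq_mul]; ring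
    rw [e, rateWeight]
    refine add_le_add (Real.rpow_le_one_of_one_le_of_nonpos (by linarith [(Nat.cast_nonneg n : (0:ℝ) ≤ n)]) (by linarith)) (Finset.sum_le_sum fun k hk => ?_)
    have : (k : ℝ) ≤ n := by exact_mod_cast (Finset.mem_range.1 hk).le
    exact Real.rpow_le_rpow_of_nonpos (by positivity) (by linarith) (by linarith)
  rw [coeff_rateSeries]
  calc ((n : ℝ) + 1) ^ (1 - β) * ((n : ℝ) + 1) ^ (1 - β)
      = ((n : ℝ) + 1) ^ (-β) * (((n : ℝ) + 1) * ((n : ℝ) + 1) ^ (1 - β)) := by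
        rw [show (1 - β) = -β + 1 by ring, Real.rpow_add_one hn.ne']; ring
    _ ≤ _ := mul_le_mul h1 h2 (by positivity) (powSeq_nonneg _ _)

/-- A discrete substitute for integral comparison: it bounds n^{-β} by a telescoping difference of
n^{1-β}. It rests on 1 + x ≤ exp x and the matching bound for the logarithm. -/
theorem rpow_neg_le_sub {x q : ℝ} (hx : 0 < x) (hq : 0 ≤ q) :
    q * (x + 1) ^ (-q - 1) ≤ x ^ (-q) - (x + 1) ^ (-q) := by
  have hx1 : 0 < x + 1 := by linarith
  have hl : 1 / (x + 1) ≤ Real.log (x + 1) - Real.log x := by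
    have := Real.log_le_sub_one_of_pos (show 0 < x / (x + 1) by positivity)
    rw [Real.log_div hx.ne' hx1.ne'] at this
    have e : x / (x + 1) - 1 = -(1 / (x + 1)) := by field_simp; ring
    linarith
  have h1 : x ^ (-q) = (x + 1) ^ (-q) * Real.exp (q * (Real.log (x + 1) - Real.log x)) := by
    rw [Real.rpow_def_of_pos hx, Real.rpow_def_of_pos hx1, ← Real.exp_add]
    ring_nf
  have h2 : 1 + q * (1 / (x + 1)) ≤ Real.exp (q * (Real.log (x + 1) - Real.log x)) := by
    have := Real.add_one_le_exp (q * (Real.log (x + 1) - Real.log x))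
    have := mul_le_mul_of_nonneg_left hl hq
    linarith
  have h3 : (0:ℝ) < (x + 1) ^ (-q) := by positivity
  rw [h1, Real.rpow_sub_one hx1.ne']
  have := mul_le_mul_of_nonneg_left h2 h3.le
  have e : (x + 1) ^ (-q) * (1 + q * (1 / (x + 1))) =
    (x + 1) ^ (-q) + q * ((x + 1) ^ (-q) / (x + 1)) := by ring
  linarith

/-- The sums of the tails of `D`, i.e. the coefficients of `(D(1) - D(z)) / (1 - z)`. -/
def tailSum (D : PowerSeries ℝ) : PowerSeries ℝ := mk fun n => ∑' j, coeff (j + (n + 1)) D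

section TailSum

variable {D : PowerSeries ℝ}

theorem coeff_tailSum (D : PowerSeries ℝ) (n : ℕ) :
    coeff n (tailSum D) = ∑' j, coeff (j + (n + 1)) D := by simp [tailSum]

theorem sum_add_coeff_tailSum (hs : Summable fun n => coeff n D) (n : ℕ) :
    ∑ i ∈ Finset.range (n + 1), coeff i D + coeff n (tailSum D) = ∑' i, coeff i D := by
  rw [coeff_tailSum]
  exact hs.sum_add_tsum_nat_add (n + 1)

theorem coeff_tailSum_succ (hs : Summable fun n => coeff n D) (n : ℕ) :
    coeff n (tailSum D) = coeff (n + 1) D + coeff (n + 1) (tailSum D) := by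
  have h1 := sum_add_coeff_tailSum hs n
  have h2 := sum_add_coeff_tailSum hs (n + 1)
  rw [Finset.sum_range_succ] at h2
  linarith

theorem one_sub_X_mul_tailSum (hs : Summable fun n => coeff n D) :
    (1 - X) * tailSum D = C (∑' i, coeff i D) - D := by
  ext n
  rcases n with _ | n
  · rw [coeff_zero_one_sub_X_mul, map_sub, coeff_zero_C]
    have := sum_add_coeff_tailSum hs 0
    simp only [zero_add, Finset.range_one, Finset.sum_singleton] at this
    linarith
  · rw [coeff_succ_one_sub_X_mul, map_sub, coeff_C, if_neg (by omega),
      coeff_tailSum_succ hs n]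
    ring

theorem powSeq_le_rpow_sub (hβ : 1 < β) {i : ℕ} (hi : i ≠ 0) :
    powSeq β i ≤ 2 ^ β / (β - 1) * ((i : ℝ) ^ (1 - β) - ((i : ℝ) + 1) ^ (1 - β)) := by
  have hq : 0 < β - 1 := by linarith
  have hx : (0:ℝ) < i := by positivity
  have h1 := rpow_neg_le_sub hx hq.le
  have h2 : powSeq β i ≤ 2 ^ β * powSeq β (i + 1) := powSeq_half (by linarith) (by omega)
  rw [powSeq_of_ne (n := i + 1) (by omega)] at h2
  push_cast at h2
  rw [show -(β - 1) = 1 - β by ring, show (1 - β - 1 : ℝ) = -β by ring] at h1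
  have h3 : (2:ℝ) ^ β * ((i : ℝ) + 1) ^ (-β) =
      2 ^ β / (β - 1) * ((β - 1) * ((i : ℝ) + 1) ^ (-β)) := by field_simp
  rw [h3] at h2
  exact h2.trans (mul_le_mul_of_nonneg_left h1 (by positivity))

theorem coeff_tailSum_le (hβ : 1 < β) {K : ℝ} (hK : Maj D (K • powSeries β)) (n : ℕ) :
    |coeff n (tailSum D)| ≤ K * (2 ^ β / (β - 1)) * ((n : ℝ) + 1) ^ (1 - β) := by
  have hK0 : 0 ≤ K := by simpa [powSeq_zero] using hK.nonneg 0
  have hq : 0 < β - 1 := by linarith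
  have hK' : ∀ i, ‖coeff i D‖ ≤ K * powSeq β i := fun i => by simpa using hK i
  have hs : Summable fun n => ‖coeff n D‖ :=
    Summable.of_nonneg_of_le (fun _ => norm_nonneg _) hK' ((summable_powSeq hβ).mul_left K)
  have hs' : Summable fun j => ‖coeff (j + (n + 1)) D‖ :=
    (summable_nat_add_iff (f := fun n => ‖coeff n D‖) (n + 1)).2 hs
  rw [coeff_tailSum, ← Real.norm_eq_abs]
  refine (norm_tsum_le_tsum_norm hs').trans ?_
  set c := 2 ^ β / (β - 1) with hc
  have hc0 : 0 ≤ c := by positivity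
  let φ : ℕ → ℝ := fun j => ((j : ℝ) + (n + 1)) ^ (1 - β)
  have key : ∀ j, ‖coeff (j + (n + 1)) D‖ ≤ K * c * (φ j - φ (j + 1)) := by
    intro j
    have h1 := powSeq_le_rpow_sub hβ (show j + (n + 1) ≠ 0 by omega)
    have e : φ j - φ (j + 1) =
        ((j + (n + 1) : ℕ) : ℝ) ^ (1 - β) - (((j + (n + 1) : ℕ) : ℝ) + 1) ^ (1 - β) := by
      simp only [φ]
      push_cast
      rw [show (j : ℝ) + 1 + (n + 1) = j + (n + 1) + 1 by ring]
    rw [mul_assoc, e]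
    exact (hK' _).trans (mul_le_mul_of_nonneg_left h1 hK0)
  refine Real.tsum_le_of_sum_range_le (fun _ => norm_nonneg _) fun N => ?_
  refine (Finset.sum_le_sum fun j _ => key j).trans ?_
  rw [← Finset.mul_sum, Finset.sum_range_sub' φ]
  refine mul_le_mul_of_nonneg_left ?_ (by positivity)
  have h1 : 0 ≤ φ N := by positivity
  have h2 : φ 0 = ((n : ℝ) + 1) ^ (1 - β) := by simp [φ]
  linarith

/-- The difference is a sum of `i` coefficients of `D`, all with index at least n/2. -/
theorem abs_tailSum_sub_le (hβ : 0 ≤ β) {K : ℝ} (hs : Summable fun n => coeff n D)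
    (hK : Maj D (K • powSeries β)) {i n : ℕ} (h : 2 * i ≤ n) :
    |coeff (n - i) (tailSum D) - coeff n (tailSum D)| ≤ i * (K * (2 ^ β * powSeq β n)) := by
  have hK0 : 0 ≤ K := by simpa [powSeq_zero] using hK.nonneg 0
  induction i with
  | zero => simp
  | succ i ih =>
    have ih := ih (by omega)
    have e : n - i = n - (i + 1) + 1 := by omega
    have h1 := coeff_tailSum_succ hs (n - (i + 1))
    rw [← e] at h1
    have h2 : |coeff (n - i) D| ≤ K * (2 ^ β * powSeq β n) := by
      refine (hK _).trans ?_
      simp only [map_smul, coeff_powSeries, smul_eq_mul]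
      exact mul_le_mul_of_nonneg_left (powSeq_half hβ (by omega)) hK0
    have e2 : coeff (n - (i + 1)) (tailSum D) - coeff n (tailSum D) =
        coeff (n - i) D + (coeff (n - i) (tailSum D) - coeff n (tailSum D)) := by
      rw [h1]; ring
    rw [e2]
    refine (abs_add_le _ _).trans ?_
    push_cast
    linarith

theorem sum_mul_powSeq_le (n : ℕ) :
    ∑ i ∈ Finset.range (n + 1), (i : ℝ) * powSeq β i ≤ rateWeight β n := by
  rw [Finset.sum_range_succ', rateWeight]
  simp only [Nat.cast_zero, zero_mul, add_zero]
  have : ∀ i ∈ Finset.range n, ((i + 1 : ℕ) : ℝ) * powSeq β (i + 1) = ((i : ℝ) + 1) ^ (1 - β) := by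
    intro i _
    rw [powSeq_of_ne (by omega)]
    push_cast
    rw [show 1 - β = -β + 1 by ring, Real.rpow_add_one (by positivity)]
    ring
  rw [Finset.sum_congr rfl this]
  linarith

/-- The coefficients of `(1 - z) t(z)²`, where `t` is the series of the summed tails. -/
theorem exists_maj_one_sub_X_mul_tailSum_sq (hβ : 1 < β) {K : ℝ}
    (hK : Maj D (K • powSeries β)) :
    ∃ C : ℝ, 0 < C ∧ Maj ((1 - X) * tailSum D * tailSum D) (C • rateSeries β) := by
  have hβ0 : 0 ≤ β := by linarith
  have hK0 : 0 ≤ K := by simpa [powSeq_zero] using hK.nonneg 0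
  have hs : Summable fun n => coeff n D :=
    Summable.of_norm (Summable.of_nonneg_of_le (fun _ => norm_nonneg _) (fun n => by simpa using hK n)
      ((summable_powSeq hβ).mul_left K))
  set t := tailSum D with ht
  set C₁ := K * (2 ^ β / (β - 1)) with hC₁
  have hC₁0 : 0 ≤ C₁ := by
    have : 0 < β - 1 := by linarith
    positivity
  have htb : ∀ n, |coeff n t| ≤ C₁ * ((n : ℝ) + 1) ^ (1 - β) := coeff_tailSum_le hβ hK
  clear_value C₁
  refine ⟨C₁ * 2 ^ (β - 1) * C₁ + K * (K * 2 ^ β) + K * 2 ^ β * C₁ + 1, by positivity, fun n => ?_⟩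
  set h := n / 2 with hh
  -- Here (1 - X) t = D(1) - D, and D(1) is written as its partial sum up to h = n/2 plus the tail
  -- at h. What remains is a product of two tails, increments of `t` over at most n/2 steps, and
  -- terms where the index of `D` exceeds n/2.
  have hdecomp : coeff n ((1 - X) * t * t) = coeff h t * coeff n t
      - ∑ i ∈ Finset.range (h + 1), coeff i D * (coeff (n - i) t - coeff n t)
      - ∑ i ∈ Finset.Ico (h + 1) (n + 1), coeff i D * coeff (n - i) t := by
    rw [one_sub_X_mul_tailSum hs, sub_mul, map_sub, coeff_C_mul, ← sum_add_coeff_tailSum hs h,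
      coeff_mul, Finset.Nat.sum_antidiagonal_eq_sum_range_succ (fun i j => coeff i D * coeff j t),
      ← Finset.sum_range_add_sum_Ico _ (show h + 1 ≤ n + 1 by omega)]
    simp only [mul_sub, Finset.sum_sub_distrib, ← Finset.sum_mul]
    ring
  have han := powSeq_nonneg β n
  have hw := one_le_rateWeight β n
  have b1 : |coeff h t * coeff n t| ≤ C₁ * 2 ^ (β - 1) * C₁ * coeff n (rateSeries β) := by
    rw [abs_mul]
    have e1 : ((h : ℝ) + 1) ^ (1 - β) ≤ 2 ^ (β - 1) * ((n : ℝ) + 1) ^ (1 - β) := by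
      have h1 : ((n : ℝ) + 1) / 2 ≤ (h : ℝ) + 1 := by
        have : n + 1 ≤ 2 * (h + 1) := by omega
        have : ((n + 1 : ℕ) : ℝ) ≤ ((2 * (h + 1) : ℕ) : ℝ) := by exact_mod_cast this
        push_cast at this
        linarith
      refine (Real.rpow_le_rpow_of_nonpos (by positivity) h1 (by linarith)).trans (le_of_eq ?_)
      rw [Real.div_rpow (by positivity) (by norm_num), div_eq_mul_inv, ← Real.rpow_neg (by norm_num),
        neg_sub, mul_comm]
    calc |coeff h t| * |coeff n t| ≤ (C₁ * (2 ^ (β - 1) * ((n : ℝ) + 1) ^ (1 - β))) *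
          (C₁ * ((n : ℝ) + 1) ^ (1 - β)) :=
          mul_le_mul ((htb h).trans (mul_le_mul_of_nonneg_left e1 hC₁0)) (htb n) (abs_nonneg _)
            (by positivity)
      _ = C₁ * 2 ^ (β - 1) * C₁ * (((n : ℝ) + 1) ^ (1 - β) * ((n : ℝ) + 1) ^ (1 - β)) := by ring
      _ ≤ _ := mul_le_mul_of_nonneg_left (rpow_mul_rpow_le_rateSeries hβ n) (by positivity)
  have b2 : |∑ i ∈ Finset.range (h + 1), coeff i D * (coeff (n - i) t - coeff n t)| ≤
      K * (K * 2 ^ β) * coeff n (rateSeries β) := by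
    have : ∀ i ∈ Finset.range (h + 1), |coeff i D * (coeff (n - i) t - coeff n t)| ≤
        (K * (K * 2 ^ β) * powSeq β n) * ((i : ℝ) * powSeq β i) := by
      intro i hi
      rw [Finset.mem_range] at hi
      rw [abs_mul]
      have h1 := hK i
      simp only [map_smul, coeff_powSeries, smul_eq_mul] at h1
      have h2 := abs_tailSum_sub_le hβ0 hs hK (show 2 * i ≤ n by omega)
      have := powSeq_nonneg β i
      calc _ ≤ (K * powSeq β i) * (i * (K * (2 ^ β * powSeq β n))) :=
            mul_le_mul h1 h2 (abs_nonneg _) (by positivity)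
        _ = _ := by ring
    refine (Finset.abs_sum_le_sum_abs _ _).trans ((Finset.sum_le_sum this).trans ?_)
    rw [← Finset.mul_sum, coeff_rateSeries, ← mul_assoc _ (powSeq β n) (rateWeight β n)]
    refine mul_le_mul_of_nonneg_left ?_ (by positivity)
    exact (sum_mul_powSeq_le h).trans (rateWeight_mono β (by omega))
  have b3 : |∑ i ∈ Finset.Ico (h + 1) (n + 1), coeff i D * coeff (n - i) t| ≤
      K * 2 ^ β * C₁ * coeff n (rateSeries β) := by
    have : ∀ i ∈ Finset.Ico (h + 1) (n + 1), |coeff i D * coeff (n - i) t| ≤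
        (K * 2 ^ β * C₁ * powSeq β n) * (((n - i : ℕ) : ℝ) + 1) ^ (1 - β) := by
      intro i hi
      rw [Finset.mem_Ico] at hi
      rw [abs_mul]
      have h1 : |coeff i D| ≤ K * (2 ^ β * powSeq β n) := by
        refine (hK _).trans ?_
        simp only [map_smul, coeff_powSeries, smul_eq_mul]
        exact mul_le_mul_of_nonneg_left (powSeq_half hβ0 (by omega)) hK0
      calc _ ≤ (K * (2 ^ β * powSeq β n)) * (C₁ * (((n - i : ℕ) : ℝ) + 1) ^ (1 - β)) :=
            mul_le_mul h1 (htb _) (abs_nonneg _) (by positivity)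
        _ = _ := by ring
    refine (Finset.abs_sum_le_sum_abs _ _).trans ((Finset.sum_le_sum this).trans ?_)
    rw [← Finset.mul_sum, coeff_rateSeries, ← mul_assoc _ (powSeq β n) (rateWeight β n)]
    refine mul_le_mul_of_nonneg_left ?_ (show 0 ≤ K * 2 ^ β * C₁ * powSeq β n by positivity)
    have h2 : ∑ i ∈ Finset.Ico (h + 1) (n + 1), (((n - i : ℕ) : ℝ) + 1) ^ (1 - β) ≤
        ∑ i ∈ Finset.Ico 1 (n + 1), (((n - i : ℕ) : ℝ) + 1) ^ (1 - β) := by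
      refine Finset.sum_le_sum_of_subset_of_nonneg (Finset.Ico_subset_Ico_left (by omega))
        fun _ _ _ => by positivity
    refine h2.trans ?_
    rw [Finset.sum_Ico_eq_sum_range, Nat.add_sub_cancel,
      ← Finset.sum_range_reflect (fun i => (((n - (1 + i) : ℕ) : ℝ) + 1) ^ (1 - β)), rateWeight]
    have e : ∀ i ∈ Finset.range n, (((n - (1 + (n - 1 - i)) : ℕ) : ℝ) + 1) ^ (1 - β) =
        ((i : ℝ) + 1) ^ (1 - β) := by
      intro i hi
      rw [Finset.mem_range] at hi
      rw [show n - (1 + (n - 1 - i)) = i by omega]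
    rw [Finset.sum_congr rfl e]
    linarith
  rw [hdecomp]
  have hZ := coeff_rateSeries_nonneg β n
  rw [map_smul, smul_eq_mul]
  rw [abs_le] at b1 b2 b3 ⊢
  constructor <;> linarith

end TailSum

/-- Second order expansion of the renewal sequence. -/
theorem IsAperiodicProb.exists_maj_renewal_sub {p : PowerSeries ℝ} (hp : IsAperiodicProb p)
    (hβ : 1 < β) {K : ℝ} (hK : Maj (tailSeries p) (K • powSeries β)) {m : ℝ}
    (hm : HasSum (fun n => coeff n (tailSeries p)) m) :
    ∃ L : ℝ, 0 < L ∧ Maj (renewal p - (m⁻¹ • geomSeries + (m⁻¹ ^ 2) • tailSum (tailSeries p)))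
      (L • rateSeries β) := by
  have hm0 : 0 < m := by
    have := le_hasSum hm 0 fun j _ => hp.tailSeries_nonneg j
    have h3 : coeff 0 (tailSeries p) = 1 := by simpa using hp.constantCoeff_tailSeries
    linarith
  obtain ⟨C₁, hC₁, h₁⟩ := exists_maj_one_sub_X_mul_tailSum_sq hβ hK
  obtain ⟨C₂, hC₂, h₂⟩ := hp.exists_maj_invTail hβ hK
  obtain ⟨C₃, hC₃, h₃⟩ := exists_maj_rateSeries_mul hβ
  have h₄ := one_sub_X_mul_tailSum hm.summable
  rw [hm.tsum_eq] at h₄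
  set D := tailSeries p
  set t := tailSum D
  set E := invTail p
  have hDE : D * E = 1 := hp.tailSeries_mul_invTail
  have hg := geomSeries_mul
  have hmm : C (m⁻¹) * C m = (1 : PowerSeries ℝ) := by
    rw [← map_mul, inv_mul_cancel₀ hm0.ne', map_one]
  -- `h5` rewrites `E` in terms of its leading constant; it is used once in `geomSeries * E` and
  -- once more in the resulting product `t * E`.
  have key : renewal p - (m⁻¹ • geomSeries + (m⁻¹ ^ 2) • t) =
      (m⁻¹ ^ 2) • ((1 - X) * t * t * E) := by
    rw [renewal, smul_eq_C_mul, smul_eq_C_mul, smul_eq_C_mul, map_pow]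
    have h5 : E = C (m⁻¹) + C (m⁻¹) * ((1 - X) * t) * E := by
      rw [h₄]
      linear_combination (-E) * hmm + C m⁻¹ * hDE
    have h6 : geomSeries * E = C (m⁻¹) * geomSeries + C (m⁻¹) * t * E := by
      conv_lhs => rw [h5]
      linear_combination (C m⁻¹ * t * E) * hg
    rw [h6]
    linear_combination C m⁻¹ * t * h5
  refine ⟨m⁻¹ ^ 2 * (C₁ * C₂ * C₃), by positivity, ?_⟩
  rw [key, mul_smul]
  refine Maj.smul_of_nonneg ?_ (by positivity)
  refine (h₁.smul_mul_smul h₂).trans ?_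
  rw [mul_smul (C₁ * C₂)]
  refine Maj.of_nonneg (fun n => ?_) |>.trans (h₃.smul_of_nonneg (by positivity))
  have := h₃.smul_of_nonneg (show 0 ≤ C₁ * C₂ by positivity)
  rw [map_smul, coeff_mul]
  refine mul_nonneg (by positivity) (Finset.sum_nonneg fun q _ => ?_)
  exact mul_nonneg (coeff_rateSeries_nonneg _ _) (coeff_powSeries_nonneg _ _)

end Renewal

/-! ### Cones of log-Hölder densities -/

section Cone

variable {Y : Type*}

/-- The functions `g ≥ 0` with `g y ≤ exp (L θ^{s(y,y')}) g y'` for all `y`, `y'` in `A`. -/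
def InCone (F : Y → Y) (α : Set (Set Y)) (θ L : ℝ) (A : Set Y) (g : Y → ℝ≥0∞) : Prop :=
  ∀ y ∈ A, ∀ y' ∈ A, g y ≤ ENNReal.ofReal (Real.exp (L * θ ^ sepTime F α y y')) * g y'

variable {F : Y → Y} {α : Set (Set Y)} {θ L : ℝ} {A : Set Y} {g : Y → ℝ≥0∞}

theorem InCone.mono {B : Set Y} (hg : InCone F α θ L A g) (hBA : B ⊆ A) : InCone F α θ L B g :=
  fun y hy y' hy' => hg y (hBA hy) y' (hBA hy')

theorem InCone.add {g' : Y → ℝ≥0∞} (hg : InCone F α θ L A g) (hg' : InCone F α θ L A g') :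
    InCone F α θ L A (fun y => g y + g' y) := fun y hy y' hy' => by
  rw [mul_add]
  exact add_le_add (hg y hy y' hy') (hg' y hy y' hy')

theorem InCone.tsum {ι : Type*} {g : ι → Y → ℝ≥0∞} (hg : ∀ i, InCone F α θ L A (g i)) :
    InCone F α θ L A (fun y => ∑' i, g i y) := fun y hy y' hy' => by
  rw [← ENNReal.tsum_mul_left]
  exact ENNReal.tsum_le_tsum fun i => hg i y hy y' hy'

theorem inCone_zero : InCone F α θ L A (fun _ => 0) := fun _ _ _ _ => by simp

theorem one_le_ofReal_exp {x : ℝ} (hx : 0 ≤ x) : 1 ≤ ENNReal.ofReal (Real.exp x) := by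
  rw [← ENNReal.ofReal_one]
  exact ENNReal.ofReal_le_ofReal (Real.one_le_exp hx)

theorem inCone_const (hθ : 0 ≤ θ) (hL : 0 ≤ L) (c : ℝ≥0∞) : InCone F α θ L A (fun _ => c) :=
  fun _ _ _ _ => le_mul_of_one_le_left' (one_le_ofReal_exp (by positivity))

theorem InCone.le_exp_mul (hθ : 0 ≤ θ) (hθ' : θ ≤ 1) (hL : 0 ≤ L)
    (hg : InCone F α θ L A g) {y y' : Y} (hy : y ∈ A) (hy' : y' ∈ A) :
    g y ≤ ENNReal.ofReal (Real.exp L) * g y' := by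
  refine (hg y hy y' hy').trans ?_
  gcongr
  exact mul_le_of_le_one_right hL (pow_le_one₀ hθ hθ')

variable [MeasurableSpace Y] {μ : Measure Y} [IsProbabilityMeasure μ]

theorem InCone.le_lintegral (hθ : 0 ≤ θ) (hθ' : θ ≤ 1) (hL : 0 ≤ L)
    (hg : InCone F α θ L Set.univ g) (y : Y) :
    g y ≤ ENNReal.ofReal (Real.exp L) * ∫⁻ y, g y ∂μ := by
  rw [← lintegral_const_mul' _ _ ENNReal.ofReal_ne_top]
  calc g y = ∫⁻ _, g y ∂μ := by simp
    _ ≤ _ := lintegral_mono fun y' => hg.le_exp_mul hθ hθ' hL (Set.mem_univ _) (Set.mem_univ _)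

theorem InCone.lintegral_le (hθ : 0 ≤ θ) (hθ' : θ ≤ 1) (hL : 0 ≤ L)
    (hg : InCone F α θ L Set.univ g) (y : Y) :
    ∫⁻ y, g y ∂μ ≤ ENNReal.ofReal (Real.exp L) * g y := by
  calc ∫⁻ y, g y ∂μ ≤ ∫⁻ _, ENNReal.ofReal (Real.exp L) * g y ∂μ :=
        lintegral_mono fun y' => hg.le_exp_mul hθ hθ' hL (Set.mem_univ _) (Set.mem_univ _)
    _ = _ := by simp

theorem exp_mul_sub_one_le {L t : ℝ} (ht0 : 0 ≤ t) (ht1 : t ≤ 1) :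
    Real.exp (L * t) - 1 ≤ t * (Real.exp L - 1) := by
  have := convexOn_exp.2 (Set.mem_univ L) (Set.mem_univ 0) ht0 (sub_nonneg.2 ht1) (by ring)
  simp only [smul_eq_mul, mul_zero, add_zero, Real.exp_zero, mul_one] at this
  rw [mul_comm t L] at this
  linarith

/-- A positive fraction of the mass can be subtracted from a regular function at the cost of some
regularity. -/
theorem InCone.sub_const {L₁ κ : ℝ} (hθ : 0 ≤ θ) (hθ' : θ ≤ 1) (hL₁ : 0 ≤ L₁) (hL : L₁ < L)
    (hκ0 : 0 ≤ κ)
    (hκ : κ * (Real.exp L - 1) ≤ Real.exp (-L₁) * (L - L₁))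
    (hg : InCone F α θ L₁ Set.univ g) (hfin : ∫⁻ y, g y ∂μ ≠ ∞) :
    InCone F α θ L Set.univ (fun y => g y - ENNReal.ofReal κ * ∫⁻ y, g y ∂μ) ∧
      ∀ y, ENNReal.ofReal κ * ∫⁻ y, g y ∂μ ≤ g y := by
  have hgfin : ∀ y, g y ≠ ∞ := fun y =>
    ne_top_of_le_ne_top (ENNReal.mul_ne_top ENNReal.ofReal_ne_top hfin)
      (hg.le_lintegral (μ := μ) hθ hθ' hL₁ y)
  set m := ∫⁻ y, g y ∂μ with hm
  -- A regular function is bounded below by a multiple of its mass, which leaves something to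
  -- subtract.
  have hlow : ∀ y, Real.exp (-L₁) * m.toReal ≤ (g y).toReal := fun y => by
    have h1 := hg.lintegral_le (μ := μ) hθ hθ' hL₁ y
    have h2 := ENNReal.toReal_mono (ENNReal.mul_ne_top ENNReal.ofReal_ne_top (hgfin y)) h1
    rw [ENNReal.toReal_mul, ENNReal.toReal_ofReal (Real.exp_pos _).le] at h2
    rw [Real.exp_neg, inv_mul_le_iff₀ (Real.exp_pos _)]
    exact h2
  have hexpL : L ≤ Real.exp L - 1 := by linarith [Real.add_one_le_exp L]
  have hL0 : 0 < L := lt_of_le_of_lt hL₁ hL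
  have hm0 : 0 ≤ m.toReal := ENNReal.toReal_nonneg
  have hκ1 : κ ≤ Real.exp (-L₁) := by
    have h3 : Real.exp (-L₁) * (L - L₁) ≤ Real.exp (-L₁) * (Real.exp L - 1) :=
      mul_le_mul_of_nonneg_left (by linarith) (Real.exp_pos _).le
    exact le_of_mul_le_mul_right (hκ.trans h3) (by linarith)
  have hsub : ∀ y, κ * m.toReal ≤ (g y).toReal := fun y =>
    (mul_le_mul_of_nonneg_right hκ1 hm0).trans (hlow y)
  have hmκ : ENNReal.ofReal κ * m = ENNReal.ofReal (κ * m.toReal) := by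
    rw [ENNReal.ofReal_mul hκ0, ENNReal.ofReal_toReal hfin]
  have hgr : ∀ y, g y = ENNReal.ofReal (g y).toReal := fun y =>
    (ENNReal.ofReal_toReal (hgfin y)).symm
  refine ⟨fun y _ y' _ => ?_, fun y => ?_⟩
  swap
  · rw [hmκ, hgr y]
    exact ENNReal.ofReal_le_ofReal (hsub y)
  set t := θ ^ sepTime F α y y' with ht
  have ht0 : 0 ≤ t := by positivity
  have ht1 : t ≤ 1 := pow_le_one₀ hθ hθ'
  have h1 : (g y).toReal ≤ Real.exp (L₁ * t) * (g y').toReal := by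
    have h2 := ENNReal.toReal_mono (ENNReal.mul_ne_top ENNReal.ofReal_ne_top (hgfin y'))
      (hg y (Set.mem_univ _) y' (Set.mem_univ _))
    rwa [ENNReal.toReal_mul, ENNReal.toReal_ofReal (Real.exp_pos _).le] at h2
  change g y - ENNReal.ofReal κ * m ≤ _ * (g y' - ENNReal.ofReal κ * m)
  rw [hmκ, hgr y, hgr y', ← ENNReal.ofReal_sub _ (by positivity),
    ← ENNReal.ofReal_sub _ (by positivity), ← ENNReal.ofReal_mul (Real.exp_pos _).le]
  refine ENNReal.ofReal_le_ofReal ?_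
  -- Together with `h1` this is the cone inequality after subtraction: the slack between the
  -- exponents `L₁` and `L` has to absorb the subtracted constant, and `hκ` is designed for that.
  have h3 : κ * m.toReal * (Real.exp (L * t) - 1) ≤
      (Real.exp (L * t) - Real.exp (L₁ * t)) * (g y').toReal := by
    have h4 : (L - L₁) * t ≤ Real.exp (L * t) - Real.exp (L₁ * t) := by
      have e : Real.exp (L * t) = Real.exp (L₁ * t) * Real.exp ((L - L₁) * t) := by
        rw [← Real.exp_add]; ring_nf
      have h5 : 1 ≤ Real.exp (L₁ * t) := Real.one_le_exp (by positivity)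
      have h6 := Real.add_one_le_exp ((L - L₁) * t)
      have h7 : 0 ≤ (L - L₁) * t := mul_nonneg (by linarith) ht0
      rw [e]
      nlinarith
    calc κ * m.toReal * (Real.exp (L * t) - 1)
        ≤ κ * m.toReal * (t * (Real.exp L - 1)) :=
          mul_le_mul_of_nonneg_left (exp_mul_sub_one_le ht0 ht1) (by positivity)
      _ = (κ * (Real.exp L - 1)) * (m.toReal * t) := by ring
      _ ≤ (Real.exp (-L₁) * (L - L₁)) * (m.toReal * t) :=
          mul_le_mul_of_nonneg_right hκ (by positivity)
      _ = ((L - L₁) * t) * (Real.exp (-L₁) * m.toReal) := by ring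
      _ ≤ _ := mul_le_mul h4 (hlow y') (by positivity)
          ((mul_nonneg (by linarith) ht0).trans h4)
  linarith

end Cone

/-! ### Regeneration -/

/-- A Gibbs-Markov map regenerates: on each partition element, after one step, a fixed fraction
`κ` of the mass of a regular density is distributed according to the invariant measure, and the
rest `Q_a g` has a regular density. -/
structure Regeneration {Y : Type*} [MeasurableSpace Y] (μ : Measure Y) (F : Y → Y)
    (α : Set (Set Y)) where
  θ : ℝ
  L : ℝ
  κ : ℝ
  θ_pos : 0 < θ
  θ_lt_one : θ < 1
  L_pos : 0 < L
  κ_pos : 0 < κ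
  κ_lt_one : κ < 1
  Q : α → (Y → ℝ≥0∞) → Y → ℝ≥0∞
  measurable_Q : ∀ a g, Measurable g → Measurable (Q a g)
  inCone_Q : ∀ (a : α) g, Measurable g → InCone F α θ L a g → ∫⁻ y in a, g y ∂μ ≠ ∞ →
    InCone F α θ L Set.univ (Q a g)
  lintegral_eq : ∀ (a : α) g, Measurable g → InCone F α θ L a g → ∫⁻ y in a, g y ∂μ ≠ ∞ →
    ∀ u : Y → ℝ≥0∞, Measurable u → ∫⁻ y in a, g y * u (F y) ∂μ =
      ENNReal.ofReal κ * (∫⁻ y in a, g y ∂μ) * (∫⁻ y, u y ∂μ) + ∫⁻ y, Q a g y * u y ∂μ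

namespace IsFullBranchGibbsMarkov

variable {Y : Type*} [MeasurableSpace Y] {μ : Measure Y} {F : Y → Y} {α : Set (Set Y)}

/-- Points of one atom are not separated at time 0, so separation is that of the images one step
later. Injectivity on the atom keeps the images distinct, so neither separation time is a junk
value. -/
theorem sepTime_eq_succ (h : IsFullBranchGibbsMarkov μ F α) {a : Set Y} (ha : a ∈ α) {y y' : Y}
    (hy : y ∈ a) (hy' : y' ∈ a) (hne : y ≠ y') :
    sepTime F α y y' = sepTime F α (F y) (F y') + 1 := by
  have hF : F y ≠ F y' := fun e => hne <| by
    have := (h.measurableEmbedding a ha).injective (a₁ := ⟨y, hy⟩) (a₂ := ⟨y', hy'⟩) e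
    simpa using this
  have hz : ¬ InDistinct α y y' := fun hd => hd a ha hy hy'
  have hmem : InDistinct α (F^[sepTime F α y y'] y) (F^[sepTime F α y y'] y') :=
    Nat.sInf_mem (s := {n | InDistinct α (F^[n] y) (F^[n] y')}) (h.separates y y' hne)
  have hmem' : InDistinct α (F^[sepTime F α (F y) (F y')] (F y))
      (F^[sepTime F α (F y) (F y')] (F y')) :=
    Nat.sInf_mem (s := {n | InDistinct α (F^[n] (F y)) (F^[n] (F y'))}) (h.separates _ _ hF)
  refine le_antisymm (Nat.sInf_le ?_) ?_
  · simpa only [Set.mem_ofPred_eq, Function.iterate_succ_apply] using hmem'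
  · rcases hk : sepTime F α y y' with _ | k
    · rw [hk] at hmem
      exact absurd hmem hz
    · rw [hk] at hmem
      refine Nat.succ_le_succ (Nat.sInf_le ?_)
      simpa only [Set.mem_ofPred_eq, Function.iterate_succ_apply] using hmem

/-- The inverse branches. -/
def branch (h : IsFullBranchGibbsMarkov μ F α) (a : α) (y : Y) : (a : Set Y) :=
  Function.surjInv (h.surjective a a.2) y

theorem map_branch (h : IsFullBranchGibbsMarkov μ F α) (a : α) (y : Y) :
    F (h.branch a y) = y :=
  Function.surjInv_eq (h.surjective a a.2) y

theorem branch_map (h : IsFullBranchGibbsMarkov μ F α) (a : α) (y : (a : Set Y)) :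
    h.branch a (F y) = y :=
  Function.leftInverse_surjInv ⟨(h.measurableEmbedding a a.2).injective, h.surjective a a.2⟩ y

theorem measurable_branch (h : IsFullBranchGibbsMarkov μ F α) (a : α) :
    Measurable (h.branch a) := fun t ht => by
  have : h.branch a ⁻¹' t = (a : Set Y).domRestrict F '' t := by
    ext y
    constructor
    · intro hy
      exact ⟨h.branch a y, hy, h.map_branch a y⟩
    · rintro ⟨x, hx, rfl⟩
      change h.branch a (F x) ∈ t
      rwa [h.branch_map]
  rw [this]
  exact (h.measurableEmbedding a a.2).measurableSet_image' ht

/-- The transfer operator of a single branch improves the cone exponent from `L` to `L₁ < L`, by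
bounded distortion and the gain of one step in separation time. The slack is spent on splitting off
a constant density of mass fraction `κ`. The lower bound on `G.θ` lets the cone accommodate Hölder
observables with a prescribed exponent. -/
theorem exists_regeneration (h : IsFullBranchGibbsMarkov μ F α) {θ₀ : ℝ} (hθ₀ : 0 < θ₀)
    (hθ₁ : θ₀ < 1) : ∃ G : Regeneration μ F α, θ₀ ≤ G.θ := by
  have := h.isProbabilityMeasure
  obtain ⟨ξ, hξm, hξpos, hξ, C, θ₁, hC, hθ₁pos, hθ₁lt, hdist⟩ := h.bounded_distortion
  set θ := max θ₀ θ₁ with hθdef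
  have hθpos : 0 < θ := lt_max_of_lt_left hθ₀
  have hθlt : θ < 1 := max_lt hθ₁ hθ₁lt
  -- Chosen so that the fixed-point inequality (C + L) θ < L holds, with gap exactly 1 - θ.
  set L := C * θ / (1 - θ) + 1 with hL
  have h1θ : 0 < 1 - θ := by linarith
  have hLpos : 0 < L := by positivity
  set L₁ := (C + L) * θ with hL₁
  have hL₁pos : 0 < L₁ := by positivity
  have hLL : L - L₁ = 1 - θ := by
    rw [hL₁, hL]; field_simp; ring
  have hexp : L ≤ Real.exp L - 1 := by linarith [Real.add_one_le_exp L]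
  -- The largest value that `InCone.sub_const` admits.
  set κ := Real.exp (-L₁) * (L - L₁) / (Real.exp L - 1) with hκ
  have hκpos : 0 < κ := by
    have : 0 < Real.exp L - 1 := by linarith
    have : 0 < L - L₁ := by linarith
    positivity
  have hκle : κ * (Real.exp L - 1) ≤ Real.exp (-L₁) * (L - L₁) := by
    rw [hκ, div_mul_cancel₀]
    linarith
  have hκlt : κ < 1 := by
    have h1 : Real.exp (-L₁) < 1 := Real.exp_lt_one_iff.2 (by linarith)
    have h2 : κ ≤ Real.exp (-L₁) := by
      refine le_of_mul_le_mul_right (hκle.trans (mul_le_mul_of_nonneg_left ?_ (Real.exp_pos _).le))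
        (by linarith : 0 < Real.exp L - 1)
      linarith
    linarith
  -- The transfer operator of the branch of `F` on one atom.
  let R : α → (Y → ℝ≥0∞) → Y → ℝ≥0∞ := fun a g y =>
    ENNReal.ofReal (ξ (h.branch a y)) * g (h.branch a y)
  have hbm : ∀ a, Measurable fun y => (h.branch a y : Y) := fun a =>
    measurable_subtype_coe.comp (h.measurable_branch a)
  have hRm : ∀ a g, Measurable g → Measurable (R a g) := fun a g hg =>
    ((hξm.comp (hbm a)).ennreal_ofReal).mul (hg.comp (hbm a))
  have hRint : ∀ (a : α) g, Measurable g → ∀ u : Y → ℝ≥0∞, Measurable u →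
      ∫⁻ y in a, g y * u (F y) ∂μ = ∫⁻ y, R a g y * u y ∂μ := by
    intro a g hg u hu
    have hem := h.measurableEmbedding a a.2
    have hFm : Measurable F := h.ergodic.measurable
    rw [← lintegral_subtype_comap (h.measurableSet a a.2), hξ a a.2,
      lintegral_withDensity_eq_lintegral_mul _ (by fun_prop) (by fun_prop)]
    have hmap : (μ.comap ((a : Set Y).domRestrict F)).map ((a : Set Y).domRestrict F) = μ := by
      rw [hem.map_comap, (h.surjective a a.2).range_eq, Measure.restrict_univ]
    conv_rhs => rw [← hmap]
    rw [hem.lintegral_map]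
    refine lintegral_congr fun x => ?_
    change ENNReal.ofReal (ξ x) * (g x * u (F x)) =
      ENNReal.ofReal (ξ (h.branch a (F x))) * g (h.branch a (F x)) * u (F x)
    rw [h.branch_map, mul_assoc]
  have hRcone : ∀ (a : α) g, InCone F α θ L a g → InCone F α θ L₁ Set.univ (R a g) := by
    intro a g hg y _ y' _
    rcases eq_or_ne y y' with rfl | hne
    · exact le_mul_of_one_le_left' (one_le_ofReal_exp (by positivity))
    have hne' : (h.branch a y : Y) ≠ h.branch a y' := fun e => hne <| by
      rw [← h.map_branch a y, e, h.map_branch]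
    have hsep := h.sepTime_eq_succ a.2 (h.branch a y).2 (h.branch a y').2 hne'
    rw [h.map_branch, h.map_branch] at hsep
    have h1 := hg _ (h.branch a y).2 _ (h.branch a y').2
    have h2 := hdist a a.2 _ (h.branch a y).2 _ (h.branch a y').2 hne'
    rw [hsep] at h1 h2
    set s := sepTime F α y y'
    have h3 : ξ (h.branch a y) ≤ Real.exp (C * θ ^ (s + 1)) * ξ (h.branch a y') := by
      have h4 : C * θ₁ ^ (s + 1) ≤ C * θ ^ (s + 1) :=
        mul_le_mul_of_nonneg_left (pow_le_pow_left₀ hθ₁pos.le (le_max_right _ _) _) hC.le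
      rw [← Real.log_le_log_iff (hξpos _) (mul_pos (Real.exp_pos _) (hξpos _)),
        Real.log_mul (Real.exp_pos _).ne' (hξpos _).ne', Real.log_exp]
      linarith [le_abs_self (Real.log (ξ (h.branch a y)) - Real.log (ξ (h.branch a y')))]
    calc R a g y ≤ ENNReal.ofReal (Real.exp (C * θ ^ (s + 1)) * ξ (h.branch a y')) *
          (ENNReal.ofReal (Real.exp (L * θ ^ (s + 1))) * g (h.branch a y')) :=
          mul_le_mul' (ENNReal.ofReal_le_ofReal h3) h1
      _ = ENNReal.ofReal (Real.exp (C * θ ^ (s + 1))) * ENNReal.ofReal (Real.exp (L * θ ^ (s + 1))) *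
          R a g y' := by
          rw [ENNReal.ofReal_mul (Real.exp_pos _).le]
          change _ = _ * (ENNReal.ofReal (ξ (h.branch a y')) * g (h.branch a y'))
          ring
      _ = ENNReal.ofReal (Real.exp (L₁ * θ ^ s)) * R a g y' := by
          rw [← ENNReal.ofReal_mul (Real.exp_pos _).le, ← Real.exp_add, hL₁]
          ring_nf
  have hRmass : ∀ (a : α) g, Measurable g → ∫⁻ y, R a g y ∂μ = ∫⁻ y in a, g y ∂μ := by
    intro a g hg
    simpa using (hRint a g hg (fun _ => 1) measurable_const).symm
  have hsub : ∀ (a : α) g, Measurable g → InCone F α θ L a g → ∫⁻ y in a, g y ∂μ ≠ ∞ → _ :=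
    fun a g hg hc hfin => InCone.sub_const (μ := μ) hθpos.le hθlt.le hL₁pos.le
      (by linarith : L₁ < L) hκpos.le hκle (hRcone a g hc) (by rwa [hRmass a g hg])
  refine ⟨{ θ := θ, L := L, κ := κ, θ_pos := hθpos, θ_lt_one := hθlt, L_pos := hLpos,
            κ_pos := hκpos, κ_lt_one := hκlt,
            Q := fun a g y => R a g y - ENNReal.ofReal κ * ∫⁻ y, R a g y ∂μ,
            measurable_Q := fun a g hg => (hRm a g hg).sub_const _,
            inCone_Q := fun a g hg hc hfin => (hsub a g hg hc hfin).1,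
            lintegral_eq := fun a g hg hc hfin u hu => ?_ }, le_max_left _ _⟩
  rw [hRint a g hg u hu, ← hRmass a g hg, ← lintegral_const_mul _ hu,
    ← lintegral_add_left (hu.const_mul _)]
  refine lintegral_congr fun y => ?_
  rw [← add_mul, add_tsub_cancel_of_le ((hsub a g hg hc hfin).2 y)]

end IsFullBranchGibbsMarkov

/-! ### Return times, delays and the renewal operator -/

section Delay

variable {Y : Type*}

/-- The value of a time on a partition element (on which it is constant). -/
def atomTime (φ : Y → ℕ) (a : Set Y) : ℕ := sInf (φ '' a)

/-- Delay of a sequence of functions by the time `φ`. -/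
def delay (φ : Y → ℕ) (X : ℕ → Y → ℝ≥0∞) (n : ℕ) (y : Y) : ℝ≥0∞ :=
  if φ y ≤ n then X (n - φ y) y else 0

/-- `K_n W = ∑_k 1_{φ_k = n} W ∘ F^k`, where `φ_k` are the Birkhoff sums of `φ`. -/
def renewalOp (F : Y → Y) (φ : Y → ℕ) (W : Y → ℝ≥0∞) : ℕ → Y → ℝ≥0∞
  | n => fun y => (if n = 0 then W y else 0) +
      if _h : 1 ≤ φ y ∧ φ y ≤ n then renewalOp F φ W (n - φ y) (F y) else 0
termination_by n => n
decreasing_by omega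

/-- A return time: positive, and constant on partition elements. -/
structure IsReturnTime (α : Set (Set Y)) (φ : Y → ℕ) : Prop where
  pos : ∀ y, 1 ≤ φ y
  const : ∀ a ∈ α, ∀ y ∈ a, ∀ y' ∈ a, φ y = φ y'

variable {F : Y → Y} {α : Set (Set Y)} {φ : Y → ℕ}

theorem IsReturnTime.atomTime_eq (hφ : IsReturnTime α φ) {a : Set Y} (ha : a ∈ α) {y : Y}
    (hy : y ∈ a) : atomTime φ a = φ y := by
  have : φ '' a = {φ y} := by
    ext n
    constructor
    · rintro ⟨y', hy', rfl⟩
      exact hφ.const a ha y' hy' y hy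
    · rintro rfl
      exact ⟨y, hy, rfl⟩
  rw [atomTime, this, csInf_singleton]

theorem IsReturnTime.renewalOp_eq (hφ : IsReturnTime α φ) (W : Y → ℝ≥0∞) (n : ℕ) (y : Y) :
    renewalOp F φ W n y = (if n = 0 then W y else 0) +
      if φ y ≤ n then renewalOp F φ W (n - φ y) (F y) else 0 := by
  rw [renewalOp]
  simp [hφ.pos y]

/-- A delay by `c` is multiplication by `X ^ c`, which can be moved from one factor of a Cauchy
product to the other. -/
theorem sum_antidiagonal_delay (x k : ℕ → ℝ≥0∞) (c n : ℕ) :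
    ∑ p ∈ Finset.HasAntidiagonal.antidiagonal n, x p.1 * (if c ≤ p.2 then k (p.2 - c) else 0) =
    ∑ p ∈ Finset.HasAntidiagonal.antidiagonal n, (if c ≤ p.1 then x (p.1 - c) else 0) * k p.2 := by
  have h1 := PowerSeries.coeff_mul n (PowerSeries.mk x) (PowerSeries.mk k * PowerSeries.X ^ c)
  have h2 := PowerSeries.coeff_mul n (PowerSeries.mk x * PowerSeries.X ^ c) (PowerSeries.mk k)
  simp only [PowerSeries.coeff_mul_X_pow', PowerSeries.coeff_mk] at h1 h2
  rw [← h1, ← h2]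
  congr 1
  ring

end Delay

/-! ### Evolution of the nonregenerated density -/

section Regen

variable {Y : Type*} [MeasurableSpace Y] {μ : Measure Y} {F : Y → Y} {α : Set (Set Y)}

/-- The part of the density `g` that arrives in the base at time `n` and has not regenerated. -/
def regen (G : Regeneration μ F α) (φ : Y → ℕ) (g : Y → ℝ≥0∞) : ℕ → Y → ℝ≥0∞
  | n => fun y => (if n = 0 then g y else 0) +
      ∑' a : α, if _h : 1 ≤ atomTime φ a ∧ atomTime φ a ≤ n then
        G.Q a (regen G φ g (n - atomTime φ a)) y else 0
termination_by n => n
decreasing_by omega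

theorem measurable_of_uncurry {X : ℕ → Y → ℝ≥0∞} (hX : ∀ n, Measurable (X n)) {t : Y → ℕ}
    (ht : Measurable t) : Measurable fun y => X (t y) y := by
  have : Measurable fun q : ℕ × Y => X q.1 q.2 := measurable_from_prod_countable_right hX
  exact this.comp (ht.prodMk measurable_id)

theorem measurable_delay {φ : Y → ℕ} (hφ : Measurable φ) {X : ℕ → Y → ℝ≥0∞}
    (hX : ∀ n, Measurable (X n)) (n : ℕ) : Measurable (delay φ X n) := by
  refine Measurable.ite (measurableSet_le hφ measurable_const) ?_ measurable_const
  exact measurable_of_uncurry hX (measurable_const.sub hφ)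

namespace IsFullBranchGibbsMarkov

variable (h : IsFullBranchGibbsMarkov μ F α)

include h

theorem lintegral_eq_tsum_atoms (f : Y → ℝ≥0∞) :
    ∫⁻ y, f y ∂μ = ∑' a : α, ∫⁻ y in a, f y ∂μ := by
  have : Countable α := h.countable.to_subtype
  have hU : ⋃ a : α, (a : Set Y) = Set.univ := by
    rw [← Set.sUnion_eq_iUnion]; exact h.isPartition.sUnion_eq_univ
  rw [← lintegral_iUnion (fun a : α => h.measurableSet a a.2), hU, Measure.restrict_univ]
  intro a b hab
  exact h.isPartition.pairwiseDisjoint a.2 b.2 (fun e => hab (Subtype.ext e))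

theorem exists_mem_atom (y : Y) : ∃ a ∈ α, y ∈ a := by
  obtain ⟨a, ha, -⟩ := h.isPartition.2 y
  exact ⟨a, ha.1, ha.2⟩

theorem measurable_of_const_on_atoms {β : Type*} [MeasurableSpace β] {f : Y → β}
    (hf : ∀ a ∈ α, ∀ y ∈ a, ∀ y' ∈ a, f y = f y') : Measurable f := fun t _ => by
  have : f ⁻¹' t = ⋃ a ∈ {a ∈ α | a ⊆ f ⁻¹' t}, a := by
    ext y
    simp only [Set.mem_iUnion, exists_prop]
    constructor
    · intro hy
      obtain ⟨a, ha, hya⟩ := h.exists_mem_atom y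
      refine ⟨a, ⟨ha, fun y' hy' => ?_⟩, hya⟩
      change f y' ∈ t
      rw [hf a ha y' hy' y hya]
      exact hy
    · rintro ⟨a, ⟨-, ha⟩, hy⟩
      exact ha hy
  rw [this]
  exact MeasurableSet.biUnion (h.countable.mono fun a ha => ha.1) fun a ha => h.measurableSet a ha.1

theorem measurable_returnTime {φ : Y → ℕ} (hφ : IsReturnTime α φ) : Measurable φ :=
  h.measurable_of_const_on_atoms hφ.const

variable {φ : Y → ℕ} (hφ : IsReturnTime α φ)

include hφ

theorem measurable_renewalOp {W : Y → ℝ≥0∞} (hW : Measurable W) (n : ℕ) :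
    Measurable (renewalOp F φ W n) := by
  induction n using Nat.strong_induction_on with
  | _ n ih =>
    have e : renewalOp F φ W n = fun y => (if n = 0 then W y else 0) +
        delay φ (fun m y => if m < n then renewalOp F φ W m (F y) else 0) n y := by
      funext y
      rw [hφ.renewalOp_eq, delay]
      have := hφ.pos y
      congr 1
      split_ifs <;> first | rfl | omega
    rw [e]
    have hF : Measurable F := h.ergodic.measurable
    refine Measurable.add ?_ (measurable_delay (h.measurable_returnTime hφ) (fun m => ?_) n)
    · split_ifs <;> [exact hW; exact measurable_const]
    · split_ifs with hm
      · exact (ih m hm).comp hF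
      · exact measurable_const

/-- A crude bound whose only purpose is finiteness, so that integrals can be cancelled and converted
to reals. -/
theorem lintegral_renewalOp_le {W : Y → ℝ≥0∞} (hW : Measurable W) (n : ℕ) :
    ∫⁻ y, renewalOp F φ W n y ∂μ ≤ 2 ^ n * ∫⁻ y, W y ∂μ := by
  induction n using Nat.strong_induction_on with
  | _ n ih =>
    rcases Nat.eq_zero_or_pos n with rfl | hn
    · refine (lintegral_mono fun y => ?_).trans_eq (one_mul _).symm
      rw [hφ.renewalOp_eq, if_pos rfl, if_neg (by have := hφ.pos y; omega), add_zero]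
    have hle : ∀ y, renewalOp F φ W n y ≤ ∑ j ∈ Finset.range n, renewalOp F φ W j (F y) := fun y => by
      rw [hφ.renewalOp_eq, if_neg hn.ne', zero_add]
      split_ifs with hy
      · have := hφ.pos y
        exact Finset.single_le_sum (f := fun j => renewalOp F φ W j (F y)) (fun _ _ => zero_le)
          (Finset.mem_range.2 (by omega))
      · exact zero_le
    refine (lintegral_mono hle).trans ?_
    have hF := h.ergodic.toMeasurePreserving
    rw [lintegral_finsetSum (f := fun j y => renewalOp F φ W j (F y)) _
      fun j _ => (h.measurable_renewalOp hφ hW j).comp hF.measurable]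
    have : ∀ j ∈ Finset.range n, ∫⁻ y, renewalOp F φ W j (F y) ∂μ ≤ 2 ^ j * ∫⁻ y, W y ∂μ := fun j hj => by
      rw [hF.lintegral_comp (h.measurable_renewalOp hφ hW j)]
      exact ih j (Finset.mem_range.1 hj)
    refine (Finset.sum_le_sum this).trans ?_
    rw [← Finset.sum_mul]
    gcongr
    have : ∑ j ∈ Finset.range n, (2:ℕ) ^ j ≤ 2 ^ n := (Nat.geomSum_lt le_rfl (by simp)).le
    exact_mod_cast this

variable (G : Regeneration μ F α) {g : Y → ℝ≥0∞} (hgm : Measurable g)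
  (hgc : InCone F α G.θ G.L Set.univ g) (hgf : ∫⁻ y, g y ∂μ ≠ ∞)

include hgm hgc hgf

/-- The three properties need a joint induction: the operators `G.Q` preserve regularity only for
measurable regular densities of finite mass. -/
theorem regen_aux (n : ℕ) : Measurable (regen G φ g n) ∧
    InCone F α G.θ G.L Set.univ (regen G φ g n) ∧ ∫⁻ y, regen G φ g n y ∂μ ≠ ∞ := by
  have : Countable α := h.countable.to_subtype
  have := h.isProbabilityMeasure
  induction n using Nat.strong_induction_on with
  | _ n ih =>
    have hfin : ∀ m < n, ∀ a : α, ∫⁻ y in a, regen G φ g m y ∂μ ≠ ∞ := fun m hm a =>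
      ne_top_of_le_ne_top (ih m hm).2.2 (setLIntegral_le_lintegral _ _)
    have hterm_m : ∀ a : α, Measurable fun y =>
        if _h : 1 ≤ atomTime φ a ∧ atomTime φ a ≤ n then
          G.Q a (regen G φ g (n - atomTime φ a)) y else 0 := fun a => by
      split_ifs with hc
      · exact G.measurable_Q _ _ (ih _ (by omega)).1
      · exact measurable_const
    have e : regen G φ g n = fun y => (if n = 0 then g y else 0) +
      ∑' a : α, if _h : 1 ≤ atomTime φ a ∧ atomTime φ a ≤ n then
        G.Q a (regen G φ g (n - atomTime φ a)) y else 0 := by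
      funext y; rw [regen]
    have hg0 : Measurable fun y => if n = 0 then g y else 0 := by
      split_ifs <;> [exact hgm; exact measurable_const]
    rw [e]
    refine ⟨hg0.add (Measurable.tsum hterm_m), InCone.add ?_ (InCone.tsum fun a => ?_), ?_⟩
    · split_ifs <;> [exact hgc; exact inCone_zero]
    · split_ifs with hc
      · have := ih (n - atomTime φ a) (by omega)
        exact G.inCone_Q a _ this.1 (this.2.1.mono (Set.subset_univ _)) (hfin _ (by omega) a)
      · exact inCone_zero
    · rw [lintegral_add_left hg0, lintegral_tsum fun a => (hterm_m a).aemeasurable]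
      refine ENNReal.add_ne_top.2 ⟨?_, ?_⟩
      · split_ifs <;> [exact hgf; simp]
      · have hle : ∀ a : α, ∫⁻ y, (if _h : 1 ≤ atomTime φ a ∧ atomTime φ a ≤ n then
            G.Q a (regen G φ g (n - atomTime φ a)) y else 0) ∂μ ≤
            ∑ m ∈ Finset.range n, ∫⁻ y in a, regen G φ g m y ∂μ := fun a => by
          split_ifs with hc
          · have h1 := ih (n - atomTime φ a) (by omega)
            have h2 := G.lintegral_eq a _ h1.1 (h1.2.1.mono (Set.subset_univ _))
              (hfin _ (by omega) a) (fun _ => 1) measurable_const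
            simp only [mul_one] at h2
            refine le_trans ?_ (Finset.single_le_sum
              (f := fun m => ∫⁻ y in a, regen G φ g m y ∂μ) (fun _ _ => zero_le)
              (Finset.mem_range.2 (show n - atomTime φ a < n by omega)))
            change _ ≤ ∫⁻ y in a, regen G φ g (n - atomTime φ a) y ∂μ
            rw [h2]
            exact le_add_self
          · simp
        refine ne_top_of_le_ne_top ?_ (ENNReal.tsum_le_tsum hle)
        rw [Summable.tsum_finsetSum fun _ _ => ENNReal.summable]
        simp_rw [← h.lintegral_eq_tsum_atoms]
        exact ENNReal.sum_ne_top.2 fun m hm => (ih m (Finset.mem_range.1 hm)).2.2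

theorem measurable_regen (n : ℕ) : Measurable (regen G φ g n) :=
  (h.regen_aux hφ G hgm hgc hgf n).1

theorem inCone_regen (n : ℕ) : InCone F α G.θ G.L Set.univ (regen G φ g n) :=
  (h.regen_aux hφ G hgm hgc hgf n).2.1

theorem lintegral_regen_ne_top (n : ℕ) : ∫⁻ y, regen G φ g n y ∂μ ≠ ∞ :=
  (h.regen_aux hφ G hgm hgc hgf n).2.2

/-- One step of the dynamics applied to the nonregenerated part. -/
theorem lintegral_delay_regen {u : Y → ℝ≥0∞} (hu : Measurable u) (n : ℕ) :
    (if n = 0 then ∫⁻ y, g y * u y ∂μ else 0) +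
      ∫⁻ y, delay φ (regen G φ g) n y * u (F y) ∂μ =
    ∫⁻ y, regen G φ g n y * u y ∂μ +
      ENNReal.ofReal G.κ * (∫⁻ y, delay φ (regen G φ g) n y ∂μ) * ∫⁻ y, u y ∂μ := by
  have : Countable α := h.countable.to_subtype
  have hterm_m : ∀ a : α, Measurable fun y =>
      if _h : 1 ≤ atomTime φ a ∧ atomTime φ a ≤ n then
        G.Q a (regen G φ g (n - atomTime φ a)) y else 0 := fun a => by
    split_ifs with hc
    · exact G.measurable_Q _ _ (h.measurable_regen hφ G hgm hgc hgf _)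
    · exact measurable_const
  have hatom : ∀ a : α, ∫⁻ y in a, delay φ (regen G φ g) n y * u (F y) ∂μ =
      ENNReal.ofReal G.κ * (∫⁻ y in a, delay φ (regen G φ g) n y ∂μ) * (∫⁻ y, u y ∂μ) +
      ∫⁻ y, (if _h : 1 ≤ atomTime φ a ∧ atomTime φ a ≤ n then
        G.Q a (regen G φ g (n - atomTime φ a)) y else 0) * u y ∂μ := fun a => by
    by_cases hc : 1 ≤ atomTime φ a ∧ atomTime φ a ≤ n
    · simp only [dif_pos hc]
      have hd : ∀ y ∈ (a : Set Y), delay φ (regen G φ g) n y =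
          regen G φ g (n - atomTime φ a) y := fun y hy => by
        rw [delay, ← hφ.atomTime_eq a.2 hy, if_pos hc.2]
      rw [setLIntegral_congr_fun (h.measurableSet a a.2) hd,
        ← G.lintegral_eq a _ (h.measurable_regen hφ G hgm hgc hgf _)
        ((h.inCone_regen hφ G hgm hgc hgf _).mono (Set.subset_univ _))
        (ne_top_of_le_ne_top (h.lintegral_regen_ne_top hφ G hgm hgc hgf _)
          (setLIntegral_le_lintegral _ _)) u hu]
      refine setLIntegral_congr_fun (h.measurableSet a a.2) fun y hy => ?_
      simp only [hd y hy]
    · simp only [dif_neg hc]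
      have hd : ∀ y ∈ (a : Set Y), delay φ (regen G φ g) n y = 0 := fun y hy => by
        have h1 := hφ.pos y
        rw [hφ.atomTime_eq a.2 hy] at hc
        rw [delay, if_neg (by omega)]
      rw [setLIntegral_congr_fun (h.measurableSet a a.2) hd,
        setLIntegral_congr_fun (g := fun _ => 0) (h.measurableSet a a.2)
          (fun y hy => by simp only [hd y hy, zero_mul])]
      simp
  rw [h.lintegral_eq_tsum_atoms (fun y => delay φ (regen G φ g) n y * u (F y)),
    h.lintegral_eq_tsum_atoms (fun y => delay φ (regen G φ g) n y)]
  simp_rw [hatom]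
  rw [ENNReal.tsum_add, ENNReal.tsum_mul_right, ENNReal.tsum_mul_left,
    ← lintegral_tsum (f := fun (a : α) y => (if _h : 1 ≤ atomTime φ a ∧ atomTime φ a ≤ n then
        G.Q a (regen G φ g (n - atomTime φ a)) y else 0) * u y)
      fun a => ((hterm_m a).mul hu).aemeasurable]
  simp_rw [ENNReal.tsum_mul_right]
  have e : ∫⁻ y, regen G φ g n y * u y ∂μ = (if n = 0 then ∫⁻ y, g y * u y ∂μ else 0) +
      ∫⁻ y, (∑' a : α, if _h : 1 ≤ atomTime φ a ∧ atomTime φ a ≤ n then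
        G.Q a (regen G φ g (n - atomTime φ a)) y else 0) * u y ∂μ := by
    have e1 : (if n = 0 then ∫⁻ y, g y * u y ∂μ else 0) =
        ∫⁻ y, (if n = 0 then g y else 0) * u y ∂μ := by
      split_ifs <;> simp
    rw [e1, ← lintegral_add_left]
    · refine lintegral_congr fun y => ?_
      rw [regen, add_mul]
    · refine Measurable.mul ?_ hu
      split_ifs <;> [exact hgm; exact measurable_const]
  rw [e]
  ring

theorem lintegral_delay_regen_ne_top (n : ℕ) :
    ∫⁻ y, delay φ (regen G φ g) n y ∂μ ≠ ∞ := by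
  refine ne_top_of_le_ne_top (b := ∑ m ∈ Finset.range (n + 1), ∫⁻ y, regen G φ g m y ∂μ)
    (ENNReal.sum_ne_top.2 fun m _ => h.lintegral_regen_ne_top hφ G hgm hgc hgf m) ?_
  rw [← lintegral_finsetSum _ fun m _ => h.measurable_regen hφ G hgm hgc hgf m]
  refine lintegral_mono fun y => ?_
  rw [delay]
  split_ifs with hy
  · exact Finset.single_le_sum (f := fun m => regen G φ g m y) (fun _ _ => zero_le)
      (Finset.mem_range.2 (by omega))
  · exact zero_le

/-- The regeneration identity: mass arriving in the base at time `n` either has not regenerated or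
has first regenerated at some time `i ≤ n`. -/
theorem lintegral_mul_renewalOp {W : Y → ℝ≥0∞} (hW : Measurable W) (hWf : ∫⁻ y, W y ∂μ ≠ ∞)
    (n : ℕ) :
    ∫⁻ y, g y * renewalOp F φ W n y ∂μ = ∫⁻ y, regen G φ g n y * W y ∂μ +
      ∑ p ∈ Finset.HasAntidiagonal.antidiagonal n,
        ENNReal.ofReal G.κ * (∫⁻ y, delay φ (regen G φ g) p.1 y ∂μ) *
          ∫⁻ y, renewalOp F φ W p.2 y ∂μ := by
  have := h.isProbabilityMeasure
  have hF : Measurable F := h.ergodic.measurable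
  have hSm := h.measurable_regen hφ G hgm hgc hgf
  have hKm := h.measurable_renewalOp hφ hW
  have hDm := measurable_delay (h.measurable_returnTime hφ) hSm
  have hKf : ∀ j, ∫⁻ y, renewalOp F φ W j y ∂μ ≠ ∞ := fun j =>
    ne_top_of_le_ne_top (ENNReal.mul_ne_top (by simp) hWf) (h.lintegral_renewalOp_le hφ hW j)
  -- `A` is evaluated twice. Expanding the renewal operator by its first step gives `hA1`; expanding
  -- the nonregenerated density by one step of the dynamics gives `hA2`. The common sum is finite
  -- and cancels.
  set A := ∑ p ∈ Finset.HasAntidiagonal.antidiagonal n,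
    ∫⁻ y, regen G φ g p.1 y * renewalOp F φ W p.2 y ∂μ with hA
  have hAf : A ≠ ∞ := by
    refine ENNReal.sum_ne_top.2 fun p _ => ?_
    refine ne_top_of_le_ne_top (ENNReal.mul_ne_top (ENNReal.mul_ne_top ENNReal.ofReal_ne_top
      (h.lintegral_regen_ne_top hφ G hgm hgc hgf p.1)) (hKf p.2))
      ((lintegral_mono fun y => mul_le_mul_left ((h.inCone_regen hφ G hgm hgc hgf
        p.1).le_lintegral (μ := μ) G.θ_pos.le G.θ_lt_one.le G.L_pos.le y) _).trans_eq
        (lintegral_const_mul _ (hKm p.2)))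
  have hA1 : A = ∫⁻ y, regen G φ g n y * W y ∂μ +
      ∑ p ∈ Finset.HasAntidiagonal.antidiagonal n,
        ∫⁻ y, delay φ (regen G φ g) p.1 y * renewalOp F φ W p.2 (F y) ∂μ := by
    rw [hA, ← lintegral_finsetSum
        (f := fun (p : ℕ × ℕ) y => regen G φ g p.1 y * renewalOp F φ W p.2 y) _
        fun p _ => (hSm p.1).mul (hKm p.2),
      ← lintegral_finsetSum
        (f := fun (p : ℕ × ℕ) y => delay φ (regen G φ g) p.1 y * renewalOp F φ W p.2 (F y)) _
        fun p _ => (hDm p.1).mul ((hKm p.2).comp hF),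
      ← lintegral_add_left (f := fun y => regen G φ g n y * W y) ((hSm n).mul hW)]
    refine lintegral_congr fun y => ?_
    have h1 := sum_antidiagonal_delay (fun i => regen G φ g i y)
      (fun i => renewalOp F φ W i (F y)) (φ y) n
    have h2 : ∀ p ∈ Finset.HasAntidiagonal.antidiagonal n,
        regen G φ g p.1 y * renewalOp F φ W p.2 y =
        (if p.2 = 0 then regen G φ g p.1 y * W y else 0) +
          regen G φ g p.1 y * (if φ y ≤ p.2 then renewalOp F φ W (p.2 - φ y) (F y) else 0) := by
      intro p _
      rw [hφ.renewalOp_eq, mul_add]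
      split_ifs <;> simp
    rw [Finset.sum_congr rfl h2, Finset.sum_add_distrib, h1]
    congr 1
    rw [Finset.sum_eq_single (n, 0)]
    · simp
    · rintro ⟨i, j⟩ hp hne
      rw [Finset.HasAntidiagonal.mem_antidiagonal] at hp
      refine if_neg fun hj => hne ?_
      simp only at hj hp
      subst hj
      simp_all
    · intro hn
      simp at hn
  have hA2 : ∫⁻ y, g y * renewalOp F φ W n y ∂μ +
      ∑ p ∈ Finset.HasAntidiagonal.antidiagonal n,
        ∫⁻ y, delay φ (regen G φ g) p.1 y * renewalOp F φ W p.2 (F y) ∂μ =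
      A + ∑ p ∈ Finset.HasAntidiagonal.antidiagonal n,
        ENNReal.ofReal G.κ * (∫⁻ y, delay φ (regen G φ g) p.1 y ∂μ) *
          ∫⁻ y, renewalOp F φ W p.2 y ∂μ := by
    rw [hA, ← Finset.sum_add_distrib]
    simp_rw [← h.lintegral_delay_regen hφ G hgm hgc hgf (hKm _)]
    rw [Finset.sum_add_distrib]
    congr 1
    rw [Finset.sum_eq_single (0, n)]
    · simp
    · rintro ⟨i, j⟩ hp hne
      rw [Finset.HasAntidiagonal.mem_antidiagonal] at hp
      refine if_neg fun hj => hne ?_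
      simp only at hj hp
      subst hj
      simp_all
    · intro hn
      simp at hn
  have hBf : ∑ p ∈ Finset.HasAntidiagonal.antidiagonal n,
        ∫⁻ y, delay φ (regen G φ g) p.1 y * renewalOp F φ W p.2 (F y) ∂μ ≠ ∞ :=
    ne_top_of_le_ne_top hAf (by rw [hA1]; exact le_add_self)
  rw [hA1, add_right_comm] at hA2
  exact (ENNReal.add_left_inj hBf).1 hA2

end IsFullBranchGibbsMarkov

end Regen

/-! ### Polynomial decay from a recursive inequality -/

section Decay

variable {β : ℝ}

/-- Going back from n to n(1 - 1/q) increases n^{-β} by a factor close to 1 for large `q`, so half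
of the gain `κ` survives. -/
theorem exists_nat_mul_rpow_le (hβ : 0 ≤ β) {κ : ℝ} (h0 : 0 < κ) :
    ∃ q : ℕ, 2 ≤ q ∧ (1 - κ) * ((1 - (q : ℝ)⁻¹)⁻¹) ^ β ≤ 1 - κ / 2 := by
  have hlim : Tendsto (fun q : ℕ => (1 - κ) * ((1 - (q : ℝ)⁻¹)⁻¹) ^ β) atTop
      (𝓝 ((1 - κ) * ((1 - 0)⁻¹) ^ β)) := by
    refine Tendsto.const_mul _ (Tendsto.rpow_const ?_ (Or.inr hβ))
    exact (tendsto_inv_atTop_nhds_zero_nat.const_sub 1).inv₀ (by norm_num)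
  simp only [sub_zero, inv_one, Real.one_rpow, mul_one] at hlim
  obtain ⟨q, hq, hq2⟩ := ((hlim.eventually_lt_const (show 1 - κ < 1 - κ / 2 by linarith)).and
    (eventually_ge_atTop 2)).exists
  exact ⟨q, hq2, hq.le⟩

/-- A sequence with `T_N ≤ (1 - κ) T_{N-M} + O(M^{-β})` decays like `N^{-β}`. -/
theorem exists_decay_bound (hβ : 0 ≤ β) {κ : ℝ} (h0 : 0 < κ) (h1 : κ < 1) {K : ℝ}
    (hK : 0 ≤ K) : ∃ C : ℝ, 0 < C ∧ ∀ (T : ℕ → ℝ) (B : ℝ), 0 ≤ B → (∀ n, T n ≤ B) →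
      (∀ N M, M ≤ N → T N ≤ (1 - κ) * T (N - M) + B * (K * powSeq β M)) →
      ∀ n, T n ≤ C * B * powSeq β n := by
  obtain ⟨q, hq2, hq⟩ := exists_nat_mul_rpow_le hβ h0
  have hq0 : (0:ℝ) < q := by positivity
  have hq1 : (2:ℝ) ≤ q := by exact_mod_cast hq2
  have hqi : (q : ℝ)⁻¹ ≤ 1 / 2 := by
    rw [inv_le_comm₀ hq0 (by norm_num)]; norm_num; exact hq2
  set c := (1 - (q : ℝ)⁻¹)⁻¹ with hc
  have hc1 : 1 ≤ c := by
    rw [hc]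
    refine (one_le_inv₀ (by linarith)).2 ?_
    have : 0 < (q : ℝ)⁻¹ := by positivity
    linarith
  refine ⟨(q : ℝ) ^ β + 2 * K * (2 * q) ^ β / κ, by positivity, fun T B hB hTB hrec n => ?_⟩
  set C := (q : ℝ) ^ β + 2 * K * (2 * q) ^ β / κ with hC
  have hC0 : 0 ≤ C := by positivity
  induction n using Nat.strong_induction_on with
  | _ n ih =>
    have han := powSeq_nonneg β n
    rcases lt_or_ge n q with hn | hn
    · have h2 : (1:ℝ) ≤ (q : ℝ) ^ β * powSeq β n := by
        have := powSeq_le_of_le_mul hβ (show (1:ℝ) ≤ q by linarith) (i := 1) (n := n)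
          (by simpa using (by exact_mod_cast hn.le : (n : ℝ) ≤ q))
        rwa [powSeq_of_ne one_ne_zero, Nat.cast_one, Real.one_rpow] at this
      have h3 : (q : ℝ) ^ β ≤ C := by
        rw [hC]
        have : 0 ≤ 2 * K * (2 * q) ^ β / κ := by positivity
        linarith
      calc T n ≤ B * 1 := by simpa using hTB n
        _ ≤ B * ((q : ℝ) ^ β * powSeq β n) := mul_le_mul_of_nonneg_left h2 hB
        _ ≤ B * (C * powSeq β n) := by gcongr
        _ = _ := by ring
    -- A fixed proportion of `n`: small enough that `powSeq β (n - M)` is nearly `powSeq β n`, large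
    -- enough that `powSeq β M` is still a bounded multiple of it.
    · set M := n / q with hM
      have hM1 : 1 ≤ M := (Nat.one_le_div_iff (by omega)).2 hn
      have hMn : M ≤ n := Nat.div_le_self _ _
      have hMq : (M : ℝ) ≤ n / q := Nat.cast_div_le
      have h2 := ih (n - M) (by omega)
      have h3 : powSeq β (n - M) ≤ c ^ β * powSeq β n := by
        refine powSeq_le_of_le_mul hβ hc1 ?_
        rw [hc, ← div_eq_inv_mul, le_div_iff₀ (by linarith), Nat.cast_sub hMn]
        have : (n : ℝ) / q = n * (q : ℝ)⁻¹ := div_eq_mul_inv _ _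
        linarith
      have h4 : powSeq β M ≤ (2 * q) ^ β * powSeq β n := by
        refine powSeq_le_of_le_mul hβ (by linarith) ?_
        have h5 : n < q * (M + 1) := by
          exact Nat.lt_mul_div_succ n (by omega)
        have h6 : (n : ℝ) ≤ q * (M + 1) := by exact_mod_cast h5.le
        have h7 : (1:ℝ) ≤ M := by exact_mod_cast hM1
        nlinarith
      have h8 : B * (K * powSeq β M) ≤ κ / 2 * C * (B * powSeq β n) := by
        have h9 : K * (2 * q) ^ β ≤ κ / 2 * C := by
          rw [hC]
          have e : κ / 2 * (2 * K * (2 * q) ^ β / κ) = K * (2 * q) ^ β := by field_simp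
          have : 0 ≤ κ / 2 * (q : ℝ) ^ β := by positivity
          linarith [mul_add (κ / 2) ((q : ℝ) ^ β) (2 * K * (2 * q) ^ β / κ)]
        calc B * (K * powSeq β M) ≤ B * (K * ((2 * q) ^ β * powSeq β n)) := by gcongr
          _ = (K * (2 * q) ^ β) * (B * powSeq β n) := by ring
          _ ≤ _ := mul_le_mul_of_nonneg_right h9 (by positivity)
      calc T n ≤ (1 - κ) * T (n - M) + B * (K * powSeq β M) := hrec n M hMn
        _ ≤ (1 - κ) * (C * B * (c ^ β * powSeq β n)) + κ / 2 * C * (B * powSeq β n) := by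
          refine add_le_add (mul_le_mul_of_nonneg_left (h2.trans ?_) (by linarith)) h8
          exact mul_le_mul_of_nonneg_left h3 (by positivity)
        _ = ((1 - κ) * c ^ β + κ / 2) * (C * (B * powSeq β n)) := by ring
        _ ≤ 1 * (C * (B * powSeq β n)) := by
          refine mul_le_mul_of_nonneg_right ?_ (by positivity)
          linarith
        _ = _ := by ring

end Decay

/-! ### Generating functions of regeneration -/

section Core

open PowerSeries

variable {Y : Type*} [MeasurableSpace Y] {F : Y → Y} {α : Set (Set Y)}

/-- A regular density with finite mass. -/
structure IsRegular (μ : Measure Y) (G : Regeneration μ F α) (g : Y → ℝ≥0∞) : Prop where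
  measurable : Measurable g
  inCone : InCone F α G.θ G.L Set.univ g
  ne_top : ∫⁻ y, g y ∂μ ≠ ∞

/-- The generating function of `∫ S_n W`, where `S_n` is the nonregenerated part of `g`. -/
def regenSeries {μ : Measure Y} (G : Regeneration μ F α) (φ : Y → ℕ) (g W : Y → ℝ≥0∞) :
    PowerSeries ℝ :=
  mk fun n => (∫⁻ y, regen G φ g n y * W y ∂μ).toReal

/-- The generating function of the first regeneration time. -/
def firstRegenSeries {μ : Measure Y} (G : Regeneration μ F α) (φ : Y → ℕ) (g : Y → ℝ≥0∞) :
    PowerSeries ℝ :=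
  mk fun n => G.κ * (∫⁻ y, delay φ (regen G φ g) n y ∂μ).toReal

/-- The generating function of `∫ g K_n W`. -/
def renewalSeries (μ : Measure Y) (F : Y → Y) (φ : Y → ℕ) (g W : Y → ℝ≥0∞) : PowerSeries ℝ :=
  mk fun n => (∫⁻ y, g y * renewalOp F φ W n y ∂μ).toReal

/-- The total mass. -/
def mass (μ : Measure Y) (g : Y → ℝ≥0∞) : ℝ := (∫⁻ y, g y ∂μ).toReal

theorem mass_nonneg (μ : Measure Y) (g : Y → ℝ≥0∞) : 0 ≤ mass μ g := ENNReal.toReal_nonneg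

/-- The generating function of the probabilities of not having regenerated by time `n`. -/
def regenTail {μ : Measure Y} (G : Regeneration μ F α) (φ : Y → ℕ) (g : Y → ℝ≥0∞) :
    PowerSeries ℝ :=
  geomSeries * (C (mass μ g) - firstRegenSeries G φ g)

theorem one_sub_X_mul_regenTail {μ : Measure Y} (G : Regeneration μ F α) (φ : Y → ℕ)
    (g : Y → ℝ≥0∞) :
    (1 - X) * regenTail G φ g = C (mass μ g) - firstRegenSeries G φ g := by
  rw [regenTail, ← mul_assoc, mul_comm (1 - X), geomSeries_mul, one_mul]

variable {μ : Measure Y} (G : Regeneration μ F α) {φ : Y → ℕ} {g W : Y → ℝ≥0∞}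

theorem coeff_firstRegenSeries (n : ℕ) : coeff n (firstRegenSeries G φ g) =
    G.κ * (∫⁻ y, delay φ (regen G φ g) n y ∂μ).toReal := by simp [firstRegenSeries]

theorem coeff_regenSeries (n : ℕ) : coeff n (regenSeries G φ g W) =
    (∫⁻ y, regen G φ g n y * W y ∂μ).toReal := by simp [regenSeries]

theorem coeff_renewalSeries (n : ℕ) : coeff n (renewalSeries μ F φ g W) =
    (∫⁻ y, g y * renewalOp F φ W n y ∂μ).toReal := by simp [renewalSeries]

theorem firstRegenSeries_nonneg (n : ℕ) : 0 ≤ coeff n (firstRegenSeries G φ g) := by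
  rw [coeff_firstRegenSeries]
  have := G.κ_pos
  positivity

theorem regenSeries_nonneg (n : ℕ) : 0 ≤ coeff n (regenSeries G φ g W) := by
  rw [coeff_regenSeries]; positivity

theorem isRegular_const [IsProbabilityMeasure μ] {c : ℝ≥0∞} (hc : c ≠ ∞) :
    IsRegular μ G (fun _ => c) :=
  ⟨measurable_const, inCone_const G.θ_pos.le G.L_pos.le c, by simpa using hc⟩

@[simp] theorem mass_one [IsProbabilityMeasure μ] : mass μ (fun _ => 1) = 1 := by simp [mass]

namespace IsFullBranchGibbsMarkov

variable (h : IsFullBranchGibbsMarkov μ F α) (hφ : IsReturnTime α φ)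

include h hφ

section General

variable (hg : IsRegular μ G g)

include hg

theorem lintegral_regen_mul_le (hW : Measurable W) (n : ℕ) :
    ∫⁻ y, regen G φ g n y * W y ∂μ ≤
      ENNReal.ofReal (Real.exp G.L) * (∫⁻ y, regen G φ g n y ∂μ) * ∫⁻ y, W y ∂μ := by
  have := h.isProbabilityMeasure
  rw [← lintegral_const_mul _ hW]
  refine lintegral_mono fun y => mul_le_mul_left ?_ _
  exact (h.inCone_regen hφ G hg.measurable hg.inCone hg.ne_top n).le_lintegral
    G.θ_pos.le G.θ_lt_one.le G.L_pos.le y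

theorem renewalSeries_eq (hW : Measurable W) (hWf : ∫⁻ y, W y ∂μ ≠ ∞) :
    renewalSeries μ F φ g W = regenSeries G φ g W +
      firstRegenSeries G φ g * renewalSeries μ F φ (fun _ => 1) W := by
  have hKf : ∀ j, ∫⁻ y, renewalOp F φ W j y ∂μ ≠ ∞ := fun j =>
    ne_top_of_le_ne_top (ENNReal.mul_ne_top (by simp) hWf) (h.lintegral_renewalOp_le hφ hW j)
  have hDf := h.lintegral_delay_regen_ne_top hφ G hg.measurable hg.inCone hg.ne_top
  ext n
  rw [map_add, coeff_mul, coeff_renewalSeries, coeff_regenSeries,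
    h.lintegral_mul_renewalOp hφ G hg.measurable hg.inCone hg.ne_top hW hWf]
  have hfin : ∀ p ∈ Finset.HasAntidiagonal.antidiagonal n,
      ENNReal.ofReal G.κ * (∫⁻ y, delay φ (regen G φ g) p.1 y ∂μ) *
          ∫⁻ y, renewalOp F φ W p.2 y ∂μ ≠ ∞ := fun p _ =>
    ENNReal.mul_ne_top (ENNReal.mul_ne_top ENNReal.ofReal_ne_top (hDf _)) (hKf _)
  rw [ENNReal.toReal_add _ (ENNReal.sum_ne_top.2 hfin), ENNReal.toReal_sum hfin]
  · congr 1
    refine Finset.sum_congr rfl fun p _ => ?_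
    rw [coeff_firstRegenSeries, coeff_renewalSeries, ENNReal.toReal_mul, ENNReal.toReal_mul,
      ENNReal.toReal_ofReal G.κ_pos.le]
    simp
  · exact ne_top_of_le_ne_top (ENNReal.mul_ne_top (ENNReal.mul_ne_top ENNReal.ofReal_ne_top
      (h.lintegral_regen_ne_top hφ G hg.measurable hg.inCone hg.ne_top n)) hWf)
      (h.lintegral_regen_mul_le G hφ hg hW n)

/-- Conservation of mass. -/
theorem regenSeries_one_eq : regenSeries G φ g (fun _ => 1) =
    C (mass μ g) + ((1 - G.κ) / G.κ) • firstRegenSeries G φ g := by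
  ext n
  have h1 := h.lintegral_delay_regen hφ G hg.measurable hg.inCone hg.ne_top
    (u := fun _ => 1) measurable_const n
  have := h.isProbabilityMeasure
  have hDf := h.lintegral_delay_regen_ne_top hφ G hg.measurable hg.inCone hg.ne_top n
  have hSf := h.lintegral_regen_ne_top hφ G hg.measurable hg.inCone hg.ne_top n
  simp only [mul_one, lintegral_const, measure_univ] at h1
  have h2 := congrArg ENNReal.toReal h1
  rw [ENNReal.toReal_add _ hDf, ENNReal.toReal_add hSf (ENNReal.mul_ne_top ENNReal.ofReal_ne_top hDf),
    ENNReal.toReal_mul, ENNReal.toReal_ofReal G.κ_pos.le] at h2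
  swap
  · split_ifs <;> [exact hg.ne_top; simp]
  rw [map_add, coeff_C, map_smul, coeff_firstRegenSeries, coeff_regenSeries, mass]
  simp only [mul_one, smul_eq_mul]
  have hκ := G.κ_pos
  have e : (1 - G.κ) / G.κ * (G.κ * (∫⁻ y, delay φ (regen G φ g) n y ∂μ).toReal) =
    (1 - G.κ) * (∫⁻ y, delay φ (regen G φ g) n y ∂μ).toReal := by field_simp
  rw [e]
  split_ifs at h2 ⊢
  · linarith
  · rw [ENNReal.toReal_zero] at h2
    linarith

/-- The mass that has not regenerated by time `N` is classified by its last arrival in the base: it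
arrived unregenerated at time `p.1` and stays away for more than `p.2` steps. -/
theorem regenTail_eq (N : ℕ) : coeff N (regenTail G φ g) =
    ∑ p ∈ Finset.HasAntidiagonal.antidiagonal N,
      (∫⁻ y, regen G φ g p.1 y * {y | p.2 < φ y}.indicator (fun _ => 1) y ∂μ).toReal := by
  have hSm := h.measurable_regen hφ G hg.measurable hg.inCone hg.ne_top
  have hSf := h.lintegral_regen_ne_top hφ G hg.measurable hg.inCone hg.ne_top
  have hDf := h.lintegral_delay_regen_ne_top hφ G hg.measurable hg.inCone hg.ne_top
  have hφm := h.measurable_returnTime hφ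
  have hset : ∀ k, MeasurableSet {y | k < φ y} := fun k => measurableSet_lt measurable_const hφm
  have hDm := measurable_delay hφm hSm
  have hIm : ∀ k, Measurable ({y | k < φ y}.indicator (fun _ => (1 : ℝ≥0∞))) := fun k =>
    measurable_const.indicator (hset k)
  have hRf : ∀ p : ℕ × ℕ,
      ∫⁻ y, regen G φ g p.1 y * {y | p.2 < φ y}.indicator (fun _ => 1) y ∂μ ≠ ∞ := fun p => by
    refine ne_top_of_le_ne_top (hSf p.1) (lintegral_mono fun y => ?_)
    refine mul_le_of_le_one_right' ?_
    exact Set.indicator_le_self' (fun _ _ => zero_le) y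
  have hsum : ∑ p ∈ Finset.HasAntidiagonal.antidiagonal N, ∫⁻ y, delay φ (regen G φ g) p.1 y ∂μ +
      ∑ p ∈ Finset.HasAntidiagonal.antidiagonal N,
        ∫⁻ y, regen G φ g p.1 y * {y | p.2 < φ y}.indicator (fun _ => 1) y ∂μ =
      ∑ p ∈ Finset.HasAntidiagonal.antidiagonal N, ∫⁻ y, regen G φ g p.1 y ∂μ := by
    rw [← lintegral_finsetSum (f := fun (p : ℕ × ℕ) y => delay φ (regen G φ g) p.1 y) _
        fun p _ => hDm p.1,
      ← lintegral_finsetSum (f := fun (p : ℕ × ℕ) y => regen G φ g p.1 y *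
        {y | p.2 < φ y}.indicator (fun _ => 1) y) _ fun p _ => (hSm p.1).mul (hIm p.2),
      ← lintegral_finsetSum (f := fun (p : ℕ × ℕ) y => regen G φ g p.1 y) _ fun p _ => hSm p.1,
      ← lintegral_add_left (Finset.measurable_fun_sum _ fun p _ => hDm p.1)]
    refine lintegral_congr fun y => ?_
    have h1 := sum_antidiagonal_delay (fun i => regen G φ g i y) (fun _ => 1) (φ y) N
    have h2 : ∑ p ∈ Finset.HasAntidiagonal.antidiagonal N, delay φ (regen G φ g) p.1 y =
        ∑ p ∈ Finset.HasAntidiagonal.antidiagonal N,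
          regen G φ g p.1 y * (if φ y ≤ p.2 then 1 else 0) := by
      rw [h1]; simp [delay]
    rw [h2, ← Finset.sum_add_distrib]
    refine Finset.sum_congr rfl fun p _ => ?_
    rw [← mul_add, Set.indicator_apply]
    by_cases hp : φ y ≤ p.2
    · rw [if_pos hp, if_neg (by simpa using hp), add_zero, mul_one]
    · rw [if_neg hp, if_pos (by simpa using hp), zero_add, mul_one]
  have hreal := congrArg ENNReal.toReal hsum
  rw [ENNReal.toReal_add (ENNReal.sum_ne_top.2 fun p _ => hDf _)
    (ENNReal.sum_ne_top.2 fun p _ => hRf p), ENNReal.toReal_sum fun p _ => hDf _,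
    ENNReal.toReal_sum fun p _ => hRf p, ENNReal.toReal_sum fun p _ => hSf _] at hreal
  have hs := h.regenSeries_one_eq G hφ hg
  have hs' : ∀ n, (∫⁻ y, regen G φ g n y ∂μ).toReal =
      coeff n (C (mass μ g)) + (1 - G.κ) * (∫⁻ y, delay φ (regen G φ g) n y ∂μ).toReal := fun n => by
    have h3 := congrArg (coeff n) hs
    rw [coeff_regenSeries, map_add, map_smul, coeff_firstRegenSeries] at h3
    simp only [mul_one, smul_eq_mul] at h3
    rw [h3]
    have := G.κ_pos
    field_simp
  simp only [hs', Finset.sum_add_distrib, ← Finset.mul_sum] at hreal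
  have hC : ∑ p ∈ Finset.HasAntidiagonal.antidiagonal N, coeff p.1 (C (mass μ g)) = mass μ g := by
    rw [Finset.Nat.sum_antidiagonal_eq_sum_range_succ (fun i _ => coeff i (C (mass μ g)))]
    simp [coeff_C]
  rw [hC] at hreal
  rw [regenTail, coeff_geomSeries_mul]
  simp only [map_sub, Finset.sum_sub_distrib, coeff_firstRegenSeries, ← Finset.mul_sum]
  rw [← Finset.Nat.sum_antidiagonal_eq_sum_range_succ (fun i _ => coeff i (C (mass μ g))), hC,
    ← Finset.Nat.sum_antidiagonal_eq_sum_range_succ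
      (fun i _ => (∫⁻ y, delay φ (regen G φ g) i y ∂μ).toReal)]
  linarith

theorem regenTail_nonneg (N : ℕ) : 0 ≤ coeff N (regenTail G φ g) := by
  rw [h.regenTail_eq G hφ hg]
  exact Finset.sum_nonneg fun _ _ => ENNReal.toReal_nonneg

omit h hφ hg in
theorem coeff_regenTail (N : ℕ) : coeff N (regenTail G φ g) =
    mass μ g - ∑ j ∈ Finset.range (N + 1), coeff j (firstRegenSeries G φ g) := by
  rw [regenTail, coeff_geomSeries_mul]
  simp [coeff_C, Finset.sum_sub_distrib]

omit h hφ hg in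
theorem regenTail_le (N : ℕ) : coeff N (regenTail G φ g) ≤ mass μ g := by
  rw [coeff_regenTail]
  have := Finset.sum_nonneg fun j (_ : j ∈ Finset.range (N + 1)) =>
    firstRegenSeries_nonneg G (φ := φ) (g := g) j
  linarith

/-- Classify the surviving mass by its last arrival in the base. An arrival by time N - M requires
an excursion longer than `M`; regularity bounds its probability by exp(L) μ(φ > M), and all arrivals
together have mass at most `mass μ g / κ`. By conservation of mass, the arrivals after N - M total
(1-κ)/κ times the decrease of the tail between N - M and N. Solving for the tail at `N` gives the
contraction factor 1 - κ. -/
theorem regenTail_rec {N M : ℕ} (hM : M ≤ N) : coeff N (regenTail G φ g) ≤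
    (1 - G.κ) * coeff (N - M) (regenTail G φ g) +
      (Real.exp G.L * mass μ g) * μ.real {y | M < φ y} := by
  have := h.isProbabilityMeasure
  have hSm := h.measurable_regen hφ G hg.measurable hg.inCone hg.ne_top
  have hSf := h.lintegral_regen_ne_top hφ G hg.measurable hg.inCone hg.ne_top
  have hφm := h.measurable_returnTime hφ
  have hset : ∀ k, MeasurableSet {y | k < φ y} := fun k => measurableSet_lt measurable_const hφm
  have hκ := G.κ_pos
  have hκ1 := G.κ_lt_one
  set s : ℕ → ℝ := fun n => coeff n (regenSeries G φ g fun _ => 1) with hs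
  have hs0 : ∀ n, 0 ≤ s n := regenSeries_nonneg G
  have hs' : ∀ n, (∫⁻ y, regen G φ g n y ∂μ).toReal = s n := fun n => by
    simp [hs, coeff_regenSeries]
  have hse : ∀ n, s n = coeff n (C (mass μ g)) +
      (1 - G.κ) / G.κ * coeff n (firstRegenSeries G φ g) := fun n => by
    have := congrArg (coeff n) (h.regenSeries_one_eq G hφ hg)
    rw [map_add, map_smul, smul_eq_mul] at this
    exact this
  have hle1 : ∀ p : ℕ × ℕ,
      (∫⁻ y, regen G φ g p.1 y * {y | p.2 < φ y}.indicator (fun _ => 1) y ∂μ).toReal ≤ s p.1 := by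
    intro p
    rw [← hs']
    refine ENNReal.toReal_mono (hSf _) (lintegral_mono fun y => ?_)
    refine mul_le_of_le_one_right' ?_
    exact Set.indicator_le_self' (fun _ _ => zero_le) y
  have hle2 : ∀ p : ℕ × ℕ,
      (∫⁻ y, regen G φ g p.1 y * {y | p.2 < φ y}.indicator (fun _ => 1) y ∂μ).toReal ≤
        Real.exp G.L * s p.1 * μ.real {y | p.2 < φ y} := by
    intro p
    have h1 := h.lintegral_regen_mul_le G hφ hg (W := {y | p.2 < φ y}.indicator (fun _ => 1))
      (measurable_const.indicator (hset _)) p.1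
    rw [lintegral_indicator_const (hset _), one_mul] at h1
    have h2 := ENNReal.toReal_mono (ENNReal.mul_ne_top (ENNReal.mul_ne_top ENNReal.ofReal_ne_top
      (hSf p.1)) (measure_ne_top _ _)) h1
    rwa [ENNReal.toReal_mul, ENNReal.toReal_mul, ENNReal.toReal_ofReal (Real.exp_pos _).le, hs'] at h2
  rw [h.regenTail_eq G hφ hg]
  have hsplit : ∑ p ∈ Finset.HasAntidiagonal.antidiagonal N,
      (∫⁻ y, regen G φ g p.1 y * {y | p.2 < φ y}.indicator (fun _ => 1) y ∂μ).toReal ≤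
      ∑ j ∈ Finset.range (N - M + 1), Real.exp G.L * s j * μ.real {y | M < φ y} +
      ∑ j ∈ Finset.Ico (N - M + 1) (N + 1), s j := by
    rw [Finset.Nat.sum_antidiagonal_eq_sum_range_succ
      (fun i j => (∫⁻ y, regen G φ g i y * {y | j < φ y}.indicator (fun _ => 1) y ∂μ).toReal),
      ← Finset.sum_range_add_sum_Ico _ (show N - M + 1 ≤ N + 1 by omega)]
    refine add_le_add (Finset.sum_le_sum fun j hj => ?_) (Finset.sum_le_sum fun j _ => hle1 (j, N - j))
    refine (hle2 (j, N - j)).trans ?_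
    rw [Finset.mem_range] at hj
    refine mul_le_mul_of_nonneg_left (measureReal_mono fun y hy => ?_)
      (mul_nonneg (Real.exp_pos _).le (hs0 j))
    change M < φ y
    change N - j < φ y at hy
    omega
  have hP := coeff_regenTail G (φ := φ) (g := g)
  have hsum1 : ∑ j ∈ Finset.range (N - M + 1), s j ≤ mass μ g / G.κ := by
    simp only [hse, Finset.sum_add_distrib, ← Finset.mul_sum]
    have h1 : ∑ j ∈ Finset.range (N - M + 1), coeff j (C (mass μ g)) = mass μ g := by simp [coeff_C]
    have h2 : ∑ j ∈ Finset.range (N - M + 1), coeff j (firstRegenSeries G φ g) ≤ mass μ g := by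
      have := hP (N - M)
      have := h.regenTail_nonneg G hφ hg (N - M)
      linarith
    rw [h1]
    have h3 := mul_le_mul_of_nonneg_left h2 (show 0 ≤ (1 - G.κ) / G.κ from div_nonneg (by linarith) hκ.le)
    have e : mass μ g + (1 - G.κ) / G.κ * mass μ g = mass μ g / G.κ := by field_simp; ring
    linarith
  have hsum2 : ∑ j ∈ Finset.Ico (N - M + 1) (N + 1), s j =
      (1 - G.κ) / G.κ * (coeff (N - M) (regenTail G φ g) - coeff N (regenTail G φ g)) := by
    have h1 : ∀ j ∈ Finset.Ico (N - M + 1) (N + 1), s j =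
        (1 - G.κ) / G.κ * coeff j (firstRegenSeries G φ g) := fun j hj => by
      rw [Finset.mem_Ico] at hj
      rw [hse, coeff_C, if_neg (by omega), zero_add]
    rw [Finset.sum_congr rfl h1, ← Finset.mul_sum, hP, hP,
      ← Finset.sum_range_add_sum_Ico _ (show N - M + 1 ≤ N + 1 by omega)]
    ring
  rw [← h.regenTail_eq G hφ hg, hsum2, ← Finset.sum_mul, ← Finset.mul_sum] at hsplit
  have hμ0 : 0 ≤ μ.real {y | M < φ y} := measureReal_nonneg
  have h5 : Real.exp G.L * ∑ j ∈ Finset.range (N - M + 1), s j ≤ Real.exp G.L * (mass μ g / G.κ) :=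
    mul_le_mul_of_nonneg_left hsum1 (Real.exp_pos _).le
  have h6 := mul_le_mul_of_nonneg_right h5 hμ0
  have h7 := hsplit.trans (add_le_add_left h6 _)
  have h8 := mul_le_mul_of_nonneg_left h7 hκ.le
  have e : G.κ * (Real.exp G.L * (mass μ g / G.κ) * μ.real {y | M < φ y} +
      (1 - G.κ) / G.κ * (coeff (N - M) (regenTail G φ g) - coeff N (regenTail G φ g))) =
      Real.exp G.L * mass μ g * μ.real {y | M < φ y} +
      (1 - G.κ) * (coeff (N - M) (regenTail G φ g) - coeff N (regenTail G φ g)) := by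
    field_simp
  rw [e] at h8
  rw [← h.regenTail_eq G hφ hg]
  linarith

end General

end IsFullBranchGibbsMarkov

end Core

/-! ### Polynomial bounds and loss of memory on the base -/

section CoreBounds

open PowerSeries

variable {Y : Type*} [MeasurableSpace Y] {F : Y → Y} {α : Set (Set Y)} {μ : Measure Y}

/-- The tails `μ(φ > n)`. -/
def returnTail (μ : Measure Y) (φ : Y → ℕ) : PowerSeries ℝ := mk fun n => μ.real {y | n < φ y}

/-- The distribution `μ(φ = n)`. -/
def returnDist (μ : Measure Y) (φ : Y → ℕ) : PowerSeries ℝ := mk fun n => μ.real {y | φ y = n}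

@[simp] theorem coeff_returnTail (μ : Measure Y) (φ : Y → ℕ) (n : ℕ) :
    coeff n (returnTail μ φ) = μ.real {y | n < φ y} := by simp [returnTail]

@[simp] theorem coeff_returnDist (μ : Measure Y) (φ : Y → ℕ) (n : ℕ) :
    coeff n (returnDist μ φ) = μ.real {y | φ y = n} := by simp [returnDist]

theorem one_sub_sum_returnDist [IsProbabilityMeasure μ] {φ : Y → ℕ} (hφm : Measurable φ) (n : ℕ) :
    1 - ∑ j ∈ Finset.range (n + 1), μ.real {y | φ y = j} = μ.real {y | n < φ y} := by
  have hset : ∀ j, MeasurableSet {y | φ y = j} := fun j => hφm (measurableSet_singleton j)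
  have h1 : ∑ j ∈ Finset.range (n + 1), μ.real {y | φ y = j} = μ.real {y | φ y ≤ n} := by
    rw [← measureReal_biUnion_finset]
    · congr 1
      ext y
      simp
    · intro i _ j _ hij
      refine Set.disjoint_left.2 fun y hy hy' => hij ?_
      exact (show φ y = i from hy).symm.trans hy'
    · exact fun j _ => hset j
  have h2 : {y | n < φ y} = {y | φ y ≤ n}ᶜ := by ext y; simp
  rw [h1, h2, probReal_compl_eq_one_sub (measurableSet_le hφm measurable_const)]

theorem tailSeries_returnDist [IsProbabilityMeasure μ] {φ : Y → ℕ} (hφm : Measurable φ) :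
    tailSeries (returnDist μ φ) = returnTail μ φ := by
  ext n
  rw [tailSeries, coeff_geomSeries_mul, coeff_returnTail, ← one_sub_sum_returnDist hφm]
  simp [coeff_one, Finset.sum_sub_distrib]

theorem hasSum_of_tendsto_tail {p : PowerSeries ℝ} (hp : ∀ n, 0 ≤ coeff n p) {m : ℝ}
    {β K : ℝ} (hβ : 1 < β) (h0 : ∀ n, 0 ≤ m - ∑ j ∈ Finset.range (n + 1), coeff j p)
    (h : ∀ n, m - ∑ j ∈ Finset.range (n + 1), coeff j p ≤ K * powSeq β n) :
    HasSum (fun n => coeff n p) m := by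
  rw [hasSum_iff_tendsto_nat_of_nonneg hp, ← tendsto_add_atTop_iff_nat 1]
  have h1 : Tendsto (fun n => K * powSeq β n) atTop (𝓝 0) := by
    simpa using (summable_powSeq hβ).tendsto_atTop_zero.const_mul K
  have h2 : Tendsto (fun n => m - ∑ j ∈ Finset.range (n + 1), coeff j p) atTop (𝓝 0) :=
    squeeze_zero h0 h h1
  simpa using h2.const_sub m

namespace IsFullBranchGibbsMarkov

variable (h : IsFullBranchGibbsMarkov μ F α)

include h

/-- The density `ξ` is positive: on a null atom the pullback of `μ` under `F` would vanish as well,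
yet `F` maps the atom onto `Y`. -/
theorem measure_atom_ne_zero {a : Set Y} (ha : a ∈ α) : μ a ≠ 0 := by
  have := h.isProbabilityMeasure
  obtain ⟨ξ, hξm, hξpos, hξ, -⟩ := h.bounded_distortion
  intro h0
  have hem := h.measurableEmbedding a ha
  have h1 : (μ.comap (Subtype.val : a → Y)) = 0 := by
    rw [← Measure.measure_univ_eq_zero, comap_subtype_coe_apply (h.measurableSet a ha)]
    simpa using h0
  rw [hξ a ha, withDensity_eq_zero_iff (by fun_prop)] at h1
  have h2 : (μ.comap (a.domRestrict F)) = 0 := by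
    rw [← ae_eq_bot, ← Filter.eventually_false_iff_eq_bot]
    filter_upwards [h1] with x hx
    simp only [Pi.zero_apply, ENNReal.ofReal_eq_zero] at hx
    exact absurd (hξpos x) (not_lt.2 hx)
  have h3 := hem.map_comap μ
  rw [h2, (h.surjective a ha).range_eq, Measure.restrict_univ, Measure.map_zero] at h3
  exact IsProbabilityMeasure.ne_zero μ h3.symm

variable {φ : Y → ℕ} (hφ : IsReturnTime α φ)

include hφ

theorem returnDist_pos (y : Y) : 0 < coeff (φ y) (returnDist μ φ) := by
  have := h.isProbabilityMeasure
  obtain ⟨a, ha, hy⟩ := h.exists_mem_atom y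
  rw [coeff_returnDist]
  refine ENNReal.toReal_pos (ne_of_gt ?_) (measure_ne_top _ _)
  refine (pos_iff_ne_zero.2 (h.measure_atom_ne_zero ha)).trans_le (measure_mono fun y' hy' => ?_)
  exact hφ.const a ha y' hy' y hy

theorem isAperiodicProb_returnDist (haper : ∀ d : ℕ, (∀ y, d ∣ φ y) → d = 1) {β K : ℝ}
    (hβ : 1 < β) (htl : Maj (returnTail μ φ) (K • powSeries β)) :
    IsAperiodicProb (returnDist μ φ) := by
  have := h.isProbabilityMeasure
  have hφm := h.measurable_returnTime hφ
  refine ⟨fun n => by simp, ?_, ?_, fun d hd => haper d fun y => hd _ (h.returnDist_pos hφ y).ne'⟩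
  · have : {y | φ y = 0} = ∅ := by
      ext y
      have := hφ.pos y
      simp only [Set.mem_ofPred_eq, Set.mem_empty_iff_false, iff_false]
      omega
    rw [coeff_returnDist, this, measureReal_empty]
  · refine hasSum_of_tendsto_tail (fun n => by simp) hβ (K := K) (fun n => ?_) fun n => ?_
    · simp only [coeff_returnDist, one_sub_sum_returnDist hφm]
      exact measureReal_nonneg
    · simp only [coeff_returnDist, one_sub_sum_returnDist hφm]
      simpa using (le_abs_self _).trans (htl n)

variable (G : Regeneration μ F α) {β K : ℝ} (hβ : 1 < β)
  (htl : Maj (returnTail μ φ) (K • powSeries β))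

include hβ htl

/-- The recursion `regenTail_rec` fed into `exists_decay_bound`, with a constant linear in the mass
of the initial density. -/
theorem exists_maj_regenTail : ∃ C : ℝ, 0 < C ∧ ∀ g, IsRegular μ G g →
    Maj (regenTail G φ g) ((C * mass μ g) • powSeries β) := by
  have hK : 0 ≤ K := by simpa [powSeq_zero] using htl.nonneg 0
  obtain ⟨C, hC, H⟩ := exists_decay_bound (show 0 ≤ β by linarith) G.κ_pos G.κ_lt_one hK
  have hexp := Real.exp_pos G.L
  refine ⟨C * Real.exp G.L, by positivity, fun g hg n => ?_⟩
  have hm := mass_nonneg μ g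
  rw [abs_of_nonneg (h.regenTail_nonneg G hφ hg n)]
  have := H (fun n => coeff n (regenTail G φ g)) (Real.exp G.L * mass μ g) (by positivity)
    (fun n => (regenTail_le G n).trans (le_mul_of_one_le_left hm (Real.one_le_exp G.L_pos.le)))
    (fun N M hM => (h.regenTail_rec G hφ hg hM).trans (by
      gcongr
      simpa using (le_abs_self _).trans (htl M))) n
  simpa [mul_assoc] using this

omit hβ htl in
theorem coeff_regenSeries_le {g W : Y → ℝ≥0∞} (hg : IsRegular μ G g) (hW : Measurable W)
    (hWf : ∫⁻ y, W y ∂μ ≠ ∞) (n : ℕ) : coeff n (regenSeries G φ g W) ≤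
      Real.exp G.L * mass μ W * coeff n (regenSeries G φ g fun _ => 1) := by
  have h1 := ENNReal.toReal_mono (ENNReal.mul_ne_top (ENNReal.mul_ne_top ENNReal.ofReal_ne_top
      (h.lintegral_regen_ne_top hφ G hg.measurable hg.inCone hg.ne_top n)) hWf)
      (h.lintegral_regen_mul_le G hφ hg hW n)
  rw [ENNReal.toReal_mul, ENNReal.toReal_mul, ENNReal.toReal_ofReal (Real.exp_pos _).le] at h1
  rw [coeff_regenSeries, coeff_regenSeries, mass]
  simp only [mul_one]
  linarith

/-- Regularity reduces `W` to its mass, and conservation of mass expresses the arriving mass through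
the law of the first regeneration time. -/
theorem exists_maj_regenSeries : ∃ C : ℝ, 0 < C ∧ ∀ g W, IsRegular μ G g → Measurable W →
    ∫⁻ y, W y ∂μ ≠ ∞ → Maj (regenSeries G φ g W) ((C * mass μ g * mass μ W) • powSeries β) := by
  obtain ⟨C, hC, H⟩ := h.exists_maj_regenTail hφ G hβ htl
  have hexp := Real.exp_pos G.L
  have hκ := G.κ_pos
  have hκ1 := G.κ_lt_one
  set c := (1 - G.κ) / G.κ with hc
  have hc0 : 0 ≤ c := div_nonneg (by linarith) hκ.le
  refine ⟨Real.exp G.L * (1 + c * (C * 2 ^ β)), by positivity, fun g W hg hW hWf n => ?_⟩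
  have hm := mass_nonneg μ g
  have hmW := mass_nonneg μ W
  rw [abs_of_nonneg (regenSeries_nonneg G n)]
  refine (h.coeff_regenSeries_le hφ G hg hW hWf n).trans ?_
  have key : coeff n (regenSeries G φ g fun _ => 1) ≤
      (1 + c * (C * 2 ^ β)) * mass μ g * powSeq β n := by
    rw [h.regenSeries_one_eq G hφ hg, map_add, map_smul, smul_eq_mul, ← hc]
    have h2 : coeff n (PowerSeries.C (mass μ g)) ≤ mass μ g * powSeq β n := by
      rw [coeff_C]
      split_ifs with hn
      · rw [hn, powSeq_zero, mul_one]
      · exact mul_nonneg hm (powSeq_nonneg _ _)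
    -- A coefficient at n + 1 is a decrease of the tail, hence at most the tail at n; at time 0
    -- nothing regenerates, since φ ≥ 1.
    have h3 : coeff n (firstRegenSeries G φ g) ≤ C * 2 ^ β * mass μ g * powSeq β n := by
      rcases n with _ | n
      · have h4 : coeff 0 (firstRegenSeries G φ g) = 0 := by
          rw [coeff_firstRegenSeries]
          have : ∀ y, delay φ (regen G φ g) 0 y = 0 := fun y => by
            have := hφ.pos y
            rw [delay, if_neg (by omega)]
          simp [this]
        rw [h4]
        have := powSeq_nonneg β 0
        positivity
      · have h4 := congrArg (coeff (n + 1)) (one_sub_X_mul_regenTail G φ g)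
        rw [coeff_succ_one_sub_X_mul, map_sub, coeff_C, if_neg (by omega)] at h4
        have h5 := h.regenTail_nonneg G hφ hg (n + 1)
        have h6 := (le_abs_self _).trans (H g hg n)
        simp only [map_smul, coeff_powSeries, smul_eq_mul] at h6
        have h7 := powSeq_le_of_le_mul_add_one (show 0 ≤ β by linarith) le_rfl (i := n) (n := n + 1)
          (by push_cast; linarith)
        rw [mul_one] at h7
        have h8 := mul_le_mul_of_nonneg_left h7 (show 0 ≤ C * mass μ g by positivity)
        linarith
    have := mul_le_mul_of_nonneg_left h3 hc0
    linarith
  have := mul_le_mul_of_nonneg_left key (show 0 ≤ Real.exp G.L * mass μ W by positivity)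
  simp only [map_smul, coeff_powSeries, smul_eq_mul]
  linarith

omit hφ hβ htl in
theorem isRegular_one : IsRegular μ G (fun _ => 1) := by
  have := h.isProbabilityMeasure
  exact isRegular_const G ENNReal.one_ne_top

omit hφ hβ htl in
theorem tailSeries_firstRegenSeries :
    tailSeries (firstRegenSeries G φ fun _ => 1) = regenTail G φ fun _ => 1 := by
  have := h.isProbabilityMeasure
  rw [tailSeries, regenTail, mass_one, map_one]

theorem isAperiodicProb_firstRegenSeries (haper : ∀ d : ℕ, (∀ y, d ∣ φ y) → d = 1) :
    IsAperiodicProb (firstRegenSeries G φ fun _ => 1) := by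
  have := h.isProbabilityMeasure
  have hg := h.isRegular_one G
  obtain ⟨C, hC, H⟩ := h.exists_maj_regenTail hφ G hβ htl
  have hf := h.isAperiodicProb_returnDist hφ haper hβ htl
  refine ⟨firstRegenSeries_nonneg G, ?_, ?_, fun d hd => hf.aperiodic d fun n hn => hd n ?_⟩
  · rw [coeff_firstRegenSeries]
    have : ∀ y, delay φ (regen G φ fun _ => 1) 0 y = 0 := fun y => by
      have := hφ.pos y
      rw [delay, if_neg (by omega)]
    simp [this]
  · refine hasSum_of_tendsto_tail (firstRegenSeries_nonneg G) hβ (K := C) (fun n => ?_) fun n => ?_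
    · simpa [coeff_regenTail] using h.regenTail_nonneg G hφ hg n
    · simpa [coeff_regenTail] using (le_abs_self _).trans (H _ hg n)
  -- Regeneration at the very first return has positive probability, so every value of φ of positive
  -- probability is in the support and aperiodicity is inherited.
  · refine ((lt_of_lt_of_le (mul_pos G.κ_pos ((hf.nonneg n).lt_of_ne hn.symm)) ?_)).ne'
    rw [coeff_firstRegenSeries, coeff_returnDist]
    refine mul_le_mul_of_nonneg_left (ENNReal.toReal_mono
      (h.lintegral_delay_regen_ne_top hφ G hg.measurable hg.inCone hg.ne_top n) ?_) G.κ_pos.le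
    have hset : MeasurableSet {y | φ y = n} := h.measurable_returnTime hφ (measurableSet_singleton n)
    rw [← lintegral_indicator_one hset]
    refine lintegral_mono fun y => ?_
    rw [Set.indicator_apply]
    split_ifs with hy
    · have hy' : φ y = n := hy
      rw [delay, if_pos hy'.le, hy', Nat.sub_self, regen]
      simp
    · exact zero_le

variable (haper : ∀ d : ℕ, (∀ y, d ∣ φ y) → d = 1)

include haper

/-- For the density 1 the renewal equation closes up, because regenerated mass again has constant
density. -/
theorem renewalSeries_one_eq {W : Y → ℝ≥0∞} (hW : Measurable W) (hWf : ∫⁻ y, W y ∂μ ≠ ∞) :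
    renewalSeries μ F φ (fun _ => 1) W =
      renewal (firstRegenSeries G φ fun _ => 1) * regenSeries G φ (fun _ => 1) W := by
  have hp := h.isAperiodicProb_firstRegenSeries hφ G hβ htl haper
  have h1 := h.renewalSeries_eq G hφ (h.isRegular_one G) hW hWf
  have h2 := hp.renewal_eq
  linear_combination renewal (firstRegenSeries G φ fun _ => 1) * h1 -
    renewalSeries μ F φ (fun _ => 1) W * h2

/-- The increments of `∫ K_n W` are summable with polynomial rate. -/
theorem exists_maj_one_sub_X_mul_renewalSeries : ∃ C : ℝ, 0 < C ∧ ∀ W, Measurable W →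
    ∫⁻ y, W y ∂μ ≠ ∞ →
    Maj ((1 - X) * renewalSeries μ F φ (fun _ => 1) W) ((C * mass μ W) • powSeries β) := by
  have := h.isProbabilityMeasure
  -- The statement does not mention a regeneration, so any exponent will do.
  obtain ⟨G, -⟩ := h.exists_regeneration (θ₀ := 1 / 2) (by norm_num) (by norm_num)
  have hp := h.isAperiodicProb_firstRegenSeries hφ G hβ htl haper
  obtain ⟨C₀, hC₀, H₀⟩ := h.exists_maj_regenTail hφ G hβ htl
  have h₀ := H₀ _ (h.isRegular_one G)
  rw [← h.tailSeries_firstRegenSeries G] at h₀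
  obtain ⟨C₁, hC₁, h₁⟩ := hp.exists_maj_invTail hβ h₀
  obtain ⟨C₂, hC₂, h₂⟩ := h.exists_maj_regenSeries hφ G hβ htl
  obtain ⟨C₃, hC₃, h₃⟩ := exists_maj_powSeries_mul_self hβ
  refine ⟨C₁ * C₂ * C₃, by positivity, fun W hW hWf => ?_⟩
  have hm := mass_nonneg μ W
  rw [h.renewalSeries_one_eq hφ G hβ htl haper hW hWf, ← mul_assoc, one_sub_X_mul_renewal]
  refine (h₁.smul_mul_smul (h₂ _ W (h.isRegular_one G) hW hWf)).trans ?_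
  refine (Maj.smul_of_nonneg h₃ ?_).trans ?_
  · rw [mass_one]; positivity
  · rw [smul_smul, mass_one]
    refine Maj.mono (c := C₁ * (C₂ * 1 * mass μ W) * C₃) (Maj.of_nonneg fun n => ?_)
      (coeff_powSeries_nonneg β) (le_of_eq (by ring))
    rw [map_smul]
    exact mul_nonneg (by positivity) (coeff_powSeries_nonneg β n)

/-- Loss of memory of the initial density. -/
theorem exists_maj_renewalSeries_sub : ∃ C : ℝ, 0 < C ∧ ∀ g W, IsRegular μ G g → Measurable W →
    ∫⁻ y, W y ∂μ ≠ ∞ →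
    Maj (renewalSeries μ F φ g W - mass μ g • renewalSeries μ F φ (fun _ => 1) W)
      ((C * mass μ g * mass μ W) • powSeries β) := by
  obtain ⟨C₁, hC₁, h₁⟩ := h.exists_maj_one_sub_X_mul_renewalSeries hφ hβ htl haper
  obtain ⟨C₂, hC₂, h₂⟩ := h.exists_maj_regenSeries hφ G hβ htl
  obtain ⟨C₃, hC₃, h₃⟩ := exists_maj_powSeries_mul_self hβ
  obtain ⟨C₄, hC₄, h₄⟩ := h.exists_maj_regenTail hφ G hβ htl
  refine ⟨C₂ + C₄ * C₁ * C₃, by positivity, fun g W hg hW hWf => ?_⟩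
  have hm := mass_nonneg μ W
  have hm' := mass_nonneg μ g
  -- The first regeneration series equals the mass minus (1 - X) times its tail; moving 1 - X onto
  -- the other factor leaves a convolution of two decaying sequences.
  have e : renewalSeries μ F φ g W - mass μ g • renewalSeries μ F φ (fun _ => 1) W =
      regenSeries G φ g W -
        regenTail G φ g * ((1 - X) * renewalSeries μ F φ (fun _ => 1) W) := by
    rw [smul_eq_C_mul, h.renewalSeries_eq G hφ hg hW hWf]
    linear_combination (renewalSeries μ F φ (fun _ => 1) W) * one_sub_X_mul_regenTail G φ g
  rw [e]
  have h5 : Maj (regenTail G φ g * ((1 - X) * renewalSeries μ F φ (fun _ => 1) W))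
      ((C₄ * C₁ * C₃ * mass μ g * mass μ W) • powSeries β) := by
    refine ((h₄ g hg).smul_mul_smul (h₁ W hW hWf)).trans ?_
    have := Maj.smul_of_nonneg h₃ (show 0 ≤ C₄ * mass μ g * (C₁ * mass μ W) by positivity)
    rw [smul_smul] at this
    exact this.mono (coeff_powSeries_nonneg β) (le_of_eq (by ring))
  have h6 := (h₂ g W hg hW hWf).sub h5
  rw [← add_smul] at h6
  exact h6.mono (coeff_powSeries_nonneg β) (le_of_eq (by ring))

end IsFullBranchGibbsMarkov

end CoreBounds

/-! ### Decomposition along the last visit to the base -/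

section Cocycle

variable {Y : Type*} {F : Y → Y} {α : Set (Set Y)} {φ : Y → ℕ}

theorem tsum_delay (S : ℕ → Y → ℝ≥0∞) (y : Y) : ∑' n, delay φ S n y = ∑' n, S n y := by
  have h := (add_left_injective (φ y)).tsum_eq (f := fun n => delay φ S n y) (fun n hn => by
    rw [Function.mem_support, delay] at hn
    have : φ y ≤ n := by
      by_contra hc
      exact hn (if_neg hc)
    exact ⟨n - φ y, Nat.sub_add_cancel this⟩)
  rw [← h]
  refine tsum_congr fun n => ?_
  simp [delay]

/-- A function evolving along the tower is the sum over the last visit to the base. -/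
theorem IsReturnTime.cocycle_eq_sum (hφ : IsReturnTime α φ) {w : ℕ → Y → ℝ≥0∞}
    (hw : ∀ k y, w (φ y + k) y = w k (F y)) (n : ℕ) (y : Y) :
    w n y = ∑ k ∈ Finset.range (n + 1),
      renewalOp F φ ({y | k < φ y}.indicator (w k)) (n - k) y := by
  induction n using Nat.strong_induction_on generalizing y with
  | _ n ih =>
    have hy := hφ.pos y
    rw [Finset.sum_congr rfl fun k _ => hφ.renewalOp_eq _ _ y, Finset.sum_add_distrib]
    have h1 : ∑ k ∈ Finset.range (n + 1),
        (if n - k = 0 then {y | k < φ y}.indicator (w k) y else 0) =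
        {y | n < φ y}.indicator (w n) y := by
      rw [Finset.sum_range_succ, Finset.sum_eq_zero]
      · simp
      · intro k hk
        rw [Finset.mem_range] at hk
        rw [if_neg (by omega)]
    rw [h1]
    rcases lt_or_ge n (φ y) with hn | hn
    · rw [Set.indicator_of_mem (show y ∈ {y | n < φ y} from hn), Finset.sum_eq_zero, add_zero]
      exact fun k _ => if_neg (by omega)
    · rw [Set.indicator_of_notMem (by simpa using hn), zero_add]
      obtain ⟨m, rfl⟩ := Nat.exists_eq_add_of_le hn
      rw [hw, ih m (by omega) (F y), ← Finset.sum_range_add_sum_Ico _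
        (show m + 1 ≤ φ y + m + 1 by omega)]
      rw [Finset.sum_eq_zero (s := Finset.Ico _ _), add_zero]
      · refine Finset.sum_congr rfl fun k hk => ?_
        rw [Finset.mem_range] at hk
        rw [if_pos (by omega)]
        congr 1
        omega
      · intro k hk
        rw [Finset.mem_Ico] at hk
        rw [if_neg (by omega)]

end Cocycle

/-! ### Asymptotic expansion of the renewal operator -/

section CoreAsymptotics

open PowerSeries

variable {Y : Type*} [MeasurableSpace Y] {F : Y → Y} {α : Set (Set Y)} {μ : Measure Y}

namespace IsFullBranchGibbsMarkov

variable (h : IsFullBranchGibbsMarkov μ F α) {φ : Y → ℕ} (hφ : IsReturnTime α φ)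
  (G : Regeneration μ F α) {β K : ℝ} (hβ : 1 < β)
  (htl : Maj (returnTail μ φ) (K • powSeries β)) (haper : ∀ d : ℕ, (∀ y, d ∣ φ y) → d = 1)

include h hφ hβ htl haper

/-- Regeneration happens almost surely: this is total mass 1 for the law of the first regeneration
time. -/
theorem tsum_lintegral_delay_regen :
    ENNReal.ofReal G.κ * ∑' n, ∫⁻ y, delay φ (regen G φ fun _ => 1) n y ∂μ = 1 := by
  have hp := h.isAperiodicProb_firstRegenSeries hφ G hβ htl haper
  have hg := h.isRegular_one G
  have hD := h.lintegral_delay_regen_ne_top hφ G hg.measurable hg.inCone hg.ne_top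
  have h1 := ENNReal.ofReal_tsum_of_nonneg hp.nonneg hp.hasSum.summable
  rw [hp.hasSum.tsum_eq, ENNReal.ofReal_one] at h1
  refine Eq.trans ?_ h1.symm
  rw [← ENNReal.tsum_mul_left]
  refine tsum_congr fun n => ?_
  rw [coeff_firstRegenSeries, ENNReal.ofReal_mul G.κ_pos.le, ENNReal.ofReal_toReal (hD n)]

/-- By ergodicity, the nonregenerated part equidistributes in total. -/
theorem tsum_lintegral_regen_mul {W : Y → ℝ≥0∞} (hW : Measurable W) :
    ENNReal.ofReal G.κ * ∑' n, ∫⁻ y, regen G φ (fun _ => 1) n y * W y ∂μ = ∫⁻ y, W y ∂μ := by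
  have := h.isProbabilityMeasure
  have hg := h.isRegular_one G
  have hSm := h.measurable_regen hφ G hg.measurable hg.inCone hg.ne_top
  have hDm := measurable_delay (h.measurable_returnTime hφ) hSm
  have hFm : Measurable F := h.ergodic.measurable
  set S := regen G φ fun _ => 1 with hS
  -- Summing the one-step identity over all times shows that κ H dμ is an `F`-invariant probability
  -- measure. It is absolutely continuous, so it equals μ by ergodicity.
  set H : Y → ℝ≥0∞ := fun y => ∑' n, S n y with hH
  have hHm : Measurable H := Measurable.tsum hSm
  have hint : ∀ u : Y → ℝ≥0∞, Measurable u →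
      ∫⁻ y, H y * u y ∂μ = ∑' n, ∫⁻ y, S n y * u y ∂μ := fun u hu => by
    rw [← lintegral_tsum (f := fun n y => S n y * u y) fun n => ((hSm n).mul hu).aemeasurable]
    exact lintegral_congr fun y => ENNReal.tsum_mul_right.symm
  have hint' : ∀ u : Y → ℝ≥0∞, Measurable u →
      ∫⁻ y, H y * u y ∂μ = ∑' n, ∫⁻ y, delay φ S n y * u y ∂μ := fun u hu => by
    rw [← lintegral_tsum (f := fun n y => delay φ S n y * u y)
      fun n => ((hDm n).mul hu).aemeasurable]
    refine lintegral_congr fun y => ?_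
    rw [ENNReal.tsum_mul_right, tsum_delay]
  have hκH : ENNReal.ofReal G.κ * ∫⁻ y, H y ∂μ = 1 := by
    have h1 := hint' (fun _ => 1) measurable_const
    simp only [mul_one] at h1
    rw [h1, h.tsum_lintegral_delay_regen hφ G hβ htl haper]
  have hκ0 : ENNReal.ofReal G.κ ≠ 0 := by simpa using G.κ_pos
  have hinv : ∀ u : Y → ℝ≥0∞, Measurable u → ∫⁻ y, u y ∂μ ≠ ∞ →
      ∫⁻ y, H y * u (F y) ∂μ = ∫⁻ y, H y * u y ∂μ := fun u hu hfin => by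
    have h1 := tsum_congr (L := SummationFilter.unconditional ℕ)
      fun n => h.lintegral_delay_regen hφ G hg.measurable hg.inCone hg.ne_top hu n
    rw [ENNReal.tsum_add, ENNReal.tsum_add, ← hint u hu, ← hint' (fun y => u (F y)) (hu.comp hFm),
      ENNReal.tsum_mul_right, ENNReal.tsum_mul_left,
      h.tsum_lintegral_delay_regen hφ G hβ htl haper, tsum_ite_eq,
      add_comm] at h1
    simp only [one_mul] at h1
    exact (ENNReal.add_left_inj hfin).1 h1
  set ν := ENNReal.ofReal G.κ • μ.withDensity H with hν
  have hνap : ∀ u : Y → ℝ≥0∞, Measurable u →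
      ∫⁻ y, u y ∂ν = ENNReal.ofReal G.κ * ∫⁻ y, H y * u y ∂μ := fun u hu => by
    rw [hν, lintegral_smul_measure, lintegral_withDensity_eq_lintegral_mul _ hHm hu]
    rfl
  have hνp : IsProbabilityMeasure ν := ⟨by
    have := hνap (fun _ => 1) measurable_const
    simpa [hκH] using this⟩
  have hνF : MeasurePreserving F ν ν := by
    refine ⟨hFm, ?_⟩
    ext s hs
    rw [Measure.map_apply hFm hs, ← lintegral_indicator_one (hFm hs), ← lintegral_indicator_one hs,
      hνap _ (measurable_one.indicator (hFm hs)), hνap _ (measurable_one.indicator hs),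
      ← hinv _ (measurable_one.indicator hs) (by
        rw [lintegral_indicator_one hs]; exact measure_ne_top _ _)]
    rfl
  have hνμ : ν ≪ μ := (withDensity_absolutelyContinuous μ H).smul_left _
  have key := h.ergodic.eq_of_absolutelyContinuous hνF hνμ
  rw [← hint W hW, ← hνap W hW, key]

/-- By `tsum_lintegral_regen_mul` the coefficients of the difference add up to 0, so its partial
sums are minus its tails. These are dominated by the tails of the mass arriving unregenerated, hence
by `regenTail`, which is already O(n^{-β}). -/
theorem exists_maj_geomSeries_mul_regenSeries_sub : ∃ C : ℝ, 0 < C ∧ ∀ W, Measurable W →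
    ∫⁻ y, W y ∂μ ≠ ∞ →
    Maj (geomSeries * (regenSeries G φ (fun _ => 1) W -
      mass μ W • regenSeries G φ (fun _ => 1) fun _ => 1)) ((C * mass μ W) • powSeries β) := by
  have := h.isProbabilityMeasure
  have hg := h.isRegular_one G
  obtain ⟨C, hC, H⟩ := h.exists_maj_regenTail hφ G hβ htl
  have hp := h.isAperiodicProb_firstRegenSeries hφ G hβ htl haper
  have hκ := G.κ_pos
  have hκ1 := G.κ_lt_one
  have hexp := Real.exp_pos G.L
  set s := regenSeries G φ (fun _ => 1) fun _ => 1 with hs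
  set c := (1 - G.κ) / G.κ with hc
  have hc0 : 0 ≤ c := div_nonneg (by linarith) hκ.le
  have hsp : s = 1 + c • firstRegenSeries G φ fun _ => 1 := by
    rw [hs, h.regenSeries_one_eq G hφ hg, mass_one, map_one]
  have hs0 : ∀ n, 0 ≤ coeff n s := regenSeries_nonneg G
  have hone : HasSum (fun n => coeff n (1 : PowerSeries ℝ)) 1 := by
    simp only [coeff_one]
    exact hasSum_ite_eq 0 1
  have hsum : HasSum (fun n => coeff n s) (1 + c * 1) := by
    simp only [hsp, map_add, map_smul, smul_eq_mul]
    exact hone.add (hp.hasSum.mul_left c)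
  refine ⟨(Real.exp G.L + 1) * (c * C) + 1, by positivity, fun W hW hWf n => ?_⟩
  have hm := mass_nonneg μ W
  set x := regenSeries G φ (fun _ => 1) W - mass μ W • s with hx
  have hle : ∀ n, coeff n (regenSeries G φ (fun _ => 1) W) ≤ Real.exp G.L * mass μ W * coeff n s :=
    h.coeff_regenSeries_le hφ G hg hW hWf
  have hxle : ∀ n, |coeff n x| ≤ (Real.exp G.L + 1) * mass μ W * coeff n s := fun n => by
    rw [hx, map_sub, map_smul, smul_eq_mul]
    have h1 := regenSeries_nonneg G (φ := φ) (g := fun _ => 1) (W := W) n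
    have h2 := hle n
    have h3 := mul_nonneg hm (hs0 n)
    have h4 : 0 ≤ Real.exp G.L * mass μ W * coeff n s := by have := hs0 n; positivity
    rw [abs_le]
    constructor <;> nlinarith
  have hrs : Summable fun n => coeff n (regenSeries G φ (fun _ => 1) W) :=
    Summable.of_nonneg_of_le (regenSeries_nonneg G) hle (hsum.summable.mul_left _)
  have hrsum : ∑' n, coeff n (regenSeries G φ (fun _ => 1) W) = mass μ W / G.κ := by
    have h1 := h.tsum_lintegral_regen_mul hφ G hβ htl haper hW
    have h2 : ∑' n, ∫⁻ y, regen G φ (fun _ => 1) n y * W y ∂μ ≠ ∞ := fun he => by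
      rw [he, ENNReal.mul_top (by simpa using hκ)] at h1
      exact hWf h1.symm
    have h3 := congrArg ENNReal.toReal h1
    rw [ENNReal.toReal_mul, ENNReal.toReal_ofReal hκ.le,
      ENNReal.tsum_toReal_eq (ENNReal.ne_top_of_tsum_ne_top h2)] at h3
    simp only [coeff_regenSeries]
    rw [eq_div_iff hκ.ne', mul_comm, h3, mass]
  have hx0 : HasSum (fun n => coeff n x) 0 := by
    have h1 := hrs.hasSum.sub (hsum.mul_left (mass μ W))
    rw [hrsum] at h1
    have e : mass μ W / G.κ - mass μ W * (1 + c * 1) = 0 := by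
      rw [hc]; field_simp; ring
    rw [e] at h1
    simpa only [hx, map_sub, map_smul, smul_eq_mul] using h1
  have htail : coeff n (tailSum s) = c * coeff n (regenTail G φ fun _ => 1) := by
    have h1 := sum_add_coeff_tailSum hsum.summable n
    rw [hsum.tsum_eq] at h1
    have h2 : ∑ i ∈ Finset.range (n + 1), coeff i s =
        1 + c * ∑ i ∈ Finset.range (n + 1), coeff i (firstRegenSeries G φ fun _ => 1) := by
      simp only [hsp, map_add, map_smul, smul_eq_mul, Finset.sum_add_distrib, ← Finset.mul_sum]
      simp [coeff_one]
    rw [coeff_regenTail, mass_one]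
    linarith
  have hxt : coeff n (geomSeries * x) = -coeff n (tailSum x) := by
    have h1 := sum_add_coeff_tailSum hx0.summable n
    rw [hx0.tsum_eq] at h1
    rw [coeff_geomSeries_mul]
    linarith
  have hbound : |coeff n (tailSum x)| ≤ (Real.exp G.L + 1) * mass μ W * coeff n (tailSum s) := by
    rw [coeff_tailSum, coeff_tailSum, ← tsum_mul_left, ← Real.norm_eq_abs]
    refine tsum_of_norm_bounded (Summable.hasSum ?_) fun j => hxle _
    exact ((summable_nat_add_iff (n + 1)).2 hsum.summable).mul_left _
  have hR := (le_abs_self _).trans (H _ hg n)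
  rw [mass_one, mul_one, map_smul, coeff_powSeries, smul_eq_mul] at hR
  rw [hxt, abs_neg, map_smul, coeff_powSeries, smul_eq_mul]
  have ha := powSeq_nonneg β n
  calc _ ≤ (Real.exp G.L + 1) * mass μ W * (c * (C * powSeq β n)) := by
        refine hbound.trans ?_
        rw [htail]
        gcongr
    _ ≤ _ := by
        have : 0 ≤ mass μ W * powSeq β n := by positivity
        nlinarith

/-- `∫ K_n W` depends on `W` only through its mass, up to a polynomial error. -/
theorem exists_maj_renewalSeries_sub_mass : ∃ C : ℝ, 0 < C ∧ ∀ W, Measurable W →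
    ∫⁻ y, W y ∂μ ≠ ∞ →
    Maj (renewalSeries μ F φ (fun _ => 1) W -
      mass μ W • renewalSeries μ F φ (fun _ => 1) fun _ => 1) ((C * mass μ W) • powSeries β) := by
  have := h.isProbabilityMeasure
  obtain ⟨G, -⟩ := h.exists_regeneration (θ₀ := 1 / 2) (by norm_num) (by norm_num)
  have hp := h.isAperiodicProb_firstRegenSeries hφ G hβ htl haper
  obtain ⟨C₀, hC₀, H₀⟩ := h.exists_maj_regenTail hφ G hβ htl
  have h₀ := H₀ _ (h.isRegular_one G)
  rw [← h.tailSeries_firstRegenSeries G] at h₀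
  obtain ⟨C₁, hC₁, h₁⟩ := hp.exists_maj_invTail hβ h₀
  obtain ⟨C₂, hC₂, h₂⟩ := h.exists_maj_geomSeries_mul_regenSeries_sub hφ G hβ htl haper
  obtain ⟨C₃, hC₃, h₃⟩ := exists_maj_powSeries_mul_self hβ
  refine ⟨C₁ * C₂ * C₃, by positivity, fun W hW hWf => ?_⟩
  have hm := mass_nonneg μ W
  have e : renewalSeries μ F φ (fun _ => 1) W -
      mass μ W • renewalSeries μ F φ (fun _ => 1) (fun _ => 1) =
      invTail (firstRegenSeries G φ fun _ => 1) * (geomSeries * (regenSeries G φ (fun _ => 1) W -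
      mass μ W • regenSeries G φ (fun _ => 1) fun _ => 1)) := by
    rw [h.renewalSeries_one_eq hφ G hβ htl haper hW hWf,
      h.renewalSeries_one_eq hφ G hβ htl haper measurable_const (by simp), renewal,
      smul_eq_C_mul, smul_eq_C_mul]
    ring
  rw [e]
  refine (h₁.smul_mul_smul (h₂ W hW hWf)).trans ?_
  have h4 := Maj.smul_of_nonneg h₃ (show 0 ≤ C₁ * (C₂ * mass μ W) by positivity)
  rw [smul_smul] at h4
  exact h4.mono (coeff_powSeries_nonneg β) (le_of_eq (by ring))

omit hβ htl haper in
-- The last-visit decomposition of the constant function 1: starting in the base, every point has a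
-- last visit to it by time `n`.
theorem sum_renewalSeries_tail : geomSeries = (PowerSeries.mk fun n => ∑ k ∈ Finset.range (n + 1),
    coeff (n - k) (renewalSeries μ F φ (fun _ => 1) ({y | k < φ y}.indicator fun _ => 1))) := by
  have := h.isProbabilityMeasure
  have hφm := h.measurable_returnTime hφ
  have hWm : ∀ k, Measurable ({y | k < φ y}.indicator fun _ => (1 : ℝ≥0∞)) := fun k =>
    measurable_const.indicator (measurableSet_lt measurable_const hφm)
  ext n
  rw [coeff_geomSeries, coeff_mk]
  have h1 : ∫⁻ _, 1 ∂μ = ∑ k ∈ Finset.range (n + 1), ∫⁻ y,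
      renewalOp F φ ({y | k < φ y}.indicator fun _ => 1) (n - k) y ∂μ := by
    rw [← lintegral_finsetSum _ fun k _ => h.measurable_renewalOp hφ (hWm k) _]
    exact lintegral_congr fun y => hφ.cocycle_eq_sum (w := fun _ _ => 1) (fun _ _ => rfl) n y
  rw [lintegral_one, measure_univ] at h1
  have h2 := congrArg ENNReal.toReal h1
  rw [ENNReal.toReal_one, ENNReal.toReal_sum] at h2
  · simpa only [coeff_renewalSeries, one_mul] using h2
  · intro k hk
    exact (ENNReal.lt_top_of_sum_ne_top (h1 ▸ ENNReal.one_ne_top) hk).ne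

/-- The asymptotic expansion of `∫ K_n W`. -/
theorem exists_maj_renewalSeries_expansion {m : ℝ}
    (hm : HasSum (fun n => coeff n (returnTail μ φ)) m) : ∃ C : ℝ, 0 < C ∧ ∀ W, Measurable W →
    ∫⁻ y, W y ∂μ ≠ ∞ →
    Maj (renewalSeries μ F φ (fun _ => 1) W -
      mass μ W • (m⁻¹ • geomSeries + m⁻¹ ^ 2 • tailSum (returnTail μ φ)))
      ((C * mass μ W) • rateSeries β) := by
  have := h.isProbabilityMeasure
  have hφm := h.measurable_returnTime hφ
  obtain ⟨C₁, hC₁, h₁⟩ := h.exists_maj_renewalSeries_sub_mass hφ hβ htl haper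
  obtain ⟨C₂, hC₂, h₂⟩ := exists_maj_powSeries_mul_self hβ
  have hq := h.isAperiodicProb_returnDist hφ haper hβ htl
  have htq := tailSeries_returnDist (μ := μ) hφm
  have htl' := htl
  rw [← htq] at htl' hm
  obtain ⟨C₃, hC₃, h₃⟩ := hq.exists_maj_invTail hβ htl'
  obtain ⟨C₄, hC₄, h₄⟩ := hq.exists_maj_renewal_sub hβ htl' hm
  rw [htq] at h₄
  have hK : 0 ≤ K := by simpa [powSeq_zero] using htl.nonneg 0
  set c := renewalSeries μ F φ (fun _ => 1) fun _ => 1 with hc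
  set D := returnTail μ φ with hD
  have hWm : ∀ k, Measurable ({y | k < φ y}.indicator fun _ => (1 : ℝ≥0∞)) := fun k =>
    measurable_const.indicator (measurableSet_lt measurable_const hφm)
  have hint : ∀ k, ∫⁻ y, {y | k < φ y}.indicator (fun _ => (1 : ℝ≥0∞)) y ∂μ = μ {y | k < φ y} :=
    fun k => by
      rw [lintegral_indicator_const (measurableSet_lt measurable_const hφm), one_mul]
  -- In the last-visit identity for 1, each indicator of φ > k is replaced by its mass. Hence `c`
  -- nearly satisfies the equation D c = 1/(1 - X) that the renewal sequence of the law of φ solves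
  -- exactly.
  have herr : Maj (geomSeries - D * c) ((K * C₁) • (powSeries β * powSeries β)) := fun n => by
    have hmass : ∀ k, mass μ ({y | k < φ y}.indicator fun _ => 1) = coeff k D := fun k => by
      rw [mass, hint, hD, coeff_returnTail, Measure.real]
    rw [h.sum_renewalSeries_tail hφ, map_sub, coeff_mk, coeff_mul,
      Finset.Nat.sum_antidiagonal_eq_sum_range_succ (fun i j => coeff i D * coeff j c),
      ← Finset.sum_sub_distrib, map_smul, coeff_mul,
      Finset.Nat.sum_antidiagonal_eq_sum_range_succ
        (fun i j => coeff i (powSeries β) * coeff j (powSeries β)), smul_eq_mul, Finset.mul_sum]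
    refine (Finset.abs_sum_le_sum_abs _ _).trans (Finset.sum_le_sum fun k _ => ?_)
    have h5 := h₁ _ (hWm k) (by rw [hint]; exact measure_ne_top _ _) (n - k)
    rw [hmass, map_sub, map_smul, map_smul, smul_eq_mul, smul_eq_mul] at h5
    refine h5.trans ?_
    have h6 := (le_abs_self _).trans (htl k)
    rw [map_smul, smul_eq_mul] at h6
    have h7 := coeff_powSeries_nonneg β (n - k)
    calc _ ≤ C₁ * (K * coeff k (powSeries β)) * coeff (n - k) (powSeries β) := by gcongr
      _ = _ := by ring
  have hcU : Maj (c - renewal (returnDist μ φ)) ((C₃ * (K * C₁ * C₂) * C₂) • powSeries β) := by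
    have hinv := hq.tailSeries_mul_invTail
    rw [htq] at hinv
    have e : c - renewal (returnDist μ φ) = -(invTail (returnDist μ φ) * (geomSeries - D * c)) := by
      rw [renewal]
      linear_combination (-c) * hinv
    rw [e]
    refine Maj.neg ?_
    have h5 := h₂.smul_of_nonneg (show 0 ≤ K * C₁ by positivity)
    rw [smul_smul] at h5
    refine (h₃.smul_mul_smul (herr.trans h5)).trans ?_
    have h6 := h₂.smul_of_nonneg (show 0 ≤ C₃ * (K * C₁ * C₂) by positivity)
    rwa [smul_smul] at h6
  refine ⟨C₁ + (C₃ * (K * C₁ * C₂) * C₂ + C₄), by positivity, fun W hW hWf => ?_⟩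
  have hmW := mass_nonneg μ W
  have hpr : ∀ b : ℝ, 0 ≤ b → Maj (b • powSeries β) (b • rateSeries β) := fun b hb =>
    (powSeries_maj_rateSeries β).smul_of_nonneg hb
  have h6 := (hcU.trans (hpr _ (by positivity))).add h₄
  rw [← add_smul] at h6
  have h7 := (h6.smul_of_nonneg hmW)
  have h8 := ((h₁ W hW hWf).trans (hpr _ (by positivity))).add h7
  rw [smul_smul, ← add_smul] at h8
  have e : renewalSeries μ F φ (fun _ => 1) W - mass μ W • (m⁻¹ • geomSeries + m⁻¹ ^ 2 • tailSum D) =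
      renewalSeries μ F φ (fun _ => 1) W - mass μ W • c + mass μ W • (c - renewal (returnDist μ φ) +
        (renewal (returnDist μ φ) - (m⁻¹ • geomSeries + m⁻¹ ^ 2 • tailSum D))) := by
    simp only [smul_eq_C_mul]
    ring
  rw [e]
  exact h8.mono (coeff_rateSeries_nonneg β) (le_of_eq (by ring))

end IsFullBranchGibbsMarkov

end CoreAsymptotics

/-! ### Observables followed along the tower -/

section Decorrelation

open PowerSeries

variable {Y : Type*} [MeasurableSpace Y] {F : Y → Y} {α : Set (Set Y)} {μ : Measure Y}

/-- A nonnegative bounded observable, followed along the tower. -/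
structure IsTowerObservable (F : Y → Y) (φ : Y → ℕ) (w : ℕ → Y → ℝ) (b : ℝ) : Prop where
  measurable : ∀ k, Measurable (w k)
  nonneg : ∀ k y, 0 ≤ w k y
  le : ∀ k y, w k y ≤ b
  cocycle : ∀ k y, w (φ y + k) y = w k (F y)

/-- The generating function of `∫ g w_n`. -/
def towerSeries (μ : Measure Y) (g : Y → ℝ≥0∞) (w : ℕ → Y → ℝ) : PowerSeries ℝ :=
  PowerSeries.mk fun n => (∫⁻ y, g y * ENNReal.ofReal (w n y) ∂μ).toReal

/-- The restriction of `w_k` to the points which have not returned by time `k`. -/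
def levelPart (φ : Y → ℕ) (w : ℕ → Y → ℝ) (k : ℕ) : Y → ℝ≥0∞ :=
  {y | k < φ y}.indicator fun y => ENNReal.ofReal (w k y)

/-- The density of the image under `F` of the measure with density `g`. -/
def pushDensity (G : Regeneration μ F α) (g : Y → ℝ≥0∞) (y : Y) : ℝ≥0∞ :=
  ENNReal.ofReal G.κ * ∫⁻ y, g y ∂μ + ∑' a : α, G.Q a g y

theorem maj_X_mul_powSeries {β : ℝ} (hβ : 0 ≤ β) :
    Maj (X * powSeries β) ((2 : ℝ) ^ β • powSeries β) := fun n => by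
  rcases n with _ | n
  · have := powSeq_nonneg β 0
    simp only [coeff_zero_eq_constantCoeff, map_mul, constantCoeff_X, zero_mul, abs_zero]
    rw [← coeff_zero_eq_constantCoeff_apply, map_smul, coeff_powSeries, smul_eq_mul]
    positivity
  · rw [coeff_succ_X_mul, map_smul, coeff_powSeries, coeff_powSeries, smul_eq_mul,
      abs_of_nonneg (powSeq_nonneg β n)]
    have h7 := powSeq_le_of_le_mul_add_one hβ le_rfl (i := n) (n := n + 1) (by push_cast; linarith)
    rwa [mul_one] at h7

namespace IsFullBranchGibbsMarkov

variable (h : IsFullBranchGibbsMarkov μ F α)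

include h

section Push

variable (G : Regeneration μ F α) {g : Y → ℝ≥0∞} (hgm : Measurable g)
  (hgc : ∀ a ∈ α, InCone F α G.θ G.L a g) (hgf : ∫⁻ y, g y ∂μ ≠ ∞)

include hgm hgc hgf

theorem lintegral_pushDensity_mul {u : Y → ℝ≥0∞} (hu : Measurable u) :
    ∫⁻ y, pushDensity G g y * u y ∂μ = ∫⁻ y, g y * u (F y) ∂μ := by
  have : Countable α := h.countable.to_subtype
  have hfin : ∀ a : α, ∫⁻ y in a, g y ∂μ ≠ ∞ := fun a =>
    ne_top_of_le_ne_top hgf (setLIntegral_le_lintegral _ _)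
  have hQ : ∀ a : α, Measurable (G.Q a g) := fun a => G.measurable_Q a g hgm
  simp only [pushDensity, add_mul]
  rw [lintegral_add_left (f := fun y => ENNReal.ofReal G.κ * (∫⁻ y, g y ∂μ) * u y)
    (hu.const_mul _), lintegral_const_mul _ hu, h.lintegral_eq_tsum_atoms fun y => g y * u (F y)]
  simp only [← ENNReal.tsum_mul_right]
  rw [lintegral_tsum (f := fun (a : α) y => G.Q a g y * u y) fun a => ((hQ a).mul hu).aemeasurable,
    h.lintegral_eq_tsum_atoms g, ← ENNReal.tsum_mul_left, ← ENNReal.tsum_mul_right,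
    ← ENNReal.tsum_add]
  exact tsum_congr fun a => (G.lintegral_eq a g hgm (hgc a a.2) (hfin a) u hu).symm

theorem lintegral_pushDensity : ∫⁻ y, pushDensity G g y ∂μ = ∫⁻ y, g y ∂μ := by
  simpa using h.lintegral_pushDensity_mul G hgm hgc hgf (u := fun _ => 1) measurable_const

/-- Regularity within each atom suffices beforehand: one step of `F` spreads every atom over all of
`Y` and produces a globally regular density. -/
theorem isRegular_pushDensity : IsRegular μ G (pushDensity G g) where
  measurable := by
    have : Countable α := h.countable.to_subtype
    exact measurable_const.add (Measurable.tsum fun a => G.measurable_Q a g hgm)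
  inCone := (inCone_const G.θ_pos.le G.L_pos.le _).add (InCone.tsum fun a =>
    G.inCone_Q a g hgm (hgc a a.2) (ne_top_of_le_ne_top hgf (setLIntegral_le_lintegral _ _)))
  ne_top := by rwa [h.lintegral_pushDensity G hgm hgc hgf]

end Push

variable {φ : Y → ℕ} (hφ : IsReturnTime α φ) {w : ℕ → Y → ℝ} {b : ℝ}
  (hw : IsTowerObservable F φ w b)

include hw in
theorem bound_nonneg : 0 ≤ b := by
  have := h.isProbabilityMeasure
  obtain ⟨y⟩ : Nonempty Y := by
    by_contra hne
    rw [not_nonempty_iff] at hne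
    exact IsProbabilityMeasure.ne_zero μ (Measure.eq_zero_of_isEmpty μ)
  exact (hw.nonneg 0 y).trans (hw.le 0 y)

include hφ hw

theorem measurable_levelPart (k : ℕ) : Measurable (levelPart φ w k) :=
  (hw.measurable k).ennreal_ofReal.indicator
    (measurableSet_lt measurable_const (h.measurable_returnTime hφ))

theorem lintegral_levelPart_le (k : ℕ) :
    ∫⁻ y, levelPart φ w k y ∂μ ≤ ENNReal.ofReal b * μ {y | k < φ y} := by
  rw [← lintegral_indicator_const (measurableSet_lt measurable_const (h.measurable_returnTime hφ))]
  refine lintegral_mono fun y => Set.indicator_le_indicator ?_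
  exact ENNReal.ofReal_le_ofReal (hw.le k y)

theorem lintegral_levelPart_ne_top (k : ℕ) : ∫⁻ y, levelPart φ w k y ∂μ ≠ ∞ := by
  have := h.isProbabilityMeasure
  exact ne_top_of_le_ne_top (ENNReal.mul_ne_top ENNReal.ofReal_ne_top (measure_ne_top _ _))
    (h.lintegral_levelPart_le hφ hw k)

theorem mass_levelPart_le (k : ℕ) : mass μ (levelPart φ w k) ≤ b * coeff k (returnTail μ φ) := by
  have := h.isProbabilityMeasure
  have hb := h.bound_nonneg hw
  have h1 := ENNReal.toReal_mono (ENNReal.mul_ne_top ENNReal.ofReal_ne_top (measure_ne_top _ _))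
    (h.lintegral_levelPart_le hφ hw k)
  rw [ENNReal.toReal_mul, ENNReal.toReal_ofReal hb] at h1
  rwa [coeff_returnTail]

theorem coeff_towerSeries_eq_sum {g : Y → ℝ≥0∞} (hg : Measurable g) (hgf : ∫⁻ y, g y ∂μ ≠ ∞)
    (n : ℕ) : coeff n (towerSeries μ g w) = ∑ k ∈ Finset.range (n + 1),
      coeff (n - k) (renewalSeries μ F φ g (levelPart φ w k)) := by
  have hKm : ∀ k, Measurable (renewalOp F φ (levelPart φ w k) (n - k)) := fun k =>
    h.measurable_renewalOp hφ (h.measurable_levelPart hφ hw k) _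
  have h1 : ∫⁻ y, g y * ENNReal.ofReal (w n y) ∂μ = ∑ k ∈ Finset.range (n + 1),
      ∫⁻ y, g y * renewalOp F φ (levelPart φ w k) (n - k) y ∂μ := by
    rw [← lintegral_finsetSum (f := fun k y => g y * renewalOp F φ (levelPart φ w k) (n - k) y) _
      fun k _ => hg.mul (hKm k)]
    refine lintegral_congr fun y => ?_
    rw [← Finset.mul_sum, hφ.cocycle_eq_sum (w := fun k y => ENNReal.ofReal (w k y))
      (fun k y => by rw [hw.cocycle]) n y]
    rfl
  have hfin : ∫⁻ y, g y * ENNReal.ofReal (w n y) ∂μ ≠ ∞ := by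
    refine ne_top_of_le_ne_top (ENNReal.mul_ne_top hgf (ENNReal.ofReal_ne_top (r := b))) ?_
    rw [← lintegral_mul_const _ hg]
    exact lintegral_mono fun y => mul_le_mul_right (ENNReal.ofReal_le_ofReal (hw.le n y)) _
  simp only [towerSeries, coeff_mk, coeff_renewalSeries]
  rw [h1, ENNReal.toReal_sum]
  exact fun k hk => (ENNReal.lt_top_of_sum_ne_top (h1 ▸ hfin) hk).ne

variable {β K : ℝ} (htl : Maj (returnTail μ φ) (K • powSeries β))

include htl

/-- Summation over the last visit to the base preserves bounds. -/
theorem abs_sum_coeff_sub_le {R : ℕ → PowerSeries ℝ} {C : ℝ} (hC : 0 ≤ C) {E : PowerSeries ℝ}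
    (hE : ∀ n, 0 ≤ coeff n E)
    (hR : ∀ k, Maj (R k) ((C * mass μ (levelPart φ w k)) • E)) (n : ℕ) :
    |∑ k ∈ Finset.range (n + 1), coeff (n - k) (R k)| ≤ C * b * K * coeff n (powSeries β * E) := by
  have hb := h.bound_nonneg hw
  rw [coeff_mul, Finset.Nat.sum_antidiagonal_eq_sum_range_succ
    (fun i j => coeff i (powSeries β) * coeff j E), Finset.mul_sum]
  refine (Finset.abs_sum_le_sum_abs _ _).trans (Finset.sum_le_sum fun k _ => ?_)
  refine (hR k _).trans ?_
  have h1 := (le_abs_self _).trans (htl k)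
  rw [map_smul, smul_eq_mul] at h1
  have h2 := (h.mass_levelPart_le hφ hw k).trans (mul_le_mul_of_nonneg_left h1 hb)
  have h3 := mul_le_mul_of_nonneg_right (mul_le_mul_of_nonneg_left h2 hC) (hE (n - k))
  rw [map_smul, smul_eq_mul]
  linarith

variable (hβ : 1 < β) (haper : ∀ d : ℕ, (∀ y, d ∣ φ y) → d = 1)

include hβ haper

omit hw in
/-- Regular densities lose memory along the tower. -/
theorem exists_maj_towerSeries_sub (G : Regeneration μ F α) : ∃ C : ℝ, 0 < C ∧
    ∀ g w b, IsRegular μ G g → IsTowerObservable F φ w b →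
      Maj (towerSeries μ g w - mass μ g • towerSeries μ (fun _ => 1) w)
        ((C * mass μ g * b) • powSeries β) := by
  have hK : 0 ≤ K := by simpa [powSeq_zero] using htl.nonneg 0
  obtain ⟨C₁, hC₁, h₁⟩ := h.exists_maj_renewalSeries_sub hφ G hβ htl haper
  obtain ⟨C₂, hC₂, h₂⟩ := exists_maj_powSeries_mul_self hβ
  -- The summand 1 only secures positivity, since `K` is merely recorded as nonnegative.
  refine ⟨C₁ * K * C₂ + 1, by positivity, fun g w b hg hw n => ?_⟩
  have := h.isProbabilityMeasure
  have hm := mass_nonneg μ g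
  have hb := h.bound_nonneg hw
  have h3 := h.abs_sum_coeff_sub_le hφ hw htl (E := powSeries β)
    (show 0 ≤ C₁ * mass μ g by positivity) (coeff_powSeries_nonneg β)
    (fun k => h₁ g _ hg (h.measurable_levelPart hφ hw k) (h.lintegral_levelPart_ne_top hφ hw k)) n
  rw [map_sub, map_smul, smul_eq_mul, h.coeff_towerSeries_eq_sum hφ hw hg.measurable hg.ne_top,
    h.coeff_towerSeries_eq_sum hφ hw measurable_const (by simp), Finset.mul_sum,
    ← Finset.sum_sub_distrib]
  simp only [map_sub, map_smul, smul_eq_mul] at h3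
  refine h3.trans ?_
  have h4 := (le_abs_self _).trans (h₂ n)
  rw [map_smul, smul_eq_mul, coeff_powSeries] at h4
  have ha := powSeq_nonneg β n
  rw [map_smul, smul_eq_mul, coeff_powSeries]
  calc _ ≤ C₁ * mass μ g * b * K * (C₂ * powSeq β n) := by gcongr
    _ ≤ _ := by
      have : 0 ≤ mass μ g * b * powSeq β n := by positivity
      nlinarith

omit hw in
-- Bounds on the increments allow the shifted values of the tower series met along the levels to be
-- replaced by its value at time n.
theorem exists_maj_one_sub_X_mul_towerSeries : ∃ C : ℝ, 0 < C ∧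
    ∀ w b, IsTowerObservable F φ w b →
      Maj ((1 - X) * towerSeries μ (fun _ => 1) w) ((C * b) • powSeries β) := by
  have hK : 0 ≤ K := by simpa [powSeq_zero] using htl.nonneg 0
  obtain ⟨C₁, hC₁, h₁⟩ := h.exists_maj_one_sub_X_mul_renewalSeries hφ hβ htl haper
  obtain ⟨C₂, hC₂, h₂⟩ := exists_maj_powSeries_mul_self hβ
  refine ⟨C₁ * K * C₂ + 1, by positivity, fun w b hw n => ?_⟩
  have := h.isProbabilityMeasure
  have hb := h.bound_nonneg hw
  have h3 := h.abs_sum_coeff_sub_le hφ hw htl hC₁.le (coeff_powSeries_nonneg β)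
    (fun k => h₁ _ (h.measurable_levelPart hφ hw k) (h.lintegral_levelPart_ne_top hφ hw k)) n
  have e : coeff n ((1 - X) * towerSeries μ (fun _ => 1) w) = ∑ k ∈ Finset.range (n + 1),
      coeff (n - k) ((1 - X) * renewalSeries μ F φ (fun _ => 1) (levelPart φ w k)) := by
    rcases n with _ | n
    · rw [coeff_zero_one_sub_X_mul, h.coeff_towerSeries_eq_sum hφ hw measurable_const (by simp)]
      simp [sub_mul]
    · rw [coeff_succ_one_sub_X_mul, h.coeff_towerSeries_eq_sum hφ hw measurable_const (by simp),
        h.coeff_towerSeries_eq_sum hφ hw measurable_const (by simp), Finset.sum_range_succ,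
        Finset.sum_range_succ (n := n + 1), add_sub_right_comm, ← Finset.sum_sub_distrib]
      congr 1
      · refine Finset.sum_congr rfl fun k hk => ?_
        rw [Finset.mem_range] at hk
        rw [Nat.succ_sub (by omega), coeff_succ_one_sub_X_mul]
      · simp [sub_mul]
  rw [e]
  refine h3.trans ?_
  have h4 := (le_abs_self _).trans (h₂ n)
  rw [map_smul, smul_eq_mul, coeff_powSeries] at h4
  have ha := powSeq_nonneg β n
  rw [map_smul, smul_eq_mul, coeff_powSeries]
  calc _ ≤ C₁ * b * K * (C₂ * powSeq β n) := by gcongr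
    _ ≤ _ := by
      have : 0 ≤ b * powSeq β n := by positivity
      nlinarith

omit hw hβ htl haper in
theorem one_le_of_hasSum_returnTail {m : ℝ} (hm : HasSum (fun n => coeff n (returnTail μ φ)) m) :
    1 ≤ m := by
  have := h.isProbabilityMeasure
  have h1 : coeff 0 (returnTail μ φ) = 1 := by
    have : {y | 0 < φ y} = Set.univ := Set.eq_univ_of_forall fun y => hφ.pos y
    rw [coeff_returnTail, this, probReal_univ]
  rw [← h1]
  exact le_hasSum hm 0 fun n _ => by simp

omit hw in
/-- The asymptotic expansion of `∫ w_n`. -/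
theorem exists_maj_towerSeries_expansion {m : ℝ}
    (hm : HasSum (fun n => coeff n (returnTail μ φ)) m) : ∃ C : ℝ, 0 < C ∧
    ∀ w b ω s, IsTowerObservable F φ w b →
      (PowerSeries.mk fun k => mass μ (levelPart φ w k)) = PowerSeries.C (m * ω) - (1 - X) * s →
      ∀ S : PowerSeries ℝ, (∀ n, 0 ≤ coeff n S) → Maj s (b • S) →
      Maj (towerSeries μ (fun _ => 1) w - (ω • geomSeries + (ω * m⁻¹) • tailSum (returnTail μ φ)))
        ((C * b) • (powSeries β * S + rateSeries β)) := by
  have hK : 0 ≤ K := by simpa [powSeq_zero] using htl.nonneg 0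
  have hm1 := h.one_le_of_hasSum_returnTail hφ hm
  have hm0 : 0 < m := by linarith
  obtain ⟨C₁, hC₁, h₁⟩ := h.exists_maj_renewalSeries_expansion hφ hβ htl haper hm
  obtain ⟨C₂, hC₂, h₂⟩ := exists_maj_rateSeries_mul hβ
  have h₃ := one_sub_X_mul_tailSum hm.summable
  rw [hm.tsum_eq] at h₃
  set D := returnTail μ φ
  set t := tailSum D
  set E₀ := m⁻¹ • geomSeries + m⁻¹ ^ 2 • t with hE₀
  refine ⟨C₁ * K * C₂ + 2 + K, by positivity, fun w b ω s hw hW S hS hs => ?_⟩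
  have := h.isProbabilityMeasure
  have hb := h.bound_nonneg hw
  set W := PowerSeries.mk fun k => mass μ (levelPart φ w k)
  have herr : Maj (towerSeries μ (fun _ => 1) w - W * E₀)
      ((C₁ * b * K * C₂) • rateSeries β) := fun n => by
    have h3 := h.abs_sum_coeff_sub_le hφ hw htl hC₁.le (coeff_rateSeries_nonneg β)
      (fun k => h₁ _ (h.measurable_levelPart hφ hw k) (h.lintegral_levelPart_ne_top hφ hw k)) n
    rw [map_sub, h.coeff_towerSeries_eq_sum hφ hw measurable_const (by simp), coeff_mul,
      Finset.Nat.sum_antidiagonal_eq_sum_range_succ (fun i j => coeff i W * coeff j E₀),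
      ← Finset.sum_sub_distrib]
    simp only [map_sub, map_smul, smul_eq_mul] at h3
    simp only [W, coeff_mk]
    refine h3.trans ?_
    have h4 := (le_abs_self _).trans (h₂ n)
    rw [mul_comm (rateSeries β), map_smul, smul_eq_mul] at h4
    rw [map_smul, smul_eq_mul]
    calc _ ≤ C₁ * b * K * (C₂ * coeff n (rateSeries β)) := by gcongr
      _ = _ := by ring
  have hinv : m⁻¹ * m = 1 := inv_mul_cancel₀ hm0.ne'
  have hCC : PowerSeries.C (m⁻¹) * PowerSeries.C m = (1 : PowerSeries ℝ) := by
    rw [← map_mul, hinv, map_one]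
  -- Insert W = mω - (1 - X)s into W E₀. As (1 - X)t = m - D, the terms with `s` collapse to -2s/m +
  -- Ds/m², with no summation left over.
  have e : towerSeries μ (fun _ => 1) w - (ω • geomSeries + (ω * m⁻¹) • t) =
      (towerSeries μ (fun _ => 1) w - W * E₀) + ((-(2 * m⁻¹)) • s + m⁻¹ ^ 2 • (D * s)) := by
    rw [hW, hE₀]
    simp only [smul_eq_C_mul, map_mul, map_neg, map_pow, map_ofNat]
    have hg := geomSeries_mul
    linear_combination (PowerSeries.C ω * geomSeries + PowerSeries.C ω * PowerSeries.C (m⁻¹) * t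
      - PowerSeries.C (m⁻¹) * s) * hCC -
      PowerSeries.C (m⁻¹) * s * hg - PowerSeries.C (m⁻¹) ^ 2 * s * h₃
  rw [e]
  have hm2 : m⁻¹ ≤ 1 := inv_le_one_of_one_le₀ hm1
  have hm3 : 0 ≤ m⁻¹ := by positivity
  have hPS : ∀ n, 0 ≤ coeff n (powSeries β * S) := fun n => by
    rw [coeff_mul]
    exact Finset.sum_nonneg fun p _ => mul_nonneg (coeff_powSeries_nonneg β _) (hS _)
  have hSA : ∀ n, coeff n S ≤ coeff n (powSeries β * S) := fun n => by
    rw [coeff_mul]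
    have := Finset.single_le_sum (s := Finset.HasAntidiagonal.antidiagonal n)
      (f := fun p : ℕ × ℕ => coeff p.1 (powSeries β) * coeff p.2 S)
      (fun p _ => mul_nonneg (coeff_powSeries_nonneg β _) (hS _))
      (show (0, n) ∈ _ by simp)
    simpa [powSeq_zero] using this
  have hDs := (htl.smul_mul_smul hs)
  intro n
  have i1 := herr n
  have i2 := hs n
  have i3 := hDs n
  have i4 := hSA n
  have i5 := hPS n
  have i6 := coeff_rateSeries_nonneg β n
  simp only [map_add, map_smul, smul_eq_mul] at i1 i2 i3 ⊢
  have j2 : |-(2 * m⁻¹) * coeff n s| ≤ 2 * (b * coeff n (powSeries β * S)) := by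
    rw [abs_mul, abs_neg, abs_of_nonneg (by positivity)]
    have : b * coeff n S ≤ b * coeff n (powSeries β * S) := by gcongr
    have := abs_nonneg (coeff n s)
    nlinarith
  have j3 : |m⁻¹ ^ 2 * coeff n (D * s)| ≤ K * b * coeff n (powSeries β * S) := by
    rw [abs_mul, abs_of_nonneg (by positivity)]
    have h1 : m⁻¹ ^ 2 ≤ 1 := pow_le_one₀ hm3 hm2
    have := abs_nonneg (coeff n (D * s))
    nlinarith
  refine (abs_add_le _ _).trans ((add_le_add i1 ((abs_add_le _ _).trans (add_le_add j2 j3))).trans ?_)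
  have k1 : 0 ≤ b * coeff n (powSeries β * S) := by positivity
  have k2 : 0 ≤ b * coeff n (rateSeries β) := by positivity
  have k3 : 0 ≤ C₁ * K * C₂ := by positivity
  nlinarith [mul_nonneg k3 k1, mul_nonneg hK k2]

end IsFullBranchGibbsMarkov

end Decorrelation

/-! ### Decay of correlations on the tower -/

section Correlation

open PowerSeries

variable {Y : Type*} [MeasurableSpace Y] {F : Y → Y} {α : Set (Set Y)} {μ : Measure Y}

/-- The level of the tower from which the base is reached in `j + 1` steps. -/
def fromTop (φ : Y → ℕ) (v : ℕ → Y → ℝ) (j : ℕ) (y : Y) : ℝ :=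
  if j < φ y then v (φ y - 1 - j) y else 0

/-- A dynamically Hölder observable on the tower. -/
structure IsTowerHolder (F : Y → Y) (α : Set (Set Y)) (φ σ : Y → ℕ) (θ : ℝ) (v : ℕ → Y → ℝ)
    (B : ℝ) : Prop where
  nonneg : 0 ≤ B
  abs_le : ∀ y, ∀ ℓ < φ y, |v ℓ y| ≤ B
  holder : ∀ a ∈ α, ∀ y ∈ a, ∀ y' ∈ a, ∀ ℓ < φ y, |v ℓ y - v ℓ y'| ≤ B * θ ^ sepTime F α y y'
  sum_abs_le : ∀ y, ∑ ℓ ∈ Finset.range (φ y), |v ℓ y| ≤ B * σ y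

/-- The integrals `∫_{φ > n} σ`. -/
def tailMean (μ : Measure Y) (φ σ : Y → ℕ) (n : ℕ) : ℝ :=
  ∫ y, {y | n < φ y}.indicator (fun y => (σ y : ℝ)) y ∂μ

/-- This lets γ_n absorb all errors of size n^{-β}. -/
theorem powSeq_le_conv {β : ℝ} {τ : ℕ → ℝ} (h0 : ∀ n, 0 ≤ τ n) (h1 : 1 ≤ τ 0) (n : ℕ) :
    powSeq β n ≤ conv (powSeq β) τ n := by
  have h2 := Finset.single_le_sum (s := Finset.range (n + 1)) (f := fun j => powSeq β j * τ (n - j))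
    (fun j _ => mul_nonneg (powSeq_nonneg β j) (h0 _)) (Finset.self_mem_range_succ n)
  simp only [Nat.sub_self] at h2
  exact (le_mul_of_one_le_right (powSeq_nonneg β n) h1).trans h2

theorem tailMean_nonneg (μ : Measure Y) (φ σ : Y → ℕ) (n : ℕ) : 0 ≤ tailMean μ φ σ n :=
  integral_nonneg fun y => Set.indicator_nonneg (fun _ _ => Nat.cast_nonneg _) y

theorem one_le_tailMean_zero [IsProbabilityMeasure μ] {φ σ : Y → ℕ} (hφ : ∀ y, 1 ≤ φ y)
    (hσ1 : ∀ y, 1 ≤ σ y) (hσ : Integrable (fun y => (σ y : ℝ)) μ) : 1 ≤ tailMean μ φ σ 0 := by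
  have h1 : ∀ y, {y | 0 < φ y}.indicator (fun y => (σ y : ℝ)) y = σ y := fun y =>
    Set.indicator_of_mem (show y ∈ {y | 0 < φ y} from hφ y) _
  simp only [tailMean, h1]
  have h2 : ∫ _, (1 : ℝ) ∂μ = 1 := by simp
  rw [← h2]
  exact integral_mono (integrable_const _) hσ fun y => Nat.one_le_cast.2 (hσ1 y)

/-- Counted from the top, the first `n` levels exhaust the column unless it is higher than `n`. -/
theorem abs_sum_sub_sum_fromTop_le (x : ℕ → ℝ) (N n : ℕ) :
    |∑ ℓ ∈ Finset.range N, x ℓ - ∑ j ∈ Finset.range n, if j < N then x (N - 1 - j) else 0| ≤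
      if n < N then ∑ ℓ ∈ Finset.range N, |x ℓ| else 0 := by
  rw [← Finset.sum_range_reflect]
  split_ifs with h
  · rw [← Finset.sum_range_reflect (fun ℓ => |x ℓ|), ← Finset.sum_range_add_sum_Ico _ h.le,
      ← Finset.sum_range_add_sum_Ico (fun ℓ => |x (N - 1 - ℓ)|) h.le]
    have h1 : ∑ j ∈ Finset.range n, (if j < N then x (N - 1 - j) else 0) =
        ∑ j ∈ Finset.range n, x (N - 1 - j) :=
      Finset.sum_congr rfl fun j hj => if_pos ((Finset.mem_range.1 hj).trans h)
    rw [h1, add_sub_cancel_left]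
    refine (Finset.abs_sum_le_sum_abs _ _).trans ?_
    exact le_add_of_nonneg_left (Finset.sum_nonneg fun _ _ => abs_nonneg _)
  · rw [not_lt] at h
    rw [← Finset.sum_range_add_sum_Ico _ h, Finset.sum_eq_zero (s := Finset.Ico _ _), add_zero,
      Finset.sum_congr rfl fun j hj => if_pos (Finset.mem_range.1 hj), sub_self, abs_zero]
    exact fun j hj => if_neg (not_lt.2 (Finset.mem_Ico.1 hj).1)

omit [MeasurableSpace Y] in
theorem IsReturnTime.holder_fromTop {φ : Y → ℕ} (hφ : IsReturnTime α φ) {θ B : ℝ} {σ : Y → ℕ} {v : ℕ → Y → ℝ} (hθ : 0 ≤ θ)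
    (hv : IsTowerHolder F α φ σ θ v B) (j : ℕ) : ∀ a ∈ α, ∀ y ∈ a, ∀ y' ∈ a,
    |fromTop φ v j y - fromTop φ v j y'| ≤ B * θ ^ sepTime F α y y' := fun a ha y hy y' hy' => by
  rw [fromTop, fromTop, hφ.const a ha y' hy' y hy]
  split_ifs with hj
  · exact hv.holder a ha y hy y' hy' _ (by omega)
  · rw [sub_self, abs_zero]
    exact mul_nonneg hv.nonneg (pow_nonneg hθ _)

namespace IsFullBranchGibbsMarkov

variable (h : IsFullBranchGibbsMarkov μ F α)

include h

theorem exists_atomIndex : ∃ e : Y → ℕ, Measurable e ∧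
    ∀ y y', e y = e y' → ∃ a ∈ α, y ∈ a ∧ y' ∈ a := by
  obtain ⟨f, hf⟩ := Set.countable_iff_exists_injective.1 h.countable
  choose at' hat hmem using h.exists_mem_atom
  refine ⟨fun y => f ⟨at' y, hat y⟩, h.measurable_of_const_on_atoms fun a ha y hy y' hy' => ?_,
    fun y y' he => ?_⟩
  · have hu : ∀ z ∈ a, at' z = a := fun z hz => by
      by_contra hne
      exact Set.disjoint_left.1 (h.isPartition.pairwiseDisjoint (hat z) ha hne) (hmem z) hz
    congr 2
    rw [hu y hy, hu y' hy']
  · have := congrArg Subtype.val (hf he)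
    exact ⟨at' y, hat y, hmem y, by rw [show at' y = at' y' from this]; exact hmem y'⟩

/-- Dynamically Hölder functions are measurable. -/
theorem measurable_of_holder {u : Y → ℝ} {B θ : ℝ} (hB : 0 ≤ B) (hθ0 : 0 ≤ θ) (hθ1 : θ < 1)
    (hu : ∀ a ∈ α, ∀ y ∈ a, ∀ y' ∈ a, |u y - u y'| ≤ B * θ ^ sepTime F α y y') :
    Measurable u := by
  obtain ⟨e, hem, he⟩ := h.exists_atomIndex
  have hF : Measurable F := h.ergodic.measurable
  rcases isEmpty_or_nonempty Y with hY | hY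
  · exact measurable_of_empty u
  let it : (n : ℕ) → Y → Fin n → ℕ := fun n y i => e (F^[i] y)
  have hit : ∀ n, Measurable (it n) := fun n =>
    measurable_pi_lambda _ fun i => hem.comp (hF.iterate i)
  -- `p n y` is a representative of the cylinder of length `n` around `y`. The function `u ∘ p n`
  -- depends on a countable itinerary only, and it converges to `u` by the Hölder bound.
  let p : ℕ → Y → Y := fun n y => Function.invFun (it n) (it n y)
  have hp : ∀ n y, it n (p n y) = it n y := fun n y =>
    Function.invFun_eq (f := it n) ⟨y, rfl⟩
  refine measurable_of_tendsto_metrizable (f := fun n y => u (p n y)) (fun n => ?_) ?_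
  · exact (measurable_of_countable fun z => u (Function.invFun (it n) z)).comp (hit n)
  · rw [tendsto_pi_nhds]
    intro y
    rw [tendsto_iff_dist_tendsto_zero]
    have h0 : Tendsto (fun n => B * θ ^ n) atTop (𝓝 0) := by
      simpa using (tendsto_pow_atTop_nhds_zero_of_lt_one hθ0 hθ1).const_mul B
    refine squeeze_zero' (Eventually.of_forall fun _ => dist_nonneg) ?_ h0
    filter_upwards [eventually_ge_atTop 1] with n hn
    rw [Real.dist_eq]
    have hsame : ∀ i < n, ∃ a ∈ α, F^[i] (p n y) ∈ a ∧ F^[i] y ∈ a := fun i hi =>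
      he _ _ (congrFun (hp n y) ⟨i, hi⟩)
    rcases eq_or_ne (p n y) y with heq | hne
    · rw [heq, sub_self, abs_zero]; positivity
    · obtain ⟨a, ha, h1, h2⟩ := hsame 0 hn
      refine (hu a ha _ h1 _ h2).trans ?_
      refine mul_le_mul_of_nonneg_left (pow_le_pow_of_le_one hθ0 hθ1.le ?_) hB
      by_contra hlt
      rw [not_le] at hlt
      have hmem := Nat.sInf_mem (s := {n | InDistinct α (F^[n] _) (F^[n] _)})
        (h.separates _ _ hne)
      obtain ⟨a', ha', h1', h2'⟩ := hsame _ hlt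
      exact hmem a' ha' h1' h2'

variable {φ : Y → ℕ} (hφ : IsReturnTime α φ) {β K : ℝ} (hβ : 1 < β)
  (htl : Maj (returnTail μ φ) (K • powSeries β)) (haper : ∀ d : ℕ, (∀ y, d ∣ φ y) → d = 1)

include hφ hβ htl haper

/-- One step of `F` turns `p` into a regular density of the same mass, to which loss of memory along
the tower applies. -/
theorem exists_abs_integral_mul_comp_sub_le_of_inCone (G : Regeneration μ F α) : ∃ C : ℝ, 0 < C ∧
    ∀ p w b, Measurable p → (∀ y, 0 ≤ p y) → Integrable p μ →
      (∀ a ∈ α, InCone F α G.θ G.L a fun y => ENNReal.ofReal (p y)) →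
      IsTowerObservable F φ w b → ∀ n,
      |∫ y, p y * w n (F y) ∂μ - (∫ y, p y ∂μ) * coeff n (towerSeries μ (fun _ => 1) w)| ≤
        C * (∫ y, p y ∂μ) * b * powSeq β n := by
  obtain ⟨C, hC, H⟩ := h.exists_maj_towerSeries_sub hφ htl hβ haper G
  refine ⟨C, hC, fun p w b hpm hp0 hpi hpc hw n => ?_⟩
  have hF : Measurable F := h.ergodic.measurable
  have hgm : Measurable fun y => ENNReal.ofReal (p y) := hpm.ennreal_ofReal
  have hg : ∫⁻ y, ENNReal.ofReal (p y) ∂μ = ENNReal.ofReal (∫ y, p y ∂μ) :=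
    (ofReal_integral_eq_lintegral_ofReal hpi (ae_of_all _ hp0)).symm
  have hgf : ∫⁻ y, ENNReal.ofReal (p y) ∂μ ≠ ∞ := by rw [hg]; exact ENNReal.ofReal_ne_top
  have h1 : ∫ y, p y * w n (F y) ∂μ =
      coeff n (towerSeries μ (pushDensity G fun y => ENNReal.ofReal (p y)) w) := by
    rw [integral_eq_lintegral_of_nonneg_ae (ae_of_all _ fun y => mul_nonneg (hp0 y) (hw.nonneg n _))
      (hpm.mul ((hw.measurable n).comp hF)).aestronglyMeasurable, towerSeries, coeff_mk,
      h.lintegral_pushDensity_mul G hgm hpc hgf (hw.measurable n).ennreal_ofReal]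
    congr 1
    exact lintegral_congr fun y => ENNReal.ofReal_mul (hp0 y)
  have h2 : mass μ (pushDensity G fun y => ENNReal.ofReal (p y)) = ∫ y, p y ∂μ := by
    rw [mass, h.lintegral_pushDensity G hgm hpc hgf, hg,
      ENNReal.toReal_ofReal (integral_nonneg hp0)]
  have h3 := H _ w b (h.isRegular_pushDensity G hgm hpc hgf) hw n
  rw [map_sub, map_smul, smul_eq_mul, h2, map_smul, coeff_powSeries, smul_eq_mul] at h3
  rwa [h1]

/-- Decorrelation over one step of the base map for Hölder functions on a union of atoms. -/
theorem exists_abs_integral_mul_comp_sub_le {θ : ℝ} (hθ0 : 0 < θ) (hθ1 : θ < 1) : ∃ C : ℝ, 0 < C ∧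
    ∀ (u : Y → ℝ) (B : ℝ) w b (A : Set Y), 0 ≤ B → MeasurableSet A →
      (∀ a ∈ α, ∀ y ∈ a, ∀ y' ∈ a, y ∈ A → y' ∈ A) → (∀ y, |u y| ≤ B) → (∀ y, y ∉ A → u y = 0) →
      (∀ a ∈ α, ∀ y ∈ a, ∀ y' ∈ a, |u y - u y'| ≤ B * θ ^ sepTime F α y y') →
      IsTowerObservable F φ w b → ∀ n,
      |∫ y, u y * w n (F y) ∂μ - (∫ y, u y ∂μ) * coeff n (towerSeries μ (fun _ => 1) w)| ≤
        C * B * b * μ.real A * powSeq β n := by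
  have := h.isProbabilityMeasure
  obtain ⟨G, hGθ⟩ := h.exists_regeneration hθ0 hθ1
  obtain ⟨C, hC, H⟩ := h.exists_abs_integral_mul_comp_sub_le_of_inCone hφ hβ htl haper G
  have hL := G.L_pos
  refine ⟨C * (3 + 2 / G.L), by positivity, fun u B w b A hB hA hsat hu huA huh hw n => ?_⟩
  have hF : Measurable F := h.ergodic.measurable
  have hb := h.bound_nonneg hw
  have hum : Measurable u := h.measurable_of_holder hB hθ0.le hθ1 huh
  -- Adding `c` on `A` makes `u` at least `B / G.L` there, so its Hölder constant `B` becomes a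
  -- logarithmic one at most `G.L`. Supporting the constant on `A`, a union of atoms, keeps all
  -- masses of order `μ.real A`.
  set c := (1 + 1 / G.L) * B with hc
  have hc0 : 0 ≤ c := by positivity
  set q : Y → ℝ := A.indicator fun _ => c with hq
  have hqm : Measurable q := measurable_const.indicator hA
  have hq0 : ∀ y, 0 ≤ q y := fun y => Set.indicator_nonneg (fun _ _ => hc0) y
  have hqi : Integrable q μ := (integrable_const c).indicator hA
  have hui : Integrable u μ := Integrable.of_bound hum.aestronglyMeasurable B (ae_of_all _ hu)
  have hp0 : ∀ y, 0 ≤ u y + q y := fun y => by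
    by_cases hy : y ∈ A
    · rw [hq, Set.indicator_of_mem hy]
      have := (abs_le.1 (hu y)).1
      have : 0 ≤ 1 / G.L * B := by positivity
      linarith
    · rw [hq, Set.indicator_of_notMem hy, huA y hy, add_zero]
  have hqc : ∀ a ∈ α, InCone F α G.θ G.L a fun y => ENNReal.ofReal (q y) := fun a ha y hy y' hy' => by
    have : q y = q y' := by
      by_cases hyA : y ∈ A
      · rw [hq, Set.indicator_of_mem hyA, Set.indicator_of_mem (hsat a ha y hy y' hy' hyA)]
      · rw [hq, Set.indicator_of_notMem hyA,
          Set.indicator_of_notMem fun hh => hyA (hsat a ha y' hy' y hy hh)]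
    beta_reduce
    rw [this]
    exact le_mul_of_one_le_left' (one_le_ofReal_exp (mul_nonneg hL.le (pow_nonneg G.θ_pos.le _)))
  have hpc : ∀ a ∈ α, InCone F α G.θ G.L a fun y => ENNReal.ofReal (u y + q y) :=
    fun a ha y hy y' hy' => by
      rw [← ENNReal.ofReal_mul (Real.exp_pos _).le]
      refine ENNReal.ofReal_le_ofReal ?_
      by_cases hyA : y ∈ A
      · have hyA' := hsat a ha y hy y' hy' hyA
        set t := G.θ ^ sepTime F α y y'
        have ht0 : 0 ≤ t := pow_nonneg G.θ_pos.le _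
        have h1 : u y - u y' ≤ B * t := (le_abs_self _).trans ((huh a ha y hy y' hy').trans
          (mul_le_mul_of_nonneg_left (pow_le_pow_left₀ hθ0.le hGθ _) hB))
        have h2 : q y = c := by rw [hq, Set.indicator_of_mem hyA]
        have h3 : q y' = c := by rw [hq, Set.indicator_of_mem hyA']
        have h4 : 1 / G.L * B ≤ u y' + c := by
          have := (abs_le.1 (hu y')).1
          rw [hc]; linarith
        have h5 : B * t ≤ G.L * t * (u y' + c) := by
          have := mul_le_mul_of_nonneg_left h4 (show 0 ≤ G.L * t by positivity)
          have e : G.L * t * (1 / G.L * B) = B * t := by field_simp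
          linarith
        have h6 : 0 ≤ u y' + c := by rw [← h3]; exact hp0 y'
        have h7 := Real.add_one_le_exp (G.L * t)
        rw [h2, h3]
        nlinarith
      · have hyA' : y' ∉ A := fun hh => hyA (hsat a ha y' hy' y hy hh)
        rw [hq, Set.indicator_of_notMem hyA, Set.indicator_of_notMem hyA', huA y hyA, huA y' hyA']
        simp
  have hqint : ∫ y, q y ∂μ = c * μ.real A := by
    rw [hq, integral_indicator_const _ hA, smul_eq_mul, mul_comm]
  have huint : ∫ y, u y ∂μ ≤ B * μ.real A := by
    have : ∫ y, A.indicator (fun _ => B) y ∂μ = B * μ.real A := by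
      rw [integral_indicator_const _ hA, smul_eq_mul, mul_comm]
    rw [← this]
    refine integral_mono hui ((integrable_const B).indicator hA) fun y => ?_
    by_cases hy : y ∈ A
    · rw [Set.indicator_of_mem hy]; exact (le_abs_self _).trans (hu y)
    · rw [Set.indicator_of_notMem hy, huA y hy]
  have H1 := H (fun y => u y + q y) w b (hum.add hqm) hp0 (hui.add hqi) hpc hw n
  have H2 := H q w b hqm hq0 hqi hqc hw n
  have hwm : Measurable fun y => w n (F y) := (hw.measurable n).comp hF
  have hwb : ∀ᵐ y ∂μ, ‖w n (F y)‖ ≤ b := ae_of_all _ fun y => by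
    rw [Real.norm_eq_abs, abs_of_nonneg (hw.nonneg _ _)]; exact hw.le _ _
  have hi1 : Integrable (fun y => u y * w n (F y)) μ := hui.mul_bdd hwm.aestronglyMeasurable hwb
  have hi2 : Integrable (fun y => q y * w n (F y)) μ := hqi.mul_bdd hwm.aestronglyMeasurable hwb
  have e1 : ∫ y, (u y + q y) * w n (F y) ∂μ = ∫ y, u y * w n (F y) ∂μ + ∫ y, q y * w n (F y) ∂μ := by
    simp only [add_mul]
    exact integral_add hi1 hi2
  rw [e1, integral_add hui hqi] at H1
  set Ω := coeff n (towerSeries μ (fun _ => 1) w)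
  have e2 : ∫ y, u y * w n (F y) ∂μ - (∫ y, u y ∂μ) * Ω =
      (∫ y, u y * w n (F y) ∂μ + ∫ y, q y * w n (F y) ∂μ - (∫ y, u y ∂μ + ∫ y, q y ∂μ) * Ω) -
      (∫ y, q y * w n (F y) ∂μ - (∫ y, q y ∂μ) * Ω) := by ring
  rw [e2]
  have H3 := (norm_sub_le _ _).trans (add_le_add ((Real.norm_eq_abs _).trans_le H1)
    ((Real.norm_eq_abs _).trans_le H2))
  refine (Real.norm_eq_abs _).symm.trans_le (H3.trans ?_)
  rw [hqint]
  have ha := powSeq_nonneg β n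
  have hA0 : 0 ≤ μ.real A := measureReal_nonneg
  calc _ = C * (∫ y, u y ∂μ + 2 * (c * μ.real A)) * (b * powSeq β n) := by ring
    _ ≤ C * (B * μ.real A + 2 * (c * μ.real A)) * (b * powSeq β n) := by gcongr
    _ = _ := by rw [hc]; ring

omit hβ htl haper in
theorem measurable_sum_range {f : ℕ → Y → ℝ} (hf : ∀ ℓ, Measurable fun y => if ℓ < φ y then f ℓ y else 0) :
    Measurable fun y => ∑ ℓ ∈ Finset.range (φ y), f ℓ y := by
  have h1 : Measurable fun q : ℕ × Y => ∑ ℓ ∈ Finset.range q.1, if ℓ < φ q.2 then f ℓ q.2 else 0 :=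
    measurable_from_prod_countable_right fun N =>
      Finset.measurable_fun_sum (Finset.range N) fun ℓ _ => hf ℓ
  have h2 := h1.comp ((h.measurable_returnTime hφ).prodMk measurable_id)
  convert h2 using 2 with y
  exact Finset.sum_congr rfl fun ℓ hℓ => (if_pos (Finset.mem_range.1 hℓ)).symm

omit hβ htl haper in
theorem integrable_level_sum {θ B b : ℝ} {σ : Y → ℕ} {v w : ℕ → Y → ℝ} (hθ0 : 0 ≤ θ) (hθ1 : θ < 1)
    (hv : IsTowerHolder F α φ σ θ v B) (hσ : Integrable (fun y => (σ y : ℝ)) μ)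
    (hwm : ∀ k, Measurable (w k)) (hwb : ∀ k y, |w k y| ≤ b) :
    Integrable (fun y => ∑ ℓ ∈ Finset.range (φ y), v ℓ y * w ℓ y) μ := by
  refine (hσ.const_mul (B * b)).mono' (Measurable.aestronglyMeasurable
    (h.measurable_sum_range hφ fun ℓ => ?_)) (ae_of_all _ fun y => ?_)
  · have h1 : Measurable fun y => if ℓ < φ y then v ℓ y else 0 := by
      refine h.measurable_of_holder hv.nonneg hθ0 hθ1 fun a ha y hy y' hy' => ?_
      rw [hφ.const a ha y' hy' y hy]
      split_ifs with hj
      · exact hv.holder a ha y hy y' hy' _ hj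
      · rw [sub_self, abs_zero]
        exact mul_nonneg hv.nonneg (pow_nonneg hθ0 _)
    convert h1.mul (hwm ℓ) using 2 with y
    simp only [ite_mul, zero_mul, Pi.mul_apply]
  · rw [Real.norm_eq_abs]
    have hb : 0 ≤ b := (abs_nonneg _).trans (hwb 0 y)
    calc _ ≤ ∑ ℓ ∈ Finset.range (φ y), |v ℓ y * w ℓ y| := Finset.abs_sum_le_sum_abs _ _
      _ ≤ ∑ ℓ ∈ Finset.range (φ y), |v ℓ y| * b := Finset.sum_le_sum fun ℓ _ => by
        rw [abs_mul]
        exact mul_le_mul_of_nonneg_left (hwb ℓ y) (abs_nonneg _)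
      _ = (∑ ℓ ∈ Finset.range (φ y), |v ℓ y|) * b := by rw [Finset.sum_mul]
      _ ≤ B * σ y * b := mul_le_mul_of_nonneg_right (hv.sum_abs_le y) hb
      _ = _ := by ring

omit hβ htl haper in
-- Only points with φ > n contribute, and over such a point the column sum is at most `B * b` times
-- σ.
theorem abs_integral_sub_sum_fromTop_le {θ B b : ℝ} {σ : Y → ℕ} {v w : ℕ → Y → ℝ} (hθ0 : 0 ≤ θ)
    (hθ1 : θ < 1) (hv : IsTowerHolder F α φ σ θ v B) (hσ : Integrable (fun y => (σ y : ℝ)) μ)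
    (hwm : ∀ k, Measurable (w k)) (hwb : ∀ k y, |w k y| ≤ b) (n : ℕ)
    (hint : ∀ j < n, Integrable (fromTop φ (fun ℓ y => v ℓ y * w ℓ y) j) μ) :
    |∫ y, ∑ ℓ ∈ Finset.range (φ y), v ℓ y * w ℓ y ∂μ -
      ∑ j ∈ Finset.range n, ∫ y, fromTop φ (fun ℓ y => v ℓ y * w ℓ y) j y ∂μ| ≤
      B * b * tailMean μ φ σ n := by
  have hset : MeasurableSet {y | n < φ y} :=
    measurableSet_lt measurable_const (h.measurable_returnTime hφ)
  rw [← integral_finsetSum _ fun j hj => hint j (Finset.mem_range.1 hj), ← integral_sub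
    (h.integrable_level_sum hφ hθ0 hθ1 hv hσ hwm hwb)
    (integrable_finsetSum _ fun j hj => hint j (Finset.mem_range.1 hj)), tailMean,
    ← integral_const_mul, ← Real.norm_eq_abs]
  refine norm_integral_le_of_norm_le ((hσ.indicator hset).const_mul _) (ae_of_all _ fun y => ?_)
  have hb : 0 ≤ b := (abs_nonneg _).trans (hwb 0 y)
  refine (abs_sum_sub_sum_fromTop_le (fun ℓ => v ℓ y * w ℓ y) (φ y) n).trans ?_
  rw [Set.indicator_apply]
  simp only [Set.mem_ofPred_eq]
  split_ifs with hn
  · calc _ ≤ ∑ ℓ ∈ Finset.range (φ y), |v ℓ y| * b := Finset.sum_le_sum fun ℓ _ => by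
          rw [abs_mul]
          exact mul_le_mul_of_nonneg_left (hwb ℓ y) (abs_nonneg _)
      _ = (∑ ℓ ∈ Finset.range (φ y), |v ℓ y|) * b := by rw [Finset.sum_mul]
      _ ≤ B * σ y * b := mul_le_mul_of_nonneg_right (hv.sum_abs_le y) hb
      _ = _ := by ring
  · simp

/-- Decay of correlations on the tower. -/
theorem exists_abs_towerCorr_sub_le {θ : ℝ} (hθ0 : 0 < θ) (hθ1 : θ < 1) {σ : Y → ℕ}
    (hσ1 : ∀ y, 1 ≤ σ y) (hσ : Integrable (fun y => (σ y : ℝ)) μ) : ∃ C : ℝ, 0 < C ∧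
    ∀ v B w b, IsTowerHolder F α φ σ θ v B → IsTowerObservable F φ w b → ∀ n,
      |∫ y, ∑ ℓ ∈ Finset.range (φ y), v ℓ y * w (n + ℓ) y ∂μ -
        (∫ y, ∑ ℓ ∈ Finset.range (φ y), v ℓ y ∂μ) * coeff n (towerSeries μ (fun _ => 1) w)| ≤
        C * B * b * conv (powSeq β) (tailMean μ φ σ) n := by
  have := h.isProbabilityMeasure
  have hφm := h.measurable_returnTime hφ
  have hK : 0 ≤ K := by simpa [powSeq_zero] using htl.nonneg 0
  have hβ0 : 0 ≤ β := by linarith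
  obtain ⟨C₁, hC₁, h₁⟩ := h.exists_abs_integral_mul_comp_sub_le hφ hβ htl haper hθ0 hθ1
  obtain ⟨C₂, hC₂, h₂⟩ := h.exists_maj_one_sub_X_mul_towerSeries hφ htl hβ haper
  obtain ⟨C₃, hC₃, h₃⟩ := exists_maj_powSeries_mul_self hβ
  have hset : ∀ n, MeasurableSet {y | n < φ y} := fun n => measurableSet_lt measurable_const hφm
  have hτ0 := tailMean_nonneg μ φ σ
  have hτ1 := one_le_tailMean_zero hφ.pos hσ1 hσ
  set S : PowerSeries ℝ := PowerSeries.mk (tailMean μ φ σ) with hS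
  have hconv : ∀ n, coeff n (powSeries β * S) = conv (powSeq β) (tailMean μ φ σ) n := fun n => by
    rw [coeff_mul, Finset.Nat.sum_antidiagonal_eq_sum_range_succ
      (fun i j => coeff i (powSeries β) * coeff j S), conv]
    simp [hS]
  have hconv_ge := powSeq_le_conv (β := β) hτ0 hτ1
  have hconv_ge' : ∀ n, tailMean μ φ σ n ≤ conv (powSeq β) (tailMean μ φ σ) n := fun n => by
    have h1 := Finset.single_le_sum (s := Finset.range (n + 1))
      (f := fun j => powSeq β j * tailMean μ φ σ (n - j))
      (fun j _ => mul_nonneg (powSeq_nonneg β j) (hτ0 _)) (Finset.mem_range.2 n.succ_pos)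
    simpa [powSeq_zero, conv] using h1
  refine ⟨C₁ * (K * C₃ * 2 ^ β) + C₂ + 1, by positivity, fun v B w b hv hw n => ?_⟩
  have hB := hv.nonneg
  have hb := h.bound_nonneg hw
  have hwb : ∀ k y, |w k y| ≤ b := fun k y => by rw [abs_of_nonneg (hw.nonneg k y)]; exact hw.le k y
  have hvh := hφ.holder_fromTop hθ0.le hv
  have hvm : ∀ j, Measurable (fromTop φ v j) := fun j =>
    h.measurable_of_holder hB hθ0.le hθ1 (hvh j)
  have hvB : ∀ j y, |fromTop φ v j y| ≤ B := fun j y => by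
    rw [fromTop]
    split_ifs with hj
    · exact hv.abs_le y _ (by omega)
    · rwa [abs_zero]
  have hvi : ∀ j, Integrable (fromTop φ v j) μ := fun j =>
    Integrable.of_bound (hvm j).aestronglyMeasurable B (ae_of_all _ (hvB j))
  have hF : Measurable F := h.ergodic.measurable
  set Ω := towerSeries μ (fun _ => 1) w with hΩ
  set s₀ := ∫ y, ∑ ℓ ∈ Finset.range (φ y), v ℓ y ∂μ with hs₀
  set V : PowerSeries ℝ := PowerSeries.mk fun j => ∫ y, fromTop φ v j y ∂μ with hV
  -- the tails of `X * V`
  set s := s₀ • geomSeries - geomSeries * (X * V) with hs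
  have hXV : X * V = PowerSeries.C s₀ - (1 - X) * s := by
    rw [hs, smul_eq_C_mul]
    linear_combination (PowerSeries.C s₀ - X * V) * geomSeries_mul
  have hsB : Maj s (B • S) := fun n => by
    have h1 : coeff n (geomSeries * (X * V)) =
        ∑ j ∈ Finset.range n, ∫ y, fromTop φ v j y ∂μ := by
      rw [coeff_geomSeries_mul, Finset.sum_range_succ']
      simp [coeff_succ_X_mul, hV]
    have h2 := h.abs_integral_sub_sum_fromTop_le hφ hθ0.le hθ1 hv hσ (w := fun _ _ => 1) (b := 1)
      (fun _ => measurable_const) (fun _ _ => by simp) n (fun j _ => by simpa using hvi j)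
    simp only [mul_one] at h2
    rw [hs, map_sub, map_smul, coeff_geomSeries, smul_eq_mul, mul_one, h1, map_smul, smul_eq_mul,
      hS, coeff_mk]
    exact h2
  -- the part which returns to the base before time `n`
  have hcomp : ∀ j < n, ∀ y, fromTop φ (fun ℓ y => v ℓ y * w (n + ℓ) y) j y =
      fromTop φ v j y * w (n - 1 - j) (F y) := fun j hj y => by
    rw [fromTop, fromTop]
    split_ifs with hjy
    · rw [← hw.cocycle]
      congr 2
      omega
    · rw [zero_mul]
  have hret : |∑ j ∈ Finset.range n, ∫ y, fromTop φ v j y * w (n - 1 - j) (F y) ∂μ -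
      coeff n (X * V * Ω)| ≤ C₁ * (K * C₃ * 2 ^ β) * B * b * powSeq β n := by
    rcases n with _ | n
    · have := powSeq_nonneg β 0
      rw [mul_assoc, coeff_zero_X_mul, Finset.range_zero, Finset.sum_empty, sub_self, abs_zero]
      positivity
    · rw [mul_assoc, coeff_succ_X_mul, coeff_mul,
        Finset.Nat.sum_antidiagonal_eq_sum_range_succ (fun i j => coeff i V * coeff j Ω),
        ← Finset.sum_sub_distrib]
      calc _ ≤ ∑ j ∈ Finset.range (n + 1), C₁ * B * b * K *
            (coeff j (powSeries β) * coeff (n - j) (powSeries β)) := by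
            refine (Finset.abs_sum_le_sum_abs _ _).trans (Finset.sum_le_sum fun j _ => ?_)
            -- The level `j + 1` steps below the base lives over φ > j; the measure of this set is
            -- the first factor of the convolution, and decorrelation over the remaining time is the
            -- second.
            have h1 := h₁ (fromTop φ v j) B w b {y | j < φ y} hB (hset j)
              (fun a ha y hy y' hy' hyA => by
                change j < φ y'
                rw [hφ.const a ha y' hy' y hy]
                exact hyA) (hvB j) (fun y hy => if_neg hy) (hvh j) hw (n - j)
            have h2 := (le_abs_self _).trans (htl j)
            rw [map_smul, smul_eq_mul, coeff_returnTail] at h2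
            simp only [hV, coeff_mk, Nat.add_sub_cancel]
            refine h1.trans ?_
            rw [coeff_powSeries β (n - j)]
            have ha := powSeq_nonneg β (n - j)
            calc _ ≤ C₁ * B * b * (K * coeff j (powSeries β)) * powSeq β (n - j) := by gcongr
              _ = _ := by ring
        _ = C₁ * B * b * K * coeff n (powSeries β * powSeries β) := by
            rw [← Finset.mul_sum, coeff_mul, Finset.Nat.sum_antidiagonal_eq_sum_range_succ
              (fun i j => coeff i (powSeries β) * coeff j (powSeries β))]
        _ ≤ C₁ * B * b * K * (C₃ * (2 ^ β * powSeq β (n + 1))) := by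
            have h4 := (le_abs_self _).trans (h₃ n)
            have h5 := (le_abs_self _).trans (maj_X_mul_powSeries hβ0 (n + 1))
            rw [coeff_succ_X_mul] at h5
            simp only [map_smul, coeff_powSeries, smul_eq_mul] at h4 h5
            refine mul_le_mul_of_nonneg_left (h4.trans ?_) (by positivity)
            exact mul_le_mul_of_nonneg_left h5 hC₃.le
        _ = _ := by ring
  have hlate := h.abs_integral_sub_sum_fromTop_le hφ hθ0.le hθ1 hv hσ (w := fun ℓ => w (n + ℓ))
      (b := b) (fun _ => hw.measurable _) (fun _ _ => hwb _ _) n (fun j hj => by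
        rw [funext (hcomp j hj)]
        exact (hvi j).mul_bdd (((hw.measurable _).comp hF).aestronglyMeasurable)
          (ae_of_all _ fun y => hwb _ _))
  rw [Finset.sum_congr rfl fun j hj => by rw [funext (hcomp j (Finset.mem_range.1 hj))]] at hlate
  have hmid := (hsB.smul_mul_smul (h₂ w b hw)) n
  -- Replacing the weighted sum of shifted values of `Ω` by `s₀` times its value at `n` costs the
  -- tails `s` convolved with the increments of `Ω`, which is of order γ_n.
  have e : coeff n (X * V * Ω) - s₀ * coeff n Ω = -coeff n (s * ((1 - X) * Ω)) := by
    have : X * V * Ω - s₀ • Ω = -(s * ((1 - X) * Ω)) := by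
      rw [hXV, smul_eq_C_mul]; ring
    rw [← smul_eq_mul s₀, ← map_smul, ← map_sub, this, map_neg]
  rw [mul_comm S, map_smul, smul_eq_mul, hconv, ← abs_neg, ← e] at hmid
  set I₀ := ∫ y, ∑ ℓ ∈ Finset.range (φ y), v ℓ y * w (n + ℓ) y ∂μ
  set I₁ := ∑ j ∈ Finset.range n, ∫ y, fromTop φ v j y * w (n - 1 - j) (F y) ∂μ
  set I₂ := coeff n (X * V * Ω)
  have e2 : I₀ - s₀ * coeff n Ω = (I₀ - I₁) + ((I₁ - I₂) + (I₂ - s₀ * coeff n Ω)) := by ring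
  rw [e2]
  refine (abs_add_le _ _).trans ((add_le_add hlate ((abs_add_le _ _).trans
    (add_le_add hret hmid))).trans ?_)
  have hBb : 0 ≤ B * b := by positivity
  have i1 := mul_le_mul_of_nonneg_left (hconv_ge' n) hBb
  have i2 := mul_le_mul_of_nonneg_left (hconv_ge n)
    (show 0 ≤ C₁ * (K * C₃ * 2 ^ β) * B * b by positivity)
  linarith

end IsFullBranchGibbsMarkov

end Correlation

/-! ### Elementary bounds for the rate -/

section Rate

theorem sum_rpow_le_of_lt_two {β : ℝ} (hβ : 1 < β) (hβ2 : β < 2) (n : ℕ) :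
    ∑ k ∈ Finset.range n, ((k : ℝ) + 1) ^ (1 - β) ≤ (2 - β)⁻¹ * (n : ℝ) ^ (2 - β) := by
  have hq : 0 < 2 - β := by linarith
  induction n with
  | zero => simp [Real.zero_rpow hq.ne']
  | succ n ih =>
    rw [Finset.sum_range_succ]
    have hn : (0:ℝ) < (n : ℝ) + 1 := by positivity
    -- Bernoulli's inequality
    have h1 : (1 + -(1 / ((n : ℝ) + 1))) ^ (2 - β) ≤ 1 + (2 - β) * -(1 / ((n : ℝ) + 1)) := by
      refine rpow_one_add_le_one_add_mul_self ?_ hq.le (by linarith)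
      have : 1 / ((n : ℝ) + 1) ≤ 1 := by
        rw [div_le_one hn]; linarith [n.cast_nonneg (α := ℝ)]
      linarith
    have h2 : 1 + -(1 / ((n : ℝ) + 1)) = n / (n + 1) := by field_simp; ring
    rw [h2, Real.div_rpow n.cast_nonneg hn.le, div_le_iff₀ (by positivity)] at h1
    have h3 : ((n : ℝ) + 1) ^ (2 - β) = ((n : ℝ) + 1) ^ (1 - β) * (n + 1) := by
      rw [← Real.rpow_add_one hn.ne']; congr 1; ring
    have h4 : (1 + (2 - β) * -(1 / ((n : ℝ) + 1))) * ((n : ℝ) + 1) ^ (2 - β) =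
        ((n : ℝ) + 1) ^ (2 - β) - (2 - β) * ((n : ℝ) + 1) ^ (1 - β) := by
      rw [h3]; field_simp; ring
    rw [h4] at h1
    push_cast
    refine (add_le_add_left ih _).trans ?_
    rw [← sub_nonneg]
    have e : (2 - β)⁻¹ * ((n : ℝ) + 1) ^ (2 - β) - ((2 - β)⁻¹ * (n : ℝ) ^ (2 - β) + ((n : ℝ) + 1) ^ (1 - β))
        = (2 - β)⁻¹ * (((n : ℝ) + 1) ^ (2 - β) - (2 - β) * ((n : ℝ) + 1) ^ (1 - β) - (n : ℝ) ^ (2 - β)) := by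
      field_simp; ring
    rw [e]
    exact mul_nonneg (by positivity) (by linarith)

/-- The rate of the renewal expansion in terms of `ζ_β`. -/
theorem exists_rate_le_zeta {β : ℝ} (hβ : 1 < β) : ∃ C : ℝ, 0 < C ∧ ∀ n : ℕ, 1 ≤ n →
    powSeq β n * rateWeight β n ≤ C * (powSeq β n + zeta β n) := by
  rcases lt_trichotomy β 2 with h2 | h2 | h2
  · have hq : 0 < 2 - β := by linarith
    refine ⟨1 + (2 - β)⁻¹, by positivity, fun n hn => ?_⟩
    have hn0 : (0:ℝ) < n := by exact_mod_cast hn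
    have ha := powSeq_nonneg β n
    have hz : zeta β n = powSeq β n * (n : ℝ) ^ (2 - β) := by
      rw [zeta, if_neg (by linarith), if_neg h2.ne, powSeq_of_ne (by omega), ← Real.rpow_add hn0]
      congr 1; ring
    have h1 : rateWeight β n ≤ 1 + (2 - β)⁻¹ * (n : ℝ) ^ (2 - β) :=
      add_le_add_right (sum_rpow_le_of_lt_two hβ h2 n) 1
    have h3 := mul_le_mul_of_nonneg_left h1 ha
    rw [hz]
    have h4 : 0 ≤ (n : ℝ) ^ (2 - β) := by positivity
    have h5 : 0 ≤ (2 - β)⁻¹ := by positivity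
    have h6 := mul_nonneg ha h4
    have h7 := mul_nonneg h5 ha
    nlinarith
  · subst h2
    -- The summand `powSeq 2 n` is indispensable here: `zeta 2 1 = 0`.
    refine ⟨2, by norm_num, fun n hn => ?_⟩
    have hn0 : (0:ℝ) < n := by exact_mod_cast hn
    have ha := powSeq_nonneg 2 n
    have hz : zeta 2 n = powSeq 2 n * Real.log n := by
      rw [zeta, if_neg (lt_irrefl _), if_pos rfl, powSeq_of_ne (by omega)]
    have h1 : rateWeight 2 n ≤ 2 + Real.log n := by
      have h2 := harmonic_le_one_add_log n
      have h3 : ((harmonic n : ℚ) : ℝ) = ∑ k ∈ Finset.range n, ((k : ℝ) + 1) ^ ((1:ℝ) - 2) := by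
        rw [harmonic]
        push_cast
        refine Finset.sum_congr rfl fun k _ => ?_
        rw [show (1:ℝ) - 2 = -1 by norm_num, Real.rpow_neg_one]
      rw [h3] at h2
      rw [rateWeight]
      linarith
    have h3 := mul_le_mul_of_nonneg_left h1 ha
    have h4 := mul_nonneg ha (Real.log_natCast_nonneg n)
    rw [hz]
    linarith
  · have hs : Summable fun k : ℕ => ((k : ℝ) + 1) ^ (1 - β) := by
      have := (summable_nat_add_iff 1).2 (Real.summable_nat_rpow (p := 1 - β) |>.2 (by linarith))
      simpa using this
    set T := ∑' k : ℕ, ((k : ℝ) + 1) ^ (1 - β)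
    have hT : 0 ≤ T := tsum_nonneg fun k => by positivity
    refine ⟨1 + T, by positivity, fun n hn => ?_⟩
    have ha := powSeq_nonneg β n
    have hz : 0 ≤ zeta β n := by
      rw [zeta, if_pos h2]; positivity
    have h1 : rateWeight β n ≤ 1 + T :=
      add_le_add_right (hs.sum_le_tsum _ fun k _ => by positivity) 1
    have h3 := mul_le_mul_of_nonneg_left h1 ha
    nlinarith [mul_nonneg (show 0 ≤ 1 + T by positivity) hz]

end Rate

/-! ### Second order expansion of correlations on the tower -/

section TowerExpansion

open PowerSeries

variable {Y : Type*} [MeasurableSpace Y] {F : Y → Y} {α : Set (Set Y)} {μ : Measure Y}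

namespace IsFullBranchGibbsMarkov

variable (h : IsFullBranchGibbsMarkov μ F α) {φ : Y → ℕ} (hφ : IsReturnTime α φ)

include h hφ

/-- The levels of an observable carried by few levels of the tower. -/
theorem levelPart_eq_C_sub {w : ℕ → Y → ℝ} {b : ℝ} (hw : IsTowerObservable F φ w b) {σ : Y → ℕ}
    (hσ : Integrable (fun y => (σ y : ℝ)) μ)
    (hwσ : ∀ y, ∑ k ∈ Finset.range (φ y), w k y ≤ b * σ y) :
    ∃ s : PowerSeries ℝ, (PowerSeries.mk fun k => mass μ (levelPart φ w k)) =
      PowerSeries.C (∫ y, ∑ k ∈ Finset.range (φ y), w k y ∂μ) - (1 - X) * s ∧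
      Maj s (b • PowerSeries.mk (tailMean μ φ σ)) := by
  have := h.isProbabilityMeasure
  have hφm := h.measurable_returnTime hφ
  have hset : ∀ n, MeasurableSet {y | n < φ y} := fun n => measurableSet_lt measurable_const hφm
  have hb := h.bound_nonneg hw
  set ω := ∫ y, ∑ k ∈ Finset.range (φ y), w k y ∂μ with hω
  set W := PowerSeries.mk fun k => mass μ (levelPart φ w k) with hW
  refine ⟨ω • geomSeries - geomSeries * W, ?_, fun n => ?_⟩
  · rw [smul_eq_C_mul]
    linear_combination (PowerSeries.C ω - W) * geomSeries_mul
  have hmass : ∀ k, mass μ (levelPart φ w k) = ∫ y, {y | k < φ y}.indicator (w k) y ∂μ := fun k => by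
    rw [mass, integral_eq_lintegral_of_nonneg_ae
      (ae_of_all _ fun y => Set.indicator_nonneg (fun y _ => hw.nonneg k y) y)
      ((hw.measurable k).indicator (hset k)).aestronglyMeasurable]
    congr 1
    refine lintegral_congr fun y => ?_
    rw [levelPart, Set.indicator_apply, Set.indicator_apply]
    split_ifs <;> simp
  have hwi : ∀ k, Integrable ({y | k < φ y}.indicator (w k)) μ := fun k =>
    (Integrable.of_bound (hw.measurable k).aestronglyMeasurable b (ae_of_all _ fun y => by
      rw [Real.norm_eq_abs, abs_of_nonneg (hw.nonneg k y)]; exact hw.le k y)).indicator (hset k)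
  have hsi : Integrable (fun y => ∑ k ∈ Finset.range (φ y), w k y) μ := by
    refine (hσ.const_mul b).mono' (h.measurable_sum_range hφ fun ℓ => ?_).aestronglyMeasurable
      (ae_of_all _ fun y => ?_)
    · exact Measurable.ite (hset ℓ) (hw.measurable ℓ) measurable_const
    · rw [Real.norm_eq_abs, abs_of_nonneg (Finset.sum_nonneg fun k _ => hw.nonneg k y)]
      exact hwσ y
  rw [map_sub, map_smul, coeff_geomSeries, coeff_geomSeries_mul, smul_eq_mul, mul_one]
  simp only [hW, coeff_mk, hmass]
  rw [hω, ← integral_finsetSum _ fun k _ => hwi k,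
    ← integral_sub hsi (integrable_finsetSum _ fun k _ => hwi k), map_smul, coeff_mk, smul_eq_mul,
    tailMean, ← integral_const_mul, ← Real.norm_eq_abs]
  refine norm_integral_le_of_norm_le ((hσ.indicator (hset n)).const_mul _) (ae_of_all _ fun y => ?_)
  have h1 : ∑ k ∈ Finset.range (n + 1), {y | k < φ y}.indicator (w k) y =
      ∑ k ∈ Finset.range (n + 1), if k < φ y then w k y else 0 :=
    Finset.sum_congr rfl fun k _ => by rw [Set.indicator_apply]; rfl
  rw [h1, Set.indicator_apply]
  simp only [Set.mem_ofPred_eq]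
  split_ifs with hn
  · rw [← Finset.sum_range_add_sum_Ico _ (show n + 1 ≤ φ y from hn), Finset.sum_congr rfl
      (fun k hk => if_pos (show k < φ y by have := Finset.mem_range.1 hk; omega)),
      add_sub_cancel_left, Real.norm_eq_abs,
      abs_of_nonneg (Finset.sum_nonneg fun k _ => hw.nonneg k y)]
    refine le_trans ?_ (hwσ y)
    rw [← Finset.sum_range_add_sum_Ico _ (show n + 1 ≤ φ y from hn)]
    exact le_add_of_nonneg_left (Finset.sum_nonneg fun k _ => hw.nonneg k y)
  · rw [← Finset.sum_range_add_sum_Ico _ (show φ y ≤ n + 1 by omega),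
      Finset.sum_eq_zero (s := Finset.Ico _ _), add_zero,
      Finset.sum_congr rfl (fun k hk => if_pos (Finset.mem_range.1 hk)), sub_self]
    · simp
    · exact fun k hk => if_neg (by have := (Finset.mem_Ico.1 hk).1; omega)

/-- The asymptotic expansion of correlations on the tower. -/
theorem exists_abs_towerCorr_expansion_le {β K : ℝ} (hβ : 1 < β)
    (htl : Maj (returnTail μ φ) (K • powSeries β)) (haper : ∀ d : ℕ, (∀ y, d ∣ φ y) → d = 1)
    {θ : ℝ} (hθ0 : 0 < θ) (hθ1 : θ < 1) {σ : Y → ℕ}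
    (hσ1 : ∀ y, 1 ≤ σ y) (hσ : Integrable (fun y => (σ y : ℝ)) μ) {m : ℝ}
    (hm : HasSum (fun n => coeff n (returnTail μ φ)) m) : ∃ C : ℝ, 0 < C ∧
    ∀ v B w b, IsTowerHolder F α φ σ θ v B → IsTowerObservable F φ w b →
      (∀ y, ∑ k ∈ Finset.range (φ y), w k y ≤ b * σ y) → ∀ n,
      |m⁻¹ * ∫ y, ∑ ℓ ∈ Finset.range (φ y), v ℓ y * w (n + ℓ) y ∂μ -
        (m⁻¹ * ∫ y, ∑ ℓ ∈ Finset.range (φ y), v ℓ y ∂μ) *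
        (m⁻¹ * ∫ y, ∑ k ∈ Finset.range (φ y), w k y ∂μ) *
        (1 + m⁻¹ * coeff n (tailSum (returnTail μ φ)))| ≤
        C * B * b * (conv (powSeq β) (tailMean μ φ σ) n + coeff n (rateSeries β)) := by
  have := h.isProbabilityMeasure
  have hm1 := h.one_le_of_hasSum_returnTail hφ hm
  have hm0 : 0 < m := by linarith
  obtain ⟨C₁, hC₁, h₁⟩ := h.exists_abs_towerCorr_sub_le hφ hβ htl haper hθ0 hθ1 hσ1 hσ
  obtain ⟨C₂, hC₂, h₂⟩ := h.exists_maj_towerSeries_expansion hφ htl hβ haper hm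
  have hτ0 := tailMean_nonneg μ φ σ
  set S : PowerSeries ℝ := PowerSeries.mk (tailMean μ φ σ) with hS
  have hS0 : ∀ n, 0 ≤ coeff n S := fun n => by rw [hS, coeff_mk]; exact hτ0 n
  have hconv : ∀ n, coeff n (powSeries β * S) = conv (powSeq β) (tailMean μ φ σ) n := fun n => by
    rw [coeff_mul, Finset.Nat.sum_antidiagonal_eq_sum_range_succ
      (fun i j => coeff i (powSeries β) * coeff j S), conv]
    simp [hS]
  set M := ∫ y, (σ y : ℝ) ∂μ with hM
  have hM0 : 0 ≤ M := integral_nonneg fun y => Nat.cast_nonneg _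
  refine ⟨C₁ + M * C₂, by positivity, fun v B w b hv hw hwσ n => ?_⟩
  have hB := hv.nonneg
  have hb := h.bound_nonneg hw
  obtain ⟨s, hs, hsS⟩ := h.levelPart_eq_C_sub hφ hw hσ hwσ
  set ω₀ := ∫ y, ∑ k ∈ Finset.range (φ y), w k y ∂μ
  set s₀ := ∫ y, ∑ ℓ ∈ Finset.range (φ y), v ℓ y ∂μ with hs₀
  set I₀ := ∫ y, ∑ ℓ ∈ Finset.range (φ y), v ℓ y * w (n + ℓ) y ∂μ
  have i1 := h₁ v B w b hv hw n
  have hmω : m * (m⁻¹ * ω₀) = ω₀ := mul_inv_cancel_left₀ hm0.ne' _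
  have i2 := h₂ w b (m⁻¹ * ω₀) s hw (by rw [hmω]; exact hs) S hS0 hsS n
  simp only [map_sub, map_add, map_smul, smul_eq_mul, coeff_geomSeries, mul_one, hconv] at i2
  set Ω := coeff n (towerSeries μ (fun _ => 1) w)
  set T := coeff n (tailSum (returnTail μ φ))
  have hs₀le : |s₀| ≤ B * M := by
    rw [hs₀, hM, ← integral_const_mul, ← Real.norm_eq_abs]
    refine norm_integral_le_of_norm_le (hσ.const_mul B) (ae_of_all _ fun y => ?_)
    exact (Finset.abs_sum_le_sum_abs _ _).trans (hv.sum_abs_le y)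
  -- Decorrelation first, then the expansion of `Ω` multiplied by `s₀`.
  have e : m⁻¹ * I₀ - m⁻¹ * s₀ * (m⁻¹ * ω₀) * (1 + m⁻¹ * T) =
      m⁻¹ * ((I₀ - s₀ * Ω) + s₀ * (Ω - (m⁻¹ * ω₀ + m⁻¹ * ω₀ * m⁻¹ * T))) := by ring
  have hm2 : m⁻¹ ≤ 1 := inv_le_one_of_one_le₀ hm1
  have hm3 : 0 ≤ m⁻¹ := by positivity
  have hc : 0 ≤ conv (powSeq β) (tailMean μ φ σ) n := by
    rw [← hconv, coeff_mul]
    exact Finset.sum_nonneg fun p _ => mul_nonneg (coeff_powSeries_nonneg β _) (hS0 _)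
  have hr := coeff_rateSeries_nonneg β n
  set c := conv (powSeq β) (tailMean μ φ σ) n
  set r := coeff n (rateSeries β)
  rw [e, abs_mul, abs_of_nonneg hm3]
  refine (mul_le_of_le_one_left (abs_nonneg _) hm2).trans ((abs_add_le _ _).trans ?_)
  have i3 : |s₀ * (Ω - (m⁻¹ * ω₀ + m⁻¹ * ω₀ * m⁻¹ * T))| ≤ B * M * (C₂ * b * (c + r)) := by
    rw [abs_mul]
    exact mul_le_mul hs₀le i2 (abs_nonneg _) (by positivity)
  have i4 : 0 ≤ C₁ * B * b * r := by positivity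
  linarith

end IsFullBranchGibbsMarkov

end TowerExpansion

/-! ### The phase space as a projection of the tower -/

section Projection

variable {M Y : Type*} [MeasurableSpace M] [MeasurableSpace Y]

/-- If `A` is invariant under `f^[d]`, mixing along multiples of `d` gives μ(A) = μ(A)². -/
theorem IsMixing.ergodic_iterate {f : M → M} {μ : Measure M} [IsProbabilityMeasure μ]
    (hmix : IsMixing f μ) (hf : MeasurePreserving f μ μ) {d : ℕ} (hd : 1 ≤ d) :
    Ergodic f^[d] μ := by
  refine ⟨hf.iterate d, ⟨fun A hA hinv => ?_⟩⟩
  have h1 : ∀ n, f^[d * n] ⁻¹' A = A := fun n => by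
    rw [Function.iterate_mul]
    induction n with
    | zero => rfl
    | succ n ih => rw [Function.iterate_succ, Set.preimage_comp, ih, hinv]
  have h2 : Tendsto (fun n : ℕ => μ (A ∩ f^[d * n] ⁻¹' A)) atTop (𝓝 (μ A * μ A)) :=
    (hmix A A hA hA).comp (tendsto_id.const_mul_atTop' (by omega))
  simp only [h1, Set.inter_self] at h2
  have h3 : μ A = μ A * μ A := tendsto_nhds_unique tendsto_const_nhds h2
  rw [eventuallyConst_set]
  rcases eq_or_ne (μ A) 0 with h0 | h0
  · exact Or.inr (measure_eq_zero_iff_ae_notMem.1 h0)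
  · refine Or.inl ((prob_compl_eq_zero_iff hA).2 ?_)
    exact (ENNReal.mul_eq_left h0 (measure_ne_top μ A)).1 h3.symm

variable {T : M → M} {μ : Measure M} [IsProbabilityMeasure μ] {ι : Y → M} {F : Y → Y}
  {μY : Measure Y} [IsProbabilityMeasure μY] {φ : Y → ℕ}

/-- An ergodic measure is the projection of the tower measure. -/
theorem lintegral_eq_lintegral_sum_tower (hT : Ergodic T μ) (hι : Measurable ι)
    (hac : μY.map ι ≪ μ) (hF : MeasurePreserving F μY μY) (hφm : Measurable φ)
    (hpos : ∀ y, 1 ≤ φ y) (hφi : Integrable (fun y => (φ y : ℝ)) μY)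
    (hret : ∀ y, ι (F y) = T^[φ y] (ι y)) {u : M → ℝ≥0∞} (hu : Measurable u) :
    ∫⁻ x, u x ∂μ = (∫⁻ y, φ y ∂μY)⁻¹ *
      ∫⁻ y, ∑ ℓ ∈ Finset.range (φ y), u (T^[ℓ] (ι y)) ∂μY := by
  have hTm : Measurable T := hT.measurable
  have hset : ∀ ℓ, MeasurableSet {y | ℓ < φ y} := fun ℓ => measurableSet_lt measurable_const hφm
  have hTι : ∀ ℓ, Measurable fun y => T^[ℓ] (ι y) := fun ℓ => (hTm.iterate ℓ).comp hι
  have htsum : ∀ (g : ℕ → ℝ≥0∞) (N : ℕ), ∑ ℓ ∈ Finset.range N, g ℓ =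
      ∑' ℓ, if ℓ < N then g ℓ else 0 := fun g N => by
    rw [tsum_eq_sum (s := Finset.range N) fun ℓ hℓ => if_neg (by simpa using hℓ)]
    exact Finset.sum_congr rfl fun ℓ hℓ => (if_pos (Finset.mem_range.1 hℓ)).symm
  -- The unnormalised projection of the tower measure. It is `T`-invariant and absolutely continuous
  -- with respect to μ, so after normalisation it equals μ by ergodicity.
  set ν₀ : Measure M := Measure.sum fun ℓ =>
    (μY.restrict {y | ℓ < φ y}).map fun y => T^[ℓ] (ι y) with hν₀
  have hint : ∀ g : M → ℝ≥0∞, Measurable g →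
      ∫⁻ x, g x ∂ν₀ = ∫⁻ y, ∑ ℓ ∈ Finset.range (φ y), g (T^[ℓ] (ι y)) ∂μY := fun g hg => by
    rw [hν₀, lintegral_sum_measure]
    simp only [htsum]
    rw [lintegral_tsum (f := fun ℓ y => if ℓ < φ y then g (T^[ℓ] (ι y)) else 0) fun ℓ =>
      (Measurable.ite (hset ℓ) (hg.comp (hTι ℓ)) measurable_const).aemeasurable]
    refine tsum_congr fun ℓ => ?_
    rw [lintegral_map hg (hTι ℓ), ← lintegral_indicator (hset ℓ)]
    exact lintegral_congr fun y => by rw [Set.indicator_apply]; rfl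
  have huniv : ν₀ Set.univ = ∫⁻ y, φ y ∂μY := by
    have := hint (fun _ => 1) measurable_const
    simpa using this
  have h0 : ∫⁻ y, (φ y : ℝ≥0∞) ∂μY ≠ 0 := by
    have : (1 : ℝ≥0∞) ≤ ∫⁻ y, (φ y : ℝ≥0∞) ∂μY := by
      have h1 : ∫⁻ _, (1 : ℝ≥0∞) ∂μY = 1 := by simp
      rw [← h1]
      exact lintegral_mono fun y => Nat.one_le_cast.2 (hpos y)
    exact (zero_lt_one.trans_le this).ne'
  have hfin : ∫⁻ y, (φ y : ℝ≥0∞) ∂μY ≠ ∞ := by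
    have := hφi.lintegral_lt_top.ne
    simpa using this
  set ν := (∫⁻ y, (φ y : ℝ≥0∞) ∂μY)⁻¹ • ν₀ with hν
  have hνp : IsProbabilityMeasure ν := ⟨by
    rw [hν, Measure.smul_apply, huniv, smul_eq_mul, ENNReal.inv_mul_cancel h0 hfin]⟩
  have hνμ : ν ≪ μ := by
    refine Measure.AbsolutelyContinuous.smul_left ?_ _
    refine Measure.absolutelyContinuous_sum_left fun ℓ => ?_
    have h1 : (μY.restrict {y | ℓ < φ y}).map (fun y => T^[ℓ] (ι y)) ≪ (μY.map ι).map T^[ℓ] := by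
      rw [Measure.map_map (hTm.iterate ℓ) hι]
      exact Measure.restrict_le_self.absolutelyContinuous.map (hTι ℓ)
    have h2 := hac.map (hTm.iterate ℓ)
    rw [(hT.toMeasurePreserving.iterate ℓ).map_eq] at h2
    exact h1.trans h2
  have hinv : ν₀.map T = ν₀ := by
    ext E hE
    set g : M → ℝ≥0∞ := E.indicator fun _ => 1 with hg
    have hgm : Measurable g := measurable_const.indicator hE
    have e1 : ν₀.map T E = ∫⁻ x, g (T x) ∂ν₀ := by
      rw [← lintegral_map hgm hTm, hg, lintegral_indicator_const hE, one_mul]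
    have e2 : ν₀ E = ∫⁻ x, g x ∂ν₀ := by rw [hg, lintegral_indicator_const hE, one_mul]
    rw [e1, e2, hint (fun x => g (T x)) (hgm.comp hTm), hint _ hgm]
    have hf1 : ∫⁻ y, g (ι y) ∂μY ≠ ∞ := by
      refine ne_top_of_le_ne_top ENNReal.one_ne_top ?_
      have h1 : ∫⁻ _, (1 : ℝ≥0∞) ∂μY = 1 := by simp
      rw [← h1]
      exact lintegral_mono fun y => Set.indicator_le_self' (fun _ _ => zero_le) _
    -- Applying `T` shifts the column sum by one level. With the bottom level added on the left and
    -- the top exit on the right both sums agree, and the two additions have equal integrals because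
    -- `F` preserves `μY`.
    refine (ENNReal.add_left_inj hf1).1 ?_
    have hgι : Measurable fun y => g (ι y) := hgm.comp hι
    have hgιF : Measurable fun y => g (ι (F y)) := hgι.comp hF.measurable
    rw [← lintegral_add_right _ hgι]
    have e3 : ∫⁻ y, g (ι y) ∂μY = ∫⁻ y, g (ι (F y)) ∂μY :=
      (hF.lintegral_comp hgι).symm
    conv_rhs => rw [e3, ← lintegral_add_right _ hgιF]
    refine lintegral_congr fun y => ?_
    have e4 : ∀ ℓ, T (T^[ℓ] (ι y)) = T^[ℓ + 1] (ι y) := fun ℓ =>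
      (Function.iterate_succ_apply' T ℓ (ι y)).symm
    simp only [e4, hret]
    rw [← Finset.sum_range_succ (fun ℓ => g (T^[ℓ] (ι y))), Finset.sum_range_succ']
    rfl
  have hνT : MeasurePreserving T ν ν := ⟨hTm, by rw [hν, Measure.map_smul, hinv]⟩
  have key := hT.eq_of_absolutelyContinuous hνT hνμ
  rw [← hint u hu, ← smul_eq_mul, ← lintegral_smul_measure, ← hν, key]

theorem integral_eq_integral_sum_tower_of_nonneg (hT : Ergodic T μ) (hι : Measurable ι)
    (hac : μY.map ι ≪ μ) (hF : MeasurePreserving F μY μY) (hφm : Measurable φ)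
    (hpos : ∀ y, 1 ≤ φ y) (hφi : Integrable (fun y => (φ y : ℝ)) μY)
    (hret : ∀ y, ι (F y) = T^[φ y] (ι y)) {u : M → ℝ} (hu : Measurable u) (hu0 : ∀ x, 0 ≤ u x) :
    ∫ x, u x ∂μ = (∫ y, (φ y : ℝ) ∂μY)⁻¹ *
      ∫ y, ∑ ℓ ∈ Finset.range (φ y), u (T^[ℓ] (ι y)) ∂μY := by
  have hTm : Measurable T := hT.measurable
  have hm : Measurable fun y => ∑ ℓ ∈ Finset.range (φ y), u (T^[ℓ] (ι y)) := by
    have h1 : Measurable fun q : ℕ × Y => ∑ ℓ ∈ Finset.range q.1, u (T^[ℓ] (ι q.2)) :=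
      measurable_from_prod_countable_right fun N =>
        Finset.measurable_fun_sum (Finset.range N) fun ℓ _ => hu.comp ((hTm.iterate ℓ).comp hι)
    exact h1.comp (hφm.prodMk measurable_id)
  have h1 := lintegral_eq_lintegral_sum_tower hT hι hac hF hφm hpos hφi hret hu.ennreal_ofReal
  rw [integral_eq_lintegral_of_nonneg_ae (ae_of_all _ hu0) hu.aestronglyMeasurable, h1,
    ENNReal.toReal_mul, ENNReal.toReal_inv, integral_eq_lintegral_of_nonneg_ae
      (ae_of_all _ fun y => Nat.cast_nonneg _) hφi.1, integral_eq_lintegral_of_nonneg_ae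
      (ae_of_all _ fun y => Finset.sum_nonneg fun ℓ _ => hu0 _) hm.aestronglyMeasurable]
  simp only [ENNReal.ofReal_natCast]
  congr 2
  exact lintegral_congr fun y => (ENNReal.ofReal_sum_of_nonneg fun ℓ _ => hu0 _).symm

/-- Integrals over the phase space as integrals over the tower. -/
theorem integral_eq_integral_sum_tower (hT : Ergodic T μ) (hι : Measurable ι)
    (hac : μY.map ι ≪ μ) (hF : MeasurePreserving F μY μY) (hφm : Measurable φ)
    (hpos : ∀ y, 1 ≤ φ y) (hφi : Integrable (fun y => (φ y : ℝ)) μY)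
    (hret : ∀ y, ι (F y) = T^[φ y] (ι y)) {u : M → ℝ} (hu : AEStronglyMeasurable u μ) {c : ℝ}
    (hc : ∀ᵐ x ∂μ, |u x| ≤ c) :
    ∫ x, u x ∂μ = (∫ y, (φ y : ℝ) ∂μY)⁻¹ *
      ∫ y, ∑ ℓ ∈ Finset.range (φ y), u (T^[ℓ] (ι y)) ∂μY := by
  have hTm : Measurable T := hT.measurable
  -- A measurable version of `u + c`, truncated so as to be nonnegative and bounded everywhere.
  set g : M → ℝ := fun x => max 0 (min (2 * c) (hu.mk u x + c)) with hg
  have hgm : Measurable g := measurable_const.max (measurable_const.min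
    (hu.stronglyMeasurable_mk.measurable.add measurable_const))
  have hg0 : ∀ x, 0 ≤ g x := fun x => le_max_left _ _
  have hc0 : 0 ≤ c := by
    obtain ⟨x, hx⟩ := hc.exists
    exact (abs_nonneg _).trans hx
  have hgc : ∀ x, g x ≤ 2 * c := fun x => max_le (by positivity) (min_le_left _ _)
  have hug : ∀ᵐ x ∂μ, u x = g x - c := by
    filter_upwards [hc, hu.ae_eq_mk] with x hx hx'
    rw [hg]
    beta_reduce
    rw [← hx']
    have := abs_le.1 hx
    rw [min_eq_right (by linarith), max_eq_right (by linarith)]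
    ring
  have hY : ∀ᵐ y ∂μY, ∀ ℓ, u (T^[ℓ] (ι y)) = g (T^[ℓ] (ι y)) - c := by
    rw [ae_all_iff]
    intro ℓ
    have h1 : ∀ᵐ x ∂μ, u (T^[ℓ] x) = g (T^[ℓ] x) - c :=
      (hT.toMeasurePreserving.iterate ℓ).quasiMeasurePreserving.ae hug
    exact ae_of_ae_map hι.aemeasurable (hac.ae_le h1)
  have hm : Measurable fun y => ∑ ℓ ∈ Finset.range (φ y), g (T^[ℓ] (ι y)) := by
    have h1 : Measurable fun q : ℕ × Y => ∑ ℓ ∈ Finset.range q.1, g (T^[ℓ] (ι q.2)) :=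
      measurable_from_prod_countable_right fun N =>
        Finset.measurable_fun_sum (Finset.range N) fun ℓ _ => hgm.comp ((hTm.iterate ℓ).comp hι)
    exact h1.comp (hφm.prodMk measurable_id)
  have hgi : Integrable (fun y => ∑ ℓ ∈ Finset.range (φ y), g (T^[ℓ] (ι y))) μY := by
    refine (hφi.mul_const (2 * c)).mono' hm.aestronglyMeasurable (ae_of_all _ fun y => ?_)
    rw [Real.norm_eq_abs, abs_of_nonneg (Finset.sum_nonneg fun ℓ _ => hg0 _)]
    refine (Finset.sum_le_card_nsmul _ _ _ fun ℓ _ => hgc _).trans_eq ?_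
    simp
  have hφ0 : ∫ y, (φ y : ℝ) ∂μY ≠ 0 := by
    have h1 : ∫ _, (1 : ℝ) ∂μY = 1 := by simp
    have : (1 : ℝ) ≤ ∫ y, (φ y : ℝ) ∂μY := by
      rw [← h1]
      exact integral_mono (integrable_const _) hφi fun y => Nat.one_le_cast.2 (hpos y)
    linarith
  have h1 := integral_eq_integral_sum_tower_of_nonneg hT hι hac hF hφm hpos hφi hret hgm hg0
  have hgiM : Integrable g μ := Integrable.of_bound hgm.aestronglyMeasurable (2 * c)
    (ae_of_all _ fun x => by rw [Real.norm_eq_abs, abs_of_nonneg (hg0 x)]; exact hgc x)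
  rw [integral_congr_ae hug, integral_sub hgiM (integrable_const _), h1]
  have h2 : ∫ y, ∑ ℓ ∈ Finset.range (φ y), u (T^[ℓ] (ι y)) ∂μY =
      ∫ y, ∑ ℓ ∈ Finset.range (φ y), g (T^[ℓ] (ι y)) - φ y * c ∂μY := by
    refine integral_congr_ae ?_
    filter_upwards [hY] with y hy
    simp only [hy, Finset.sum_sub_distrib, Finset.sum_const, Finset.card_range, nsmul_eq_mul]
  rw [h2, integral_sub hgi (hφi.mul_const c), integral_mul_const, mul_sub,
    inv_mul_cancel_left₀ hφ0]
  simp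

end Projection

/-- Dividing by the greatest common divisor gives an aperiodic time. -/
theorem exists_aperiodic_div {Y : Type*} [Nonempty Y] {φ : Y → ℕ} (hpos : ∀ y, 1 ≤ φ y) :
    ∃ d : ℕ, 1 ≤ d ∧ (∀ y, d ∣ φ y) ∧ ∀ e : ℕ, (∀ y, e ∣ φ y / d) → e = 1 := by
  obtain ⟨y₀⟩ := ‹Nonempty Y›
  set D := {d : ℕ | ∀ y, d ∣ φ y}
  have hbdd : BddAbove D := ⟨φ y₀, fun d hd => Nat.le_of_dvd (hpos y₀) (hd y₀)⟩
  have hmem : sSup D ∈ D := Nat.sSup_mem ⟨1, fun y => one_dvd _⟩ hbdd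
  have h1 : 1 ≤ sSup D := le_csSup hbdd fun y => one_dvd _
  refine ⟨sSup D, h1, hmem, fun e he => ?_⟩
  have h2 : sSup D * e ∈ D := fun y => by
    obtain ⟨c, hc⟩ := he y
    refine ⟨c, ?_⟩
    rw [mul_assoc, ← hc, Nat.mul_div_cancel' (hmem y)]
  have h3 : sSup D * e ≤ sSup D * 1 := by rw [mul_one]; exact le_csSup hbdd h2
  have h4 : e ≤ 1 := Nat.le_of_mul_le_mul_left h3 h1
  have h5 : e ≠ 0 := by
    rintro rfl
    have := Nat.eq_zero_of_zero_dvd (he y₀)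
    have h6 := Nat.div_pos (Nat.le_of_dvd (hpos y₀) (hmem y₀)) h1
    omega
  omega

theorem integrable_and_hasSum_of_summable_tail {Y : Type*} [MeasurableSpace Y] {μ : Measure Y}
    [IsProbabilityMeasure μ] {φ : Y → ℕ} (hφm : Measurable φ)
    (hs : Summable fun n => μ.real {y | n < φ y}) :
    Integrable (fun y => (φ y : ℝ)) μ ∧
      HasSum (fun n => μ.real {y | n < φ y}) (∫ y, (φ y : ℝ) ∂μ) := by
  have hset : ∀ n, MeasurableSet {y | n < φ y} := fun n => measurableSet_lt measurable_const hφm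
  have hm : Measurable fun y => (φ y : ℝ) := measurable_from_top.comp hφm
  have h1 : ∫⁻ y, (φ y : ℝ≥0∞) ∂μ = ∑' n, μ {y | n < φ y} := by
    have h2 : ∀ n, μ {y | n < φ y} = ∫⁻ y, {y | n < φ y}.indicator (fun _ => 1) y ∂μ := fun n => by
      rw [lintegral_indicator_const (hset n), one_mul]
    simp only [h2]
    rw [← lintegral_tsum fun n => (measurable_const.indicator (hset n)).aemeasurable]
    refine lintegral_congr fun y => ?_
    rw [tsum_eq_sum (s := Finset.range (φ y)) fun n hn =>
      Set.indicator_of_notMem (by simpa using hn) _, Finset.sum_congr rfl fun n hn =>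
      Set.indicator_of_mem (show y ∈ {y | n < φ y} from Finset.mem_range.1 hn) _]
    simp
  have h2 : ∑' n, μ {y | n < φ y} = ENNReal.ofReal (∑' n, μ.real {y | n < φ y}) := by
    rw [ENNReal.ofReal_tsum_of_nonneg (fun n => measureReal_nonneg) hs]
    exact tsum_congr fun n => by rw [ofReal_measureReal]
  have h3 : ∫⁻ y, ENNReal.ofReal (φ y : ℝ) ∂μ = ENNReal.ofReal (∑' n, μ.real {y | n < φ y}) := by
    simp only [ENNReal.ofReal_natCast]
    rw [h1, h2]
  refine ⟨⟨hm.aestronglyMeasurable, ?_⟩, ?_⟩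
  · rw [hasFiniteIntegral_iff_ofReal (ae_of_all _ fun y => Nat.cast_nonneg _), h3]
    exact ENNReal.ofReal_lt_top
  · rw [integral_eq_lintegral_of_nonneg_ae (ae_of_all _ fun y => Nat.cast_nonneg _)
      hm.aestronglyMeasurable, h3, ENNReal.toReal_ofReal (tsum_nonneg fun n => measureReal_nonneg)]
    exact hs.hasSum

/-! ### Orbits and observables of the structure -/

namespace Structure

variable {M : Type*} [MeasurableSpace M] {f : M → M} {μ : Measure M} (S : Structure f μ)

theorem one_le_firstReturnTime {x : M} (hx : x ∈ S.X) : 1 ≤ firstReturnTime f S.X x :=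
  (Nat.sInf_mem (s := {n | 1 ≤ n ∧ f^[n] x ∈ S.X}) (S.returns x hx)).1

theorem firstReturnMap_mem {x : M} (hx : x ∈ S.X) : firstReturnMap f S.X x ∈ S.X :=
  (Nat.sInf_mem (s := {n | 1 ≤ n ∧ f^[n] x ∈ S.X}) (S.returns x hx)).2

theorem iterate_notMem {x : M} {k : ℕ} (hk : 1 ≤ k) (hk' : k < firstReturnTime f S.X x) :
    f^[k] x ∉ S.X := fun hh =>
  Nat.notMem_of_lt_sInf (s := {n | 1 ≤ n ∧ f^[n] x ∈ S.X}) hk' ⟨hk, hh⟩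

/-- The time of the `ℓ`-th return to `X`. -/
def visitTime (f : M → M) (X : Set M) (x : M) (ℓ : ℕ) : ℕ :=
  ∑ i ∈ Finset.range ℓ, firstReturnTime f X ((firstReturnMap f X)^[i] x)

theorem iterate_firstReturnMap {x : M} (hx : x ∈ S.X) (ℓ : ℕ) :
    (firstReturnMap f S.X)^[ℓ] x = f^[visitTime f S.X x ℓ] x ∧
      (firstReturnMap f S.X)^[ℓ] x ∈ S.X := by
  induction ℓ with
  | zero => exact ⟨rfl, hx⟩
  | succ ℓ ih =>
    rw [Function.iterate_succ_apply']
    refine ⟨?_, S.firstReturnMap_mem ih.2⟩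
    rw [visitTime, Finset.sum_range_succ, add_comm, Function.iterate_add_apply]
    change _ = f^[_] (f^[visitTime f S.X x ℓ] x)
    rw [← ih.1]
    rfl

/-- Between consecutive returns the orbit is outside `X`, where `u` vanishes; each visit to `X`
contributes at most `B`. -/
theorem sum_visitTime_le {x : M} (hx : x ∈ S.X) {u : M → ℝ} {B : ℝ} (hX : ∀ x, x ∉ S.X → u x = 0)
    (ℓ : ℕ) (hB : ∀ k < visitTime f S.X x ℓ, u (f^[k] x) ≤ B) :
    ∑ k ∈ Finset.range (visitTime f S.X x ℓ), u (f^[k] x) ≤ B * ℓ := by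
  induction ℓ with
  | zero => simp [visitTime]
  | succ ℓ ih =>
    set H := visitTime f S.X x ℓ with hH
    have hmem := S.iterate_firstReturnMap hx ℓ
    have e : visitTime f S.X x (ℓ + 1) = H +
        firstReturnTime f S.X ((firstReturnMap f S.X)^[ℓ] x) := by
      rw [visitTime, Finset.sum_range_succ]; rfl
    have h1 := S.one_le_firstReturnTime hmem.2
    set t := firstReturnTime f S.X ((firstReturnMap f S.X)^[ℓ] x) with ht
    rw [e] at hB ⊢
    rw [Finset.sum_range_add]
    have h2 := ih fun k hk => hB k (by omega)
    have h3 : ∑ k ∈ Finset.range t, u (f^[H + k] x) = u (f^[H] x) := by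
      rw [Finset.sum_eq_single_of_mem 0 (Finset.mem_range.2 h1), add_zero]
      intro k hk hk0
      rw [Finset.mem_range] at hk
      refine hX _ ?_
      rw [add_comm, Function.iterate_add_apply, hH, ← hmem.1]
      exact S.iterate_notMem (by omega) hk
    rw [h3]
    have h4 := hB H (by omega)
    push_cast
    linarith

theorem mem_X (y : S.Y) : (y : M) ∈ S.X := S.Y_subset_X y.2

theorem map_eq_iterate (y : S.Y) : (S.F y : M) = f^[S.φ y] y := by
  rw [S.modelled.map_eq, (S.iterate_firstReturnMap (S.mem_X y) _).1]
  rfl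

theorem isReturnTime_σ : IsReturnTime S.α S.σ :=
  ⟨S.modelled.time_pos, S.modelled.time_const⟩

theorem isReturnTime_φ : IsReturnTime S.α S.φ where
  pos y := by
    have h1 := S.modelled.time_pos y
    have h2 := Finset.single_le_sum (s := Finset.range (S.σ y))
      (f := fun ℓ => firstReturnTime f S.X ((firstReturnMap f S.X)^[ℓ] y))
      (fun _ _ => Nat.zero_le _) (Finset.mem_range.2 (show 0 < S.σ y by omega))
    exact (S.one_le_firstReturnTime (S.mem_X y)).trans h2
  const a ha y hy y' hy' := by
    rw [φ, φ, S.modelled.time_const a ha y' hy' y hy]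
    exact Finset.sum_congr rfl fun ℓ hℓ =>
      S.firstReturnTime_const a ha y hy y' hy' ℓ (Finset.mem_range.1 hℓ)

theorem measurable_val : Measurable (Subtype.val : S.Y → M) := measurable_subtype_coe

/-- The base is level 0 of the tower with height `S.σ`: a null set of the phase space pulls back to
a null set of the tower, and its slice at level 0 is null for the base measure. -/
theorem map_val_absolutelyContinuous : S.μY.map Subtype.val ≪ μ := by
  have hP := S.modelled.gibbsMarkov.isProbabilityMeasure
  have hgm : Measurable fun p : S.Y × ℕ => (firstReturnMap f S.X)^[p.2] (p.1 : M) :=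
    measurable_from_prod_countable_left fun n =>
      (S.modelled.ergodic.measurable.iterate n).comp S.measurable_val
  have hσm := S.modelled.gibbsMarkov.measurable_returnTime S.isReturnTime_σ
  have hint : 1 ≤ ∫ y, (S.σ y : ℝ) ∂S.μY := by
    have h1 : ∫ _, (1 : ℝ) ∂S.μY = 1 := by simp
    rw [← h1]
    exact integral_mono (integrable_const _) S.modelled.time_integrable fun y =>
      Nat.one_le_cast.2 (S.modelled.time_pos y)
  refine Measure.AbsolutelyContinuous.mk fun E hE h0 => ?_
  rw [Measure.map_apply S.measurable_val hE]
  have h1 : ProbabilityTheory.cond μ S.X E = 0 :=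
    ProbabilityTheory.cond_absolutelyContinuous h0
  rw [← S.modelled.map_towerMeasure, Measure.map_apply hgm hE, towerMeasure, Measure.smul_apply,
    smul_eq_mul, mul_eq_zero] at h1
  rcases h1 with h1 | h1
  · rw [ENNReal.ofReal_eq_zero] at h1
    have : 0 < (∫ y, (S.σ y : ℝ) ∂S.μY)⁻¹ := by positivity
    linarith
  · have h2 := Measure.restrict_apply (μ := S.μY.prod Measure.count) (s := tower S.σ) (hgm hE)
    rw [h1] at h2
    have h3 := measure_mono_null (s := (Subtype.val ⁻¹' E : Set S.Y) ×ˢ ({0} : Set ℕ))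
      (fun p hp => ?_) h2.symm
    · rw [Measure.prod_prod, Measure.count_singleton, mul_one] at h3
      exact h3
    · obtain ⟨hp1, hp2⟩ := hp
      have hp2' : p.2 = 0 := hp2
      refine ⟨?_, ?_⟩
      · change (firstReturnMap f S.X)^[p.2] (p.1 : M) ∈ E
        rw [hp2']
        exact hp1
      · change p.2 < S.σ p.1
        rw [hp2']
        exact S.modelled.time_pos _

theorem ae_forall_iterate {p : M → Prop} (hp : ∀ᵐ x ∂μ, p x) :
    ∀ᵐ y : S.Y ∂S.μY, ∀ ℓ, p (f^[ℓ] (y : M)) := by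
  rw [ae_all_iff]
  intro ℓ
  have h1 : ∀ᵐ x ∂μ, p (f^[ℓ] x) :=
    (S.ergodic.toMeasurePreserving.iterate ℓ).quasiMeasurePreserving.ae hp
  exact ae_of_ae_map S.measurable_val.aemeasurable (S.map_val_absolutelyContinuous.ae_le h1)

section Holder

variable {θ : ℝ} {v : M → ℝ} (hv : v ∈ S.dynHolder θ)

include hv

theorem ae_abs_le : ∀ᵐ x ∂μ, |v x| ≤ (eLpNorm v ∞ μ).toReal := by
  have hfin : eLpNorm v ∞ μ ≠ ∞ := (ENNReal.add_ne_top.1 hv.2.1.ne).1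
  have h1 : ∀ᵐ x ∂μ, ‖v x‖ₑ ≤ eLpNorm v ∞ μ := by
    rw [eLpNorm_exponent_top]
    exact ae_le_eLpNormEssSup
  filter_upwards [h1] with x hx
  have h2 := ENNReal.toReal_mono hfin hx
  simpa using h2

theorem abs_sub_le_dynSeminorm (hθ : 0 < θ) {y y' : S.Y} {ℓ : ℕ} (hℓ : ℓ < S.φ y) :
    |v (f^[ℓ] y) - v (f^[ℓ] y')| ≤ (S.dynSeminorm θ v).toReal * θ ^ sepTime S.F S.α y y' := by
  have hfin : S.dynSeminorm θ v ≠ ∞ := (ENNReal.add_ne_top.1 hv.2.1.ne).2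
  rcases eq_or_ne y y' with rfl | hne
  · rw [sub_self, abs_zero]; positivity
  · have h1 : ENNReal.ofReal (|v (f^[ℓ] y) - v (f^[ℓ] y')| / θ ^ sepTime S.F S.α y y') ≤
        S.dynSeminorm θ v :=
      le_iSup_of_le y <| le_iSup_of_le y' <| le_iSup_of_le hne <| le_iSup_of_le ℓ <|
        le_iSup_of_le hℓ le_rfl
    have h2 := ENNReal.toReal_mono hfin h1
    rw [ENNReal.toReal_ofReal (by positivity), div_le_iff₀ (by positivity)] at h2
    exact h2

theorem toReal_dynNorm : (S.dynNorm θ v).toReal =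
    (eLpNorm v ∞ μ).toReal + (S.dynSeminorm θ v).toReal :=
  ENNReal.toReal_add (ENNReal.add_ne_top.1 hv.2.1.ne).1 (ENNReal.add_ne_top.1 hv.2.1.ne).2

/-- The essential bound holds only almost everywhere, but atoms have positive measure. Each atom
therefore contains a point whose whole orbit obeys it, and the Hölder seminorm carries the bound to
the other points of the atom. -/
theorem abs_iterate_le_dynNorm (hθ0 : 0 < θ) (hθ1 : θ < 1) {y : S.Y} {ℓ : ℕ} (hℓ : ℓ < S.φ y) :
    |v (f^[ℓ] y)| ≤ (S.dynNorm θ v).toReal := by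
  obtain ⟨a, ha, hya⟩ := S.modelled.gibbsMarkov.exists_mem_atom y
  have h0 := S.modelled.gibbsMarkov.measure_atom_ne_zero ha
  obtain ⟨y', hy'a, hy'⟩ : ∃ y' ∈ a, ∀ ℓ, |v (f^[ℓ] (y' : M))| ≤ (eLpNorm v ∞ μ).toReal := by
    by_contra! hcon
    refine h0 (measure_mono_null (fun y' hy' => ?_) (S.ae_forall_iterate (S.ae_abs_le hv)))
    obtain ⟨ℓ, hℓ⟩ := hcon y' hy'
    exact fun hh => absurd (hh ℓ) (not_le.2 hℓ)
  have h1 := S.abs_sub_le_dynSeminorm hv hθ0 (y' := y') hℓ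
  have h2 : (S.dynSeminorm θ v).toReal * θ ^ sepTime S.F S.α y y' ≤ (S.dynSeminorm θ v).toReal :=
    mul_le_of_le_one_right ENNReal.toReal_nonneg (pow_le_one₀ hθ0.le hθ1.le)
  have h3 := hy' ℓ
  rw [S.toReal_dynNorm hv]
  have h4 := abs_add_le (v (f^[ℓ] y) - v (f^[ℓ] y')) (v (f^[ℓ] y'))
  rw [sub_add_cancel] at h4
  linarith

end Holder

/-- Sums over every `d`-th point of an orbit segment. -/
theorem sum_subsequence_le {u : M → ℝ} {B : ℝ} (hX : ∀ x, x ∉ S.X → u x = 0) (hu : ∀ x, 0 ≤ u x)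
    {y : S.Y} (hB : ∀ k < S.φ y, u (f^[k] y) ≤ B) {d r : ℕ} (hd : d ∣ S.φ y) (hr : r < d) :
    ∑ ℓ ∈ Finset.range (S.φ y / d), u (f^[d * ℓ + r] y) ≤ B * S.σ y := by
  refine le_trans ?_ (S.sum_visitTime_le (S.mem_X y) hX (S.σ y) hB)
  have h1 : ∑ ℓ ∈ Finset.range (S.φ y / d), u (f^[d * ℓ + r] y) =
      ∑ k ∈ (Finset.range (S.φ y / d)).image fun ℓ => d * ℓ + r, u (f^[k] y) := by
    rw [Finset.sum_image]
    intro i _ j _ hij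
    have : d * i = d * j := by simpa using hij
    exact Nat.eq_of_mul_eq_mul_left (by omega) this
  rw [h1]
  refine Finset.sum_le_sum_of_subset_of_nonneg (fun k hk => ?_) fun _ _ _ => hu _
  obtain ⟨ℓ, hℓ, rfl⟩ := Finset.mem_image.1 hk
  rw [Finset.mem_range] at hℓ ⊢
  change d * ℓ + r < S.φ y
  obtain ⟨c, hc⟩ := hd
  rw [hc] at hℓ ⊢
  rw [Nat.mul_div_cancel_left _ (by omega)] at hℓ
  have : d * (ℓ + 1) ≤ d * c := Nat.mul_le_mul_left _ hℓ
  rw [mul_add, mul_one] at this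
  omega

end Structure

/-! ### Dividing the return time by its common divisor -/

namespace Structure

open PowerSeries

variable {M : Type*} [MeasurableSpace M] {f : M → M} {μ : Measure M} (S : Structure f μ)

theorem nonempty_Y : Nonempty S.Y := by
  have := S.modelled.gibbsMarkov.isProbabilityMeasure
  by_contra hne
  rw [not_nonempty_iff] at hne
  exact IsProbabilityMeasure.ne_zero S.μY (Measure.eq_zero_of_isEmpty _)

theorem isReturnTime_div {d : ℕ} (hd : 1 ≤ d) (hdvd : ∀ y, d ∣ S.φ y) :
    IsReturnTime S.α fun y => S.φ y / d where
  pos y := Nat.div_pos (Nat.le_of_dvd (S.isReturnTime_φ.pos y) (hdvd y)) hd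
  const a ha y hy y' hy' := by rw [S.isReturnTime_φ.const a ha y hy y' hy']

theorem maj_returnTail {β K : ℝ} (hK : ∀ n : ℕ, 1 ≤ n → S.tail n ≤ K * (n : ℝ) ^ (-β)) :
    Maj (returnTail S.μY S.φ) (max 1 K • powSeries β) := fun n => by
  have := S.modelled.gibbsMarkov.isProbabilityMeasure
  rw [coeff_returnTail, abs_of_nonneg measureReal_nonneg, map_smul, coeff_powSeries, smul_eq_mul]
  rcases n.eq_zero_or_pos with rfl | hn
  · rw [powSeq_zero, mul_one]
    exact measureReal_le_one.trans (le_max_left _ _)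
  · rw [powSeq_of_ne (by omega)]
    refine (hK n hn).trans ?_
    gcongr
    exact le_max_right _ _

theorem coeff_returnTail_div {d : ℕ} (hd : 1 ≤ d) (hdvd : ∀ y, d ∣ S.φ y) (j : ℕ) :
    coeff (j / d) (returnTail S.μY fun y => S.φ y / d) = coeff j (returnTail S.μY S.φ) := by
  rw [coeff_returnTail, coeff_returnTail]
  congr 1
  ext y
  obtain ⟨c, hc⟩ := hdvd y
  simp only [Set.mem_ofPred_eq]
  rw [hc, Nat.mul_div_cancel_left _ (by omega), Nat.div_lt_iff_lt_mul (by omega), mul_comm]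

theorem maj_returnTail_div {d : ℕ} (hd : 1 ≤ d) (hdvd : ∀ y, d ∣ S.φ y) {β K : ℝ} (hβ : 0 ≤ β)
    (hK0 : 0 ≤ K) (hK : Maj (returnTail S.μY S.φ) (K • powSeries β)) :
    Maj (returnTail S.μY fun y => S.φ y / d) (K • powSeries β) := fun n => by
  have h1 := S.coeff_returnTail_div hd hdvd (d * n)
  rw [Nat.mul_div_cancel_left _ (by omega)] at h1
  rw [h1]
  refine (hK _).trans ?_
  simp only [map_smul, coeff_powSeries, smul_eq_mul]
  exact mul_le_mul_of_nonneg_left (powSeq_anti hβ (Nat.le_mul_of_pos_left n hd)) hK0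

theorem tsum_Ioi_tail (n : ℕ) :
    ∑' j : Set.Ioi n, S.tail j = coeff n (tailSum (returnTail S.μY S.φ)) := by
  rw [coeff_tailSum, tsum_subtype (Set.Ioi n) S.tail,
    ← (add_left_injective (n + 1)).tsum_eq (f := (Set.Ioi n).indicator S.tail)]
  · refine tsum_congr fun j => ?_
    rw [Set.indicator_of_mem (by simp; omega), coeff_returnTail, tail]
  · intro j hj
    have hj' : n < j := by
      by_contra hc
      exact hj (Set.indicator_of_notMem (by simpa using hc) _)
    exact ⟨j - (n + 1), by simp; omega⟩

section Comparison

variable {β : ℝ}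

theorem powSeq_div_le (hβ : 0 ≤ β) {d : ℕ} (hd : 1 ≤ d) (N : ℕ) :
    powSeq β (N / d) ≤ (2 * d) ^ β * powSeq β N := by
  refine powSeq_le_of_le_mul_add_one hβ (by exact_mod_cast hd) ?_
  exact_mod_cast (Nat.lt_mul_div_succ N hd).le

theorem coeff_rateSeries_div_le (hβ : 0 ≤ β) {d : ℕ} (hd : 1 ≤ d) (N : ℕ) :
    coeff (N / d) (rateSeries β) ≤ (2 * d) ^ β * coeff N (rateSeries β) := by
  rw [coeff_rateSeries, coeff_rateSeries, ← mul_assoc]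
  exact mul_le_mul (powSeq_div_le hβ hd N) (rateWeight_mono β (Nat.div_le_self N d))
    (zero_le_one.trans (one_le_rateWeight β _)) (mul_nonneg (by positivity) (powSeq_nonneg β N))

theorem tailMean_div {d : ℕ} (hd : 1 ≤ d) (hdvd : ∀ y, d ∣ S.φ y) (k : ℕ) :
    tailMean S.μY (fun y => S.φ y / d) S.σ k = S.σseq (d * k) := by
  rw [tailMean, σseq]
  congr 1
  funext y
  congr 1
  ext y
  obtain ⟨c, hc⟩ := hdvd y
  simp only [Set.mem_ofPred_eq]
  rw [hc, Nat.mul_div_cancel_left _ (by omega)]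
  exact (Nat.mul_lt_mul_left (by omega)).symm

/-- With r = N mod d, the terms of the coarse convolution match those terms of the fine one whose
first index is congruent to r mod d, and the fine terms are nonnegative. -/
theorem conv_div_le (hβ : 0 ≤ β) {d : ℕ} (hd : 1 ≤ d) (hdvd : ∀ y, d ∣ S.φ y) (N : ℕ) :
    conv (powSeq β) (tailMean S.μY (fun y => S.φ y / d) S.σ) (N / d) ≤
      (2 * d) ^ β * S.γ β N := by
  have hσ0 : ∀ n, 0 ≤ S.σseq n := tailMean_nonneg S.μY S.φ S.σ
  set n := N / d
  set r := N % d with hr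
  have hrd : r < d := Nat.mod_lt _ hd
  have hN : N = d * n + r := (Nat.div_add_mod N d).symm
  have hinj : Set.InjOn (fun j => d * j + r) (Finset.range (n + 1)) := fun i _ j _ hij => by
    have : d * i = d * j := by simpa using hij
    exact Nat.eq_of_mul_eq_mul_left hd this
  rw [γ, conv, conv, Finset.mul_sum]
  calc _ ≤ ∑ j ∈ Finset.range (n + 1),
        (2 * d) ^ β * (powSeq β (d * j + r) * S.σseq (N - (d * j + r))) := by
        refine Finset.sum_le_sum fun j hj => ?_
        have hj' : j ≤ n := by have := Finset.mem_range.1 hj; omega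
        have e : N - (d * j + r) = d * (n - j) := by
          rw [hN, Nat.mul_sub]
          omega
        rw [S.tailMean_div hd hdvd, e, ← mul_assoc]
        refine mul_le_mul_of_nonneg_right ?_ (hσ0 _)
        have h1 := powSeq_div_le hβ hd (d * j + r)
        rwa [Nat.mul_add_div hd, Nat.div_eq_of_lt hrd, add_zero] at h1
    _ = ∑ i ∈ (Finset.range (n + 1)).image (fun j => d * j + r),
        (2 * d) ^ β * (powSeq β i * S.σseq (N - i)) := by rw [Finset.sum_image hinj]
    _ ≤ _ := by
        refine Finset.sum_le_sum_of_subset_of_nonneg (fun i hi => ?_) fun i _ _ => ?_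
        · obtain ⟨j, hj, rfl⟩ := Finset.mem_image.1 hi
          have hj' : j ≤ n := by have := Finset.mem_range.1 hj; omega
          have := Nat.mul_le_mul_left d hj'
          rw [Finset.mem_range]
          omega
        · have := hσ0 (N - i)
          have := powSeq_nonneg β i
          positivity

theorem powSeq_le_γ (n : ℕ) : powSeq β n ≤ S.γ β n := by
  have := S.modelled.gibbsMarkov.isProbabilityMeasure
  exact powSeq_le_conv (tailMean_nonneg S.μY S.φ S.σ) (one_le_tailMean_zero S.isReturnTime_φ.pos
    S.modelled.time_pos S.modelled.time_integrable) n

/-- The second order term of the expansion does not depend on the period. -/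
theorem abs_sub_tailSum_div_le {d : ℕ} (hd : 1 ≤ d) (hdvd : ∀ y, d ∣ S.φ y) {K : ℝ} (hβ : 1 < β)
    (hK0 : 0 ≤ K) (hK : Maj (returnTail S.μY S.φ) (K • powSeries β)) (N : ℕ) :
    |S.φbar⁻¹ * coeff N (tailSum (returnTail S.μY S.φ)) -
      (∫ y, ((S.φ y / d : ℕ) : ℝ) ∂S.μY)⁻¹ *
        coeff (N / d) (tailSum (returnTail S.μY fun y => S.φ y / d))| ≤
      K * (2 * d) ^ β * powSeq β N := by
  have h := S.modelled.gibbsMarkov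
  have := h.isProbabilityMeasure
  have hβ0 : 0 ≤ β := by linarith
  have hK' := S.maj_returnTail_div hd hdvd hβ0 hK0 hK
  have hsum : ∀ {g : PowerSeries ℝ}, Maj g (K • powSeries β) → Summable fun n => coeff n g :=
    fun {g} hg => Summable.of_norm_bounded ((summable_powSeq hβ).mul_left K) fun n => by
      simpa using hg n
  have hD := integrable_and_hasSum_of_summable_tail (h.measurable_returnTime S.isReturnTime_φ)
    (by simpa using hsum hK)
  have hD' := integrable_and_hasSum_of_summable_tail (h.measurable_returnTime
    (S.isReturnTime_div hd hdvd)) (by simpa using hsum hK')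
  have hm' := h.one_le_of_hasSum_returnTail (S.isReturnTime_div hd hdvd) (by simpa using hD'.2)
  have hφbar : S.φbar = d * ∫ y, ((S.φ y / d : ℕ) : ℝ) ∂S.μY := by
    rw [φbar, ← integral_const_mul]
    refine integral_congr_ae (ae_of_all _ fun y => ?_)
    beta_reduce
    rw [← Nat.cast_mul, Nat.mul_div_cancel' (hdvd y)]
  set D := returnTail S.μY S.φ
  set D' := returnTail S.μY fun y => S.φ y / d with hDD
  set m := ∫ y, ((S.φ y / d : ℕ) : ℝ) ∂S.μY with hm
  set n := N / d with hn
  have hd0 : (0:ℝ) < d := by exact_mod_cast hd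
  have e1 := sum_add_coeff_tailSum (hsum hK) N
  have e2 := sum_add_coeff_tailSum (hsum hK') n
  have hs1 : ∑' i, coeff i D = d * m := by
    rw [← hφbar, φbar, ← hD.2.tsum_eq]
    exact tsum_congr fun i => coeff_returnTail _ _ _
  have hs2 : ∑' i, coeff i D' = m := by
    rw [← hD'.2.tsum_eq]
    exact tsum_congr fun i => coeff_returnTail _ _ _
  -- φ takes values in multiples of `d`, so its tails are constant on blocks of length `d`.
  have hblock : ∀ k, ∑ j ∈ Finset.range (d * k), coeff j D =
      d * ∑ i ∈ Finset.range k, coeff i D' := fun k => by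
    induction k with
    | zero => simp
    | succ k ih =>
      rw [mul_add, mul_one, Finset.sum_range_add, ih, Finset.sum_range_succ, mul_add]
      congr 1
      have : ∀ i ∈ Finset.range d, coeff (d * k + i) D = coeff k D' := fun i hi => by
        rw [← S.coeff_returnTail_div hd hdvd, Nat.mul_add_div hd,
          Nat.div_eq_of_lt (Finset.mem_range.1 hi), add_zero]
      rw [Finset.sum_congr rfl this]
      simp
  have hlt := Nat.lt_mul_div_succ N hd
  rw [← hn] at hlt
  have hle := Nat.mul_div_le N d
  rw [← hn] at hle
  have hrest : ∑ j ∈ Finset.Ico (N + 1) (d * (n + 1)), coeff j D =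
      ((d * (n + 1) - (N + 1) : ℕ) : ℝ) * coeff n D' := by
    have : ∀ j ∈ Finset.Ico (N + 1) (d * (n + 1)), coeff j D = coeff n D' := fun j hj => by
      rw [Finset.mem_Ico] at hj
      rw [← S.coeff_returnTail_div hd hdvd]
      rw [show j / d = n from le_antisymm
        (Nat.lt_succ_iff.1 ((Nat.div_lt_iff_lt_mul (by omega)).2 (by rw [mul_comm]; exact hj.2)))
        (hn ▸ Nat.div_le_div_right (by omega))]
    rw [Finset.sum_congr rfl this]
    simp
  have e3 := Finset.sum_range_add_sum_Ico (fun j => coeff j D) (show N + 1 ≤ d * (n + 1) by omega)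
  rw [hblock, hrest] at e3
  rw [hs1] at e1
  rw [hs2] at e2
  have hcnt : ((d * (n + 1) - (N + 1) : ℕ) : ℝ) ≤ d := by
    have : d * (n + 1) - (N + 1) ≤ d := by rw [mul_add, mul_one]; omega
    exact_mod_cast this
  set cnt := ((d * (n + 1) - (N + 1) : ℕ) : ℝ)
  have hcnt0 : 0 ≤ cnt := Nat.cast_nonneg _
  -- The unfinished block beyond `N` has fewer than `d` terms, all equal to the coarse tail at `n`;
  -- this is the whole discrepancy.
  have hT : coeff N (tailSum D) = d * coeff n (tailSum D') + cnt * coeff n D' := by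
    have e4 := congrArg (fun x => (d : ℝ) * x) e2
    simp only [mul_add] at e4
    linarith
  have hDn : |coeff n D'| ≤ K * ((2 * d) ^ β * powSeq β N) := by
    have h1 := hK' n
    simp only [map_smul, coeff_powSeries, smul_eq_mul] at h1
    exact h1.trans (mul_le_mul_of_nonneg_left (powSeq_div_le hβ0 hd N) hK0)
  have e5 : (d * m)⁻¹ * (d * coeff n (tailSum D') + cnt * coeff n D') - m⁻¹ * coeff n (tailSum D') =
      cnt / (d * m) * coeff n D' := by
    field_simp
    ring
  rw [hφbar, hT, e5, abs_mul]
  have h6 : |cnt / (d * m)| ≤ 1 := by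
    rw [abs_of_nonneg (by positivity), div_le_one (by positivity)]
    exact hcnt.trans (le_mul_of_one_le_right hd0.le hm')
  calc _ ≤ 1 * |coeff n D'| := mul_le_mul_of_nonneg_right h6 (abs_nonneg _)
    _ ≤ _ := by rw [one_mul, mul_assoc]; exact hDn

end Comparison

section Levels

variable [IsProbabilityMeasure μ] {d : ℕ} (hd : 1 ≤ d) (hdvd : ∀ y, d ∣ S.φ y)

include hd hdvd

/-- This is where mixing of `f` is used: `f^[d]` is ergodic, so the levels whose index is a multiple
of `d` already carry the whole of μ. -/
theorem integral_eq_integral_sum_levels (hφi : Integrable (fun y => ((S.φ y / d : ℕ) : ℝ)) S.μY)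
    {u : M → ℝ} (hu : AEStronglyMeasurable u μ) {c : ℝ} (hc : ∀ᵐ x ∂μ, |u x| ≤ c) :
    ∫ x, u x ∂μ = (∫ y, ((S.φ y / d : ℕ) : ℝ) ∂S.μY)⁻¹ *
      ∫ y : S.Y, ∑ ℓ ∈ Finset.range (S.φ y / d), u (f^[d * ℓ] (y : M)) ∂S.μY := by
  have h := S.modelled.gibbsMarkov
  have := h.isProbabilityMeasure
  have h1 := integral_eq_integral_sum_tower (T := f^[d]) (ι := Subtype.val) (F := S.F)
    (φ := fun y => S.φ y / d) (S.mixing.ergodic_iterate S.ergodic.toMeasurePreserving hd)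
    S.measurable_val S.map_val_absolutelyContinuous h.ergodic.toMeasurePreserving
    (h.measurable_returnTime (S.isReturnTime_div hd hdvd)) (S.isReturnTime_div hd hdvd).pos hφi
    (fun y => by rw [← Function.iterate_mul, Nat.mul_div_cancel' (hdvd y), S.map_eq_iterate]) hu hc
  simp only [← Function.iterate_mul] at h1
  exact h1

omit [IsProbabilityMeasure μ] in
theorem isTowerHolder_iterate {θ : ℝ} (hθ0 : 0 < θ) (hθ1 : θ < 1) {v : M → ℝ}
    (hv : v ∈ S.dynHolder θ) :
    IsTowerHolder S.F S.α (fun y => S.φ y / d) S.σ θ (fun ℓ y => v (f^[d * ℓ] (y : M)))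
      (S.dynNorm θ v).toReal := by
  have hlt : ∀ y, ∀ ℓ < S.φ y / d, d * ℓ < S.φ y := fun y ℓ hℓ => by
    have h1 := (Nat.mul_lt_mul_left (by omega : 0 < d)).2 hℓ
    rwa [Nat.mul_div_cancel' (hdvd y)] at h1
  refine ⟨ENNReal.toReal_nonneg, fun y ℓ hℓ => S.abs_iterate_le_dynNorm hv hθ0 hθ1 (hlt y ℓ hℓ),
    fun a _ y _ y' _ ℓ hℓ => (S.abs_sub_le_dynSeminorm hv hθ0 (hlt y ℓ hℓ)).trans ?_, fun y => ?_⟩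
  · rw [S.toReal_dynNorm hv]
    gcongr
    exact le_add_of_nonneg_left ENNReal.toReal_nonneg
  · have h1 := S.sum_subsequence_le (u := fun x => |v x|) (fun x hx => by rw [hv.2.2 x hx, abs_zero])
      (fun x => abs_nonneg _) (fun k hk => S.abs_iterate_le_dynNorm hv hθ0 hθ1 hk) (hdvd y)
      (show 0 < d by omega)
    simpa using h1

omit [IsProbabilityMeasure μ] hd in
theorem isTowerObservable_iterate {w : M → ℝ} {b : ℝ} (hw : Measurable w) (hw0 : ∀ x, 0 ≤ w x)
    (hwb : ∀ x, w x ≤ b) (r : ℕ) :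
    IsTowerObservable S.F (fun y => S.φ y / d) (fun k (y : S.Y) => w (f^[d * k + r] (y : M))) b where
  measurable k := hw.comp ((S.ergodic.measurable.iterate _).comp S.measurable_val)
  nonneg _ _ := hw0 _
  le _ _ := hwb _
  cocycle k y := by
    rw [S.map_eq_iterate, ← Function.iterate_add_apply]
    congr 2
    rw [mul_add, Nat.mul_div_cancel' (hdvd y)]
    ring

end Levels

end Structure

/-! ### Correlations on the phase space -/

section Correlations

variable {M : Type*} [MeasurableSpace M] {f : M → M} {μ : Measure M}

/-- An essentially bounded function is a difference of nonnegative bounded measurable functions. -/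
theorem exists_ae_eq_sub {w : M → ℝ} (hw : MemLp w ∞ μ) {E : Set M} (hE : MeasurableSet E)
    (hwE : ∀ᵐ x ∂μ, x ∉ E → w x = 0) : ∃ w₁ w₂ : M → ℝ, Measurable w₁ ∧ Measurable w₂ ∧
      (∀ x, 0 ≤ w₁ x) ∧ (∀ x, 0 ≤ w₂ x) ∧ (∀ x, w₁ x ≤ (eLpNorm w ∞ μ).toReal) ∧
      (∀ x, w₂ x ≤ (eLpNorm w ∞ μ).toReal) ∧ (∀ x, x ∉ E → w₁ x = 0) ∧ (∀ x, x ∉ E → w₂ x = 0) ∧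
      ∀ᵐ x ∂μ, w x = w₁ x - w₂ x := by
  set b := (eLpNorm w ∞ μ).toReal with hb
  have hb0 : 0 ≤ b := ENNReal.toReal_nonneg
  set g := hw.1.mk w
  have hg : Measurable g := hw.1.stronglyMeasurable_mk.measurable
  have hp0 : ∀ z, 0 ≤ max 0 (min b z) := fun z => le_max_left _ _
  have hpb : ∀ z, max 0 (min b z) ≤ b := fun z => max_le hb0 (min_le_left _ _)
  refine ⟨E.indicator fun x => max 0 (min b (g x)), E.indicator fun x => max 0 (min b (-g x)),
    (measurable_const.max (measurable_const.min hg)).indicator hE,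
    (measurable_const.max (measurable_const.min hg.neg)).indicator hE,
    fun x => Set.indicator_nonneg (fun x _ => hp0 _) x, fun x => Set.indicator_nonneg (fun x _ => hp0 _) x,
    fun x => Set.indicator_apply_le' (fun _ => hpb _) fun _ => hb0,
    fun x => Set.indicator_apply_le' (fun _ => hpb _) fun _ => hb0,
    fun x hx => Set.indicator_of_notMem hx _, fun x hx => Set.indicator_of_notMem hx _, ?_⟩
  have h1 : ∀ᵐ x ∂μ, |w x| ≤ b := by
    have h2 : ∀ᵐ x ∂μ, ‖w x‖ₑ ≤ eLpNorm w ∞ μ := by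
      rw [eLpNorm_exponent_top]
      exact ae_le_eLpNormEssSup
    filter_upwards [h2] with x hx
    have h3 := ENNReal.toReal_mono hw.2.ne hx
    rwa [toReal_enorm, Real.norm_eq_abs] at h3
  filter_upwards [h1, hwE, hw.1.ae_eq_mk] with x hx1 hx2 hx3
  have hx4 : g x = w x := hx3.symm
  by_cases hx : x ∈ E
  · rw [Set.indicator_of_mem hx, Set.indicator_of_mem hx, hx4]
    have h5 := abs_le.1 hx1
    rw [min_eq_right h5.2, min_eq_right (show -w x ≤ b by linarith)]
    rcases le_total 0 (w x) with h6 | h6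
    · rw [max_eq_right h6, max_eq_left (by linarith), sub_zero]
    · rw [max_eq_left h6, max_eq_right (by linarith)]
      ring
  · rw [Set.indicator_of_notMem hx, Set.indicator_of_notMem hx, hx2 hx, sub_zero]

theorem corr_eq_sub [IsProbabilityMeasure μ] (hf : MeasurePreserving f μ μ) {v w w₁ w₂ : M → ℝ} {c b : ℝ}
    (hv : AEStronglyMeasurable v μ) (hc : ∀ᵐ x ∂μ, |v x| ≤ c) (h₁ : Measurable w₁)
    (h₂ : Measurable w₂) (hb₁ : ∀ x, |w₁ x| ≤ b) (hb₂ : ∀ x, |w₂ x| ≤ b)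
    (hw : ∀ᵐ x ∂μ, w x = w₁ x - w₂ x) (n : ℕ) :
    corr f μ v w n = corr f μ v w₁ n - corr f μ v w₂ n ∧
      ∫ x, w x ∂μ = ∫ x, w₁ x ∂μ - ∫ x, w₂ x ∂μ := by
  have hvi : Integrable v μ := Integrable.of_bound hv c (by simpa using hc)
  have hint : ∀ {u : M → ℝ}, Measurable u → (∀ x, |u x| ≤ b) → Integrable u μ := fun hu hub =>
    Integrable.of_bound hu.aestronglyMeasurable b (ae_of_all _ hub)
  have hprod : ∀ {u : M → ℝ}, Measurable u → (∀ x, |u x| ≤ b) →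
      Integrable (fun x => v x * u (f^[n] x)) μ := fun hu hub =>
    hvi.mul_bdd (hu.comp (hf.measurable.iterate n)).aestronglyMeasurable (ae_of_all _ fun x => hub _)
  have h3 : ∫ x, w x ∂μ = ∫ x, w₁ x ∂μ - ∫ x, w₂ x ∂μ := by
    rw [integral_congr_ae hw, integral_sub (hint h₁ hb₁) (hint h₂ hb₂)]
  refine ⟨?_, h3⟩
  have h4 : ∀ᵐ x ∂μ, w (f^[n] x) = w₁ (f^[n] x) - w₂ (f^[n] x) :=
    (hf.iterate n).quasiMeasurePreserving.ae hw
  have h5 : ∫ x, v x * w (f^[n] x) ∂μ =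
      ∫ x, v x * w₁ (f^[n] x) ∂μ - ∫ x, v x * w₂ (f^[n] x) ∂μ := by
    rw [← integral_sub (hprod h₁ hb₁) (hprod h₂ hb₂)]
    refine integral_congr_ae ?_
    filter_upwards [h4] with x hx
    rw [hx, mul_sub]
  rw [corr, corr, corr, h3, h5]
  ring

end Correlations

namespace Structure

open PowerSeries

variable {M : Type*} [MeasurableSpace M] {f : M → M} {μ : Measure M} [IsProbabilityMeasure μ]
  (S : Structure f μ)

/-- Correlation bounds for nonnegative bounded observables `w`. -/
theorem exists_abs_corr_le_of_nonneg {θ : ℝ} (hθ₀ : 0 < θ) (hθ₁ : θ < 1) {β K : ℝ} (hβ : 1 < β)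
    (hK : ∀ n : ℕ, 1 ≤ n → S.tail n ≤ K * (n : ℝ) ^ (-β)) :
    ∃ C : ℝ, 0 < C ∧ ∀ n : ℕ, 1 ≤ n → ∀ v ∈ S.dynHolder θ, ∀ (w : M → ℝ) (b : ℝ), Measurable w →
      (∀ x, 0 ≤ w x) → (∀ x, w x ≤ b) →
      ((∀ x, x ∉ S.X → w x = 0) →
        |corr f μ v w n - S.φbar⁻¹ * (∑' j : Set.Ioi n, S.tail j) *
          ((∫ x, v x ∂μ) * ∫ x, w x ∂μ)| ≤
          C * (S.dynNorm θ v).toReal * b * (S.γ β n + zeta β n)) ∧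
      (∫ x, v x ∂μ = 0 → |corr f μ v w n| ≤ C * (S.dynNorm θ v).toReal * b * S.γ β n) := by
  have h := S.modelled.gibbsMarkov
  have hP := h.isProbabilityMeasure
  have := S.nonempty_Y
  have hβ0 : 0 ≤ β := by linarith
  obtain ⟨d, hd, hdvd, haper⟩ := exists_aperiodic_div S.isReturnTime_φ.pos
  have hφ' := S.isReturnTime_div hd hdvd
  set K₀ := max 1 K
  have hK₀ : 0 ≤ K₀ := zero_le_one.trans (le_max_left _ _)
  have htl := S.maj_returnTail hK
  have htl' := S.maj_returnTail_div hd hdvd hβ0 hK₀ htl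
  have hsum : Summable fun n => S.μY.real {y | n < S.φ y / d} :=
    Summable.of_norm_bounded ((summable_powSeq hβ).mul_left K₀) fun n => by simpa using htl' n
  obtain ⟨hφi, hm⟩ := integrable_and_hasSum_of_summable_tail (h.measurable_returnTime hφ') hsum
  have hm' : HasSum (fun n => coeff n (returnTail S.μY fun y => S.φ y / d))
      (∫ y, ((S.φ y / d : ℕ) : ℝ) ∂S.μY) := by simpa using hm
  have hm1 := h.one_le_of_hasSum_returnTail hφ' hm'
  obtain ⟨C₁, hC₁, h₁⟩ := h.exists_abs_towerCorr_expansion_le hφ' hβ htl' haper hθ₀ hθ₁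
    S.modelled.time_pos S.modelled.time_integrable hm'
  obtain ⟨C₂, hC₂, h₂⟩ := h.exists_abs_towerCorr_sub_le hφ' hβ htl' haper hθ₀ hθ₁
    S.modelled.time_pos S.modelled.time_integrable
  obtain ⟨C₃, hC₃, h₃⟩ := exists_rate_le_zeta hβ
  have hd0 : (0:ℝ) < d := by exact_mod_cast hd
  set D := (2 * (d : ℝ)) ^ β
  have hD0 : 0 < D := by positivity
  set m := ∫ y, ((S.φ y / d : ℕ) : ℝ) ∂S.μY with hm_def
  have hm0 : 0 < m := by linarith
  refine ⟨C₁ * (D + D * C₃) + K₀ * D + C₂ * D, by positivity,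
    fun N hN v hv w b hw hw0 hwb => ?_⟩
  obtain ⟨x₀⟩ : Nonempty M := ⟨(Classical.arbitrary S.Y : M)⟩
  have hb : 0 ≤ b := (hw0 x₀).trans (hwb x₀)
  set B := (S.dynNorm θ v).toReal with hB_def
  have hB : 0 ≤ B := ENNReal.toReal_nonneg
  set n := N / d
  set r := N % d
  have hrd : r < d := Nat.mod_lt _ hd
  -- The remainder `r` is absorbed into the observable `w ∘ f^[r]`, whose mean is that of `w` by
  -- invariance.
  have hNn : N = d * n + r := (Nat.div_add_mod N d).symm
  have hTv := S.isTowerHolder_iterate hd hdvd hθ₀ hθ₁ hv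
  have hTw := S.isTowerObservable_iterate hdvd hw hw0 hwb r
  have hf := S.ergodic.toMeasurePreserving
  have hvc := S.ae_abs_le hv
  have hwabs : ∀ x, |w x| ≤ b := fun x => by rw [abs_of_nonneg (hw0 x)]; exact hwb x
  -- the integrals in terms of the tower
  have hVint := S.integral_eq_integral_sum_levels hd hdvd hφi hv.1 hvc
  have hWint : ∫ x, w x ∂μ = m⁻¹ *
      ∫ y : S.Y, ∑ k ∈ Finset.range (S.φ y / d), w (f^[d * k + r] (y : M)) ∂S.μY := by
    have h1 : ∫ x, w x ∂μ = ∫ x, w (f^[r] x) ∂μ := by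
      conv_lhs => rw [← (hf.iterate r).map_eq]
      exact integral_map (hf.iterate r).measurable.aemeasurable hw.aestronglyMeasurable
    rw [h1, S.integral_eq_integral_sum_levels (u := fun x => w (f^[r] x)) hd hdvd hφi
      (hw.comp (hf.measurable.iterate r)).aestronglyMeasurable (ae_of_all _ fun x => hwabs _)]
    simp only [← Function.iterate_add_apply, Nat.add_comm r]
    rfl
  have hIint : ∫ x, v x * w (f^[N] x) ∂μ = m⁻¹ *
      ∫ y : S.Y, ∑ ℓ ∈ Finset.range (S.φ y / d),
        v (f^[d * ℓ] (y : M)) * w (f^[d * (n + ℓ) + r] (y : M)) ∂S.μY := by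
    rw [S.integral_eq_integral_sum_levels (u := fun x => v x * w (f^[N] x)) hd hdvd hφi
      (hv.1.mul (hw.comp (hf.measurable.iterate N)).aestronglyMeasurable)
      (c := (eLpNorm v ∞ μ).toReal * b) (by
        filter_upwards [hvc] with x hx
        rw [abs_mul]
        exact mul_le_mul hx (hwabs _) (abs_nonneg _) ENNReal.toReal_nonneg)]
    have e : ∀ ℓ, N + d * ℓ = d * (n + ℓ) + r := fun ℓ => by rw [hNn]; ring
    simp only [← Function.iterate_add_apply, e]
    rfl
  have hVB : |∫ x, v x ∂μ| ≤ B := by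
    have h1 := norm_integral_le_of_norm_le_const (μ := μ) (f := v)
      (C := (eLpNorm v ∞ μ).toReal) (by simpa using hvc)
    rw [probReal_univ, mul_one, Real.norm_eq_abs] at h1
    refine h1.trans ?_
    rw [hB_def, S.toReal_dynNorm hv]
    exact le_add_of_nonneg_right ENNReal.toReal_nonneg
  have hWb : |∫ x, w x ∂μ| ≤ b := by
    have h1 := norm_integral_le_of_norm_le_const (μ := μ) (f := w) (C := b)
      (ae_of_all _ hwabs)
    rwa [probReal_univ, mul_one, Real.norm_eq_abs] at h1
  set V := ∫ x, v x ∂μ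
  set W := ∫ x, w x ∂μ
  have hγ := S.powSeq_le_γ (β := β) N
  have ha := powSeq_nonneg β N
  have hconv := S.conv_div_le hβ0 hd hdvd N
  have hBb : 0 ≤ B * b := by positivity
  have hγ0 : 0 ≤ S.γ β N := ha.trans hγ
  refine ⟨fun hwX => ?_, fun hV0 => ?_⟩
  -- Since `w` vanishes off `X`, its column sums are also controlled by σ, even along the shifted
  -- progression with residue `r`.
  · have i1 := h₁ _ B _ b hTv hTw
      (fun y => S.sum_subsequence_le hwX hw0 (fun k _ => hwb _) (hdvd y) hrd) n
    rw [← hVint, ← hWint, ← hIint] at i1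
    have i2 := S.abs_sub_tailSum_div_le hd hdvd hβ hK₀ htl N
    rw [← S.tsum_Ioi_tail] at i2
    have i3 := coeff_rateSeries_div_le hβ0 hd N
    rw [coeff_rateSeries β N] at i3
    have i4 := h₃ N hN
    have hz : 0 ≤ zeta β N := by
      rw [zeta]
      split_ifs
      · positivity
      · exact mul_nonneg (by positivity) (Real.log_natCast_nonneg N)
      · positivity
    set t := coeff n (tailSum (returnTail S.μY fun y => S.φ y / d))
    set R := S.φbar⁻¹ * ∑' j : Set.Ioi N, S.tail j
    set I := ∫ x, v x * w (f^[N] x) ∂μ with hI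
    have e : corr f μ v w N - R * (V * W) =
        (I - V * W * (1 + m⁻¹ * t)) - (V * W) * (R - m⁻¹ * t) := by
      rw [corr]; ring
    rw [e]
    have i5 : |V * W * (R - m⁻¹ * t)| ≤ B * b * (K₀ * D * powSeq β N) := by
      rw [abs_mul, abs_mul]
      exact mul_le_mul (mul_le_mul hVB hWb (abs_nonneg _) hB) i2 (abs_nonneg _) hBb
    have i6 : C₁ * B * b * (conv (powSeq β) (tailMean S.μY (fun y => S.φ y / d) S.σ) n +
        coeff n (rateSeries β)) ≤ C₁ * B * b * (D * S.γ β N + D * (C₃ * (S.γ β N + zeta β N))) := by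
      have j1 : coeff n (rateSeries β) ≤ D * (C₃ * (S.γ β N + zeta β N)) := by
        refine i3.trans (mul_le_mul_of_nonneg_left (i4.trans ?_) hD0.le)
        gcongr
      gcongr
    have i7 : B * b * (K₀ * D * powSeq β N) ≤ B * b * (K₀ * D * (S.γ β N + zeta β N)) := by
      gcongr
      linarith
    have i8 : 0 ≤ C₁ * B * b * D * zeta β N := by positivity
    have i9 : 0 ≤ C₂ * D * B * b * (S.γ β N + zeta β N) := by positivity
    have i10 := abs_add_le (I - V * W * (1 + m⁻¹ * t)) (-(V * W * (R - m⁻¹ * t)))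
    rw [← sub_eq_add_neg, abs_neg] at i10
    linarith
  · have i1 := h₂ _ B _ b hTv hTw n
    have hs0 : ∫ y : S.Y, ∑ ℓ ∈ Finset.range (S.φ y / d), v (f^[d * ℓ] (y : M)) ∂S.μY = 0 := by
      have := hVint
      rw [hV0] at this
      exact (mul_eq_zero.1 this.symm).resolve_left (inv_ne_zero hm0.ne')
    rw [hs0, zero_mul, sub_zero] at i1
    have hm2 : m⁻¹ ≤ 1 := inv_le_one_of_one_le₀ hm1
    have e : corr f μ v w N = ∫ x, v x * w (f^[N] x) ∂μ := by
      change _ - V * W = _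
      rw [hV0, zero_mul, sub_zero]
    rw [e, hIint, abs_mul, abs_of_nonneg (inv_nonneg.2 hm0.le)]
    refine (mul_le_of_le_one_left (abs_nonneg _) hm2).trans (i1.trans ?_)
    have i2 : C₂ * B * b * conv (powSeq β) (tailMean S.μY (fun y => S.φ y / d) S.σ) n ≤
        C₂ * B * b * (D * S.γ β N) := by gcongr
    have i3 : 0 ≤ (C₁ * (D + D * C₃) + K₀ * D) * B * b * S.γ β N := by positivity
    linarith

end Structure

end CMZ

end

theorem theorem3p1 {M : Type*} [MeasurableSpace M] (f : M → M) (μ : Measure M)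
    [IsProbabilityMeasure μ] (S : CMZ.Structure f μ)
    (θ : ℝ) (hθ₀ : 0 < θ) (hθ₁ : θ < 1)
    (β' : ℝ) (hβ' : 1 < β')
    (htail : ∃ K : ℝ, ∀ n : ℕ, 1 ≤ n → S.tail n ≤ K * (n : ℝ) ^ (-β')) :
    ∃ C : ℝ, 0 < C ∧ ∀ n : ℕ, 1 ≤ n →
      (∀ v ∈ S.dynHolder θ, ∀ w : M → ℝ, MemLp w ∞ μ → (∀ᵐ x ∂μ, x ∉ S.X → w x = 0) →
        |CMZ.corr f μ v w n -
            S.φbar⁻¹ * (∑' j : Set.Ioi n, S.tail j) * ((∫ x, v x ∂μ) * ∫ x, w x ∂μ)| ≤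
          C * (S.dynNorm θ v).toReal * (eLpNorm w ∞ μ).toReal *
            (S.γ β' n + CMZ.zeta β' n)) ∧
      (∀ v ∈ S.dynHolder θ, ∫ x, v x ∂μ = 0 → ∀ w : M → ℝ, MemLp w ∞ μ →
        |CMZ.corr f μ v w n| ≤
          C * (S.dynNorm θ v).toReal * (eLpNorm w ∞ μ).toReal * S.γ β' n) := by
  obtain ⟨K, hK⟩ := htail
  obtain ⟨C, hC, H⟩ := S.exists_abs_corr_le_of_nonneg hθ₀ hθ₁ hβ' hK
  -- The factor 2 accounts for the positive and negative parts of `w`.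
  refine ⟨2 * C, by positivity, fun n hn => ⟨fun v hv w hw hwX => ?_, fun v hv hv0 w hw => ?_⟩⟩
  · obtain ⟨w₁, w₂, hm₁, hm₂, h0₁, h0₂, hb₁, hb₂, hX₁, hX₂, hae⟩ :=
      CMZ.exists_ae_eq_sub hw S.measurableSet_X hwX
    obtain ⟨e1, e2⟩ := CMZ.corr_eq_sub S.ergodic.toMeasurePreserving hv.1 (S.ae_abs_le hv) hm₁ hm₂
      (fun x => by rw [abs_of_nonneg (h0₁ x)]; exact hb₁ x)
      (fun x => by rw [abs_of_nonneg (h0₂ x)]; exact hb₂ x) hae n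
    have i1 := (H n hn v hv w₁ _ hm₁ h0₁ hb₁).1 hX₁
    have i2 := (H n hn v hv w₂ _ hm₂ h0₂ hb₂).1 hX₂
    rw [e1, e2]
    rw [abs_le] at i1 i2 ⊢
    constructor <;> linarith [i1.1, i1.2, i2.1, i2.2]
  · obtain ⟨w₁, w₂, hm₁, hm₂, h0₁, h0₂, hb₁, hb₂, -, -, hae⟩ :=
      CMZ.exists_ae_eq_sub hw MeasurableSet.univ (ae_of_all _ fun x hx => absurd (Set.mem_univ x) hx)
    obtain ⟨e1, -⟩ := CMZ.corr_eq_sub S.ergodic.toMeasurePreserving hv.1 (S.ae_abs_le hv) hm₁ hm₂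
      (fun x => by rw [abs_of_nonneg (h0₁ x)]; exact hb₁ x)
      (fun x => by rw [abs_of_nonneg (h0₂ x)]; exact hb₂ x) hae n
    have i1 := (H n hn v hv w₁ _ hm₁ h0₁ hb₁).2 hv0
    have i2 := (H n hn v hv w₂ _ hm₂ h0₂ hb₂).2 hv0
    rw [e1]
    rw [abs_le] at i1 i2 ⊢
    constructor <;> linarith [i1.1, i1.2, i2.1, i2.2]
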